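/- Let $d\ge 1$ and $p_d=\frac{2d-2}{d+1}$. Let $1<p<p_d$ (which forces $d\ge4$) and let $\varepsilon$ be a real number with $\varepsilon<(d-1)\big(\frac1p-\frac1{p_d}\big)$. Let $\psi_\circ:\mathbb R^d\to\mathbb C$ be a radial $C^\infty$ function supported in $\{|x|\le 1/10\}$ whose Fourier transform vanishes to order $20d$ at the origin (all its derivatives of order less than $20d$ vanish there), and put $\psi=\psi_\circ*\psi_\circ$. For $s\in\mathbb Z$ and a function $f$ on $\mathbb R^d$ write $f_s(x)=2^{sd}f(2^sx)$; for $\nu\in\mathbb Z$ let $\mathcal W^\nu$ be the tiling of $\mathbb R^d$ by the dyadic cubes $\prod_{i=1}^d[z_i2^\nu,(z_i+1)2^\nu)$, $z\in\mathbb Z^d$. Then there is a constant $C<\infty$, depending only on $d,p,\varepsilon$ and $\psi_\circ$, such that for every integer $\ell\ge0$, every radial $K\in L^p(\mathbb R^d)$ vanishing outside $\{x:|x|>2^\ell\}$, every $s\in\mathbb Z$ and every measurable $g:\mathbb R^d\to\mathbb C$, $$\big\|\psi_s*K_s*g\big\|_p\le C\,\|K\|_p\,2^{-\ell\varepsilon}\Big(\sum_{W\in\mathcal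 W^{\ell-s}}|W|\,\|g\chi_W\|_\infty^p\Big)^{1/p}.$$ Here $\psi_s*K_s*g=\psi_s*(K_s*g)$, and whenever the sum on the right is finite, the integrals defining $K_s*g$ and $\psi_s*(K_s*g)$ converge absolutely at every point. -/

import Mathlib

open MeasureTheory
open scoped ENNReal NNReal ContDiff Convolution FourierTransform

namespace RadialMultiplier

/-- `f` is radial: `f x` depends only on `|x|`. -/
def IsRadial {d : ℕ} (f : EuclideanSpace ℝ (Fin d) → ℂ) : Prop :=
  ∀ x y : EuclideanSpace ℝ (Fin d), ‖x‖ = ‖y‖ → f x = f y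

/-- Convolution of complex-valued functions on `ℝ^d`: `(f * g)(x) = ∫ f(t) g(x - t) dt`. -/
noncomputable def conv {d : ℕ} (f g : EuclideanSpace ℝ (Fin d) → ℂ) :
    EuclideanSpace ℝ (Fin d) → ℂ :=
  f ⋆[ContinuousLinearMap.mul ℝ ℂ, volume] g

/-- The integral defining `(f * g)(x)` converges absolutely for every `x`. -/
def ConvExists {d : ℕ} (f g : EuclideanSpace ℝ (Fin d) → ℂ) : Prop :=
  ConvolutionExists f g (ContinuousLinearMap.mul ℝ ℂ) volume

/-- The `L^1`-normalized dilate `f_s(x) = 2^{sd} f(2^s x)`. -/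
noncomputable def dilate {d : ℕ} (s : ℤ) (f : EuclideanSpace ℝ (Fin d) → ℂ) :
    EuclideanSpace ℝ (Fin d) → ℂ :=
  fun x => (2 : ℂ) ^ (s * (d : ℤ)) * f ((2 : ℝ) ^ s • x)

/-- The exponent `p_d = (2d - 2) / (d + 1)`. -/
noncomputable def criticalExponent (d : ℕ) : ℝ := (2 * (d : ℝ) - 2) / ((d : ℝ) + 1)

/-- The functions `ψ₀` allowed in the construction of `ψ = ψ₀ * ψ₀`: radial, smooth, supported in
the ball of radius `1/10` about the origin, with Fourier transform vanishing to order `20 d` at the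
origin. -/
structure IsAdmissible {d : ℕ} (ψ₀ : EuclideanSpace ℝ (Fin d) → ℂ) : Prop where
  radial : IsRadial ψ₀
  smooth : ContDiff ℝ ∞ ψ₀
  support_subset : Function.support ψ₀ ⊆ Metric.closedBall 0 (1 / 10)
  fourier_vanishes : ∀ k : ℕ, k < 20 * d → iteratedFDeriv ℝ k (𝓕 ψ₀) 0 = 0

/-- The dyadic cube `∏ᵢ [zᵢ 2^ν, (zᵢ + 1) 2^ν)`; for fixed `ν`, the family indexed by `z ∈ ℤ^d` is
the tiling `𝒲^ν` of `ℝ^d`. -/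
def dyadicCube {d : ℕ} (ν : ℤ) (z : Fin d → ℤ) : Set (EuclideanSpace ℝ (Fin d)) :=
  {x | ∀ i, (z i : ℝ) * (2 : ℝ) ^ ν ≤ x i ∧ x i < ((z i : ℝ) + 1) * (2 : ℝ) ^ ν}

/-- `(∑_{W ∈ 𝒲^ν} meas(W) ‖g χ_W‖_∞^p)^{1/p}`, with the essential supremum norm, as an extended
nonnegative number. -/
noncomputable def cubeNorm {d : ℕ} (p : ℝ) (ν : ℤ) (g : EuclideanSpace ℝ (Fin d) → ℂ) : ℝ≥0∞ :=
  (∑' z : Fin d → ℤ, volume (dyadicCube ν z) *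
    (eLpNorm ((dyadicCube ν z).indicator g) ∞ volume) ^ p) ^ (1 / p)

end RadialMultiplier

/-! Dilation reduces everything to `s = 0`. Write β = (d-1)/2 and K(x) = κ(|x|). In polar
coordinates ψ*K*g is the superposition of the functions F_r(· - y) with density g(y)κ(r) with
respect to r^{d-1} dy dr, where F_r = σ_r*ψ is a smoothed sphere of radius r; `sphOp` is this
operator for a general density h(y, r), and here r > 2^ℓ ≥ 1. All estimates rest on the decay of the
Fourier transform of the sphere (`exists_besselFun_decay`). Since σ_r is normalized to mass
independent of r, convolution with F_r has norm O(r^{-β}) on L², and the inner product of F_r(· - y)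
with F_{r'}(· - y') is O((r r' |y - y'|)^{-β}). The vanishing of the Fourier transform of ψ₀ at the
origin makes both bounds uniform in the frequency.

The theorem is an interpolation (`exists_lintegral_sphOp_rpow_le`) between two bounds for `sphOp`.
One is a weak type (q, q) bound without gain, for q below p_d (`exists_weak_le`). The other is an L¹
bound with gain 2^{-ℓβ} for densities dominated by a function constant in y on cubes of side 2^ℓ
(`exists_lintegral_sphOp_le`). That domination is why the right side carries the supremum of g on
each cube. The resulting gain is 2^{-ℓθ} with θ = β(q-p)/(p(q-1)). As q tends to p_d this tends to a
number at least (d-1)(1/p - 1/p_d), because p_d ≤ 2.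

For the L¹ gain, take one radius r ≥ 2^ℓ and one cube. The convolution lives in a shell of thickness
about 2^ℓ about a sphere of radius r, and Cauchy-Schwarz on that shell together with the L² bound
gives 2^{-ℓβ} (`exists_lintegral_cube_le`).

For the weak type bound at height 1, the part |h| > 1 is handled in L¹. Boxes of side 2^m in which
|h|^q has mass above 2^{m(1+δ)} generate spheres covering a set of controlled volume
(`exists_volume_iUnion_boxShell_le`), which is discarded. What remains is cut into levels |h| ~
2^{-j}; after normalization each level has box mass at most u 2^{m(1+δ)} with u ~ 2^{jq}, and an L²
bound with constant u^{1/(β-δ)} applies (`exists_lintegral_sphOp_sq_le`). Chebyshev's inequality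
sums over j when q(1 + 1/(β-δ)) < 2, which for δ → 0 is exactly q < p_d.

The L² bound expands the square. Radii within 4L of each other cost a factor L. For the other pairs,
the total interaction with one fixed larger sphere is O(u L^{-(β-1-δ)}) (`exists_interaction_le`);
this needs β > 1, that is d ≥ 4. The choice L = u^{1/(β-δ)} balances the two. -/

namespace RadialMultiplier

/-! ### Rotation invariance of surface measure and polar coordinates. -/

/-- Euclidean space `ℝ^d`. -/
abbrev Euc (d : ℕ) : Type := EuclideanSpace ℝ (Fin d)

/-- The unit sphere of `ℝ^d`. -/
abbrev Sph (d : ℕ) : Set (Euc d) := Metric.sphere (0 : Euc d) 1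

/-- Surface measure on the unit sphere of `ℝ^d`. -/
noncomputable abbrev sphereMeasure (d : ℕ) :
    Measure (Sph d) :=
  (volume : Measure (Euc d)).toSphere

/-- A linear isometry restricted to the unit sphere. -/
noncomputable def sphereMap {d : ℕ} (R : Euc d ≃ₗᵢ[ℝ] Euc d)
    (θ : Sph d) :
    Sph d :=
  ⟨R θ, by simp⟩

lemma measurable_sphereMap {d : ℕ}
    (R : Euc d ≃ₗᵢ[ℝ] Euc d) :
    Measurable (sphereMap R) :=
  (R.continuous.comp continuous_subtype_val).measurable.subtype_mk

-- `toSphere` measures a set by the volume of the cone over it, and a linear isometry carries cones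
-- to cones and preserves volume.
open scoped Pointwise in
lemma measurePreserving_sphereMap {d : ℕ}
    (R : Euc d ≃ₗᵢ[ℝ] Euc d) :
    MeasurePreserving (sphereMap R) (sphereMeasure d) (sphereMeasure d) := by
  refine ⟨measurable_sphereMap R, ?_⟩
  ext s hs
  rw [Measure.map_apply (measurable_sphereMap R) hs,
    Measure.toSphere_apply' _ (measurable_sphereMap R hs), Measure.toSphere_apply' _ hs]
  congr 1
  have h1 : (R ⁻¹' (Set.Ioo (0 : ℝ) 1 • ((↑) '' s : Set (Euc d)))) =
      Set.Ioo (0 : ℝ) 1 • ((↑) '' (sphereMap R ⁻¹' s) : Set (Euc d)) := by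
    ext x
    simp only [Set.mem_preimage, Set.mem_smul, Set.mem_image]
    constructor
    · rintro ⟨r, hr, _, ⟨θ, hθ, rfl⟩, h⟩
      refine ⟨r, hr, R.symm θ, ⟨⟨R.symm θ, by simp⟩, ?_, rfl⟩, ?_⟩
      · simpa [sphereMap] using hθ
      · rw [← R.symm_apply_apply x, ← h]; simp
    · rintro ⟨r, hr, _, ⟨θ, hθ, rfl⟩, rfl⟩
      exact ⟨r, hr, R θ, ⟨_, hθ, rfl⟩, by simp⟩
  rw [← h1]
  exact R.measurePreserving.measure_preimage_equiv (f := R.toMeasurableEquiv) _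

lemma integral_sphereMap {d : ℕ} {F : Type*} [NormedAddCommGroup F] [NormedSpace ℝ F]
    (R : Euc d ≃ₗᵢ[ℝ] Euc d)
    (f : Euc d → F) :
    ∫ θ : Sph d, f (R θ) ∂sphereMeasure d =
      ∫ θ : Sph d, f θ ∂sphereMeasure d := by
  have hemb : MeasurableEmbedding (sphereMap R) := by
    refine MeasurableEmbedding.of_measurable_inverse (g := sphereMap R.symm)
      (measurable_sphereMap R) ?_ (measurable_sphereMap _) ?_
    · rw [Set.range_eq_univ.2]
      · exact MeasurableSet.univ
      · exact fun θ => ⟨sphereMap R.symm θ, by ext1; simp [sphereMap]⟩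
    · intro θ; ext1; simp [sphereMap]
  exact (measurePreserving_sphereMap R).integral_comp hemb (fun θ => f θ)

/-- Polar coordinates for lower integrals. -/
lemma lintegral_polar {d : ℕ} (hd : 0 < d) {f : Euc d → ℝ≥0∞}
    (hf : Measurable f) :
    ∫⁻ x, f x = ∫⁻ r in Set.Ioi (0 : ℝ), ENNReal.ofReal (r ^ (d - 1)) *
      ∫⁻ θ : Sph d, f (r • (θ : Euc d))
        ∂sphereMeasure d := by
  have : Nonempty (Fin d) := ⟨⟨0, hd⟩⟩
  have : Nontrivial (Euc d) := inferInstance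
  have h0 : ∫⁻ x, f x = ∫⁻ x : ({0}ᶜ : Set (Euc d)), f x
      ∂((volume : Measure (Euc d)).comap (↑)) := by
    rw [lintegral_subtype_comap (measurableSet_singleton _).compl, restrict_compl_singleton]
  have hmp := (volume : Measure (Euc d)).measurePreserving_homeomorphUnitSphereProd
  rw [finrank_euclideanSpace_fin] at hmp
  have h1 : ∫⁻ x : ({0}ᶜ : Set (Euc d)), f x
      ∂((volume : Measure (Euc d)).comap (↑)) =
      ∫⁻ q : Sph d × Set.Ioi (0 : ℝ),
        f ((q.2 : ℝ) • (q.1 : Euc d))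
        ∂((sphereMeasure d).prod (Measure.volumeIoiPow (d - 1))) := by
    rw [← hmp.lintegral_comp_emb (Homeomorph.measurableEmbedding _)]
    refine lintegral_congr fun x => ?_
    congr 1
    have := congrArg Subtype.val ((homeomorphUnitSphereProd (Euc d)).symm_apply_apply x)
    rw [homeomorphUnitSphereProd_symm_apply_coe] at this
    exact this.symm
  have hm : Measurable fun q : Sph d × Set.Ioi (0 : ℝ) =>
        f ((q.2 : ℝ) • (q.1 : Euc d)) := by
    apply hf.comp; fun_prop
  rw [h0, h1, lintegral_prod_symm _ hm.aemeasurable, Measure.volumeIoiPow,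
    lintegral_withDensity_eq_lintegral_mul _ (by fun_prop) (by exact hm.lintegral_prod_left')]
  simp only [Pi.mul_apply]
  rw [lintegral_subtype_comap measurableSet_Ioi
    (fun r : ℝ => ENNReal.ofReal (r ^ (d - 1)) *
      ∫⁻ θ : Sph d, f (r • (θ : Euc d))
        ∂sphereMeasure d)]

/-- Polar coordinates for Bochner integrals. -/
lemma integral_polar {d : ℕ} (hd : 0 < d) {f : Euc d → ℂ}
    (hf : Integrable f) :
    ∫ x, f x = ∫ r in Set.Ioi (0 : ℝ), ((r ^ (d - 1) : ℝ) : ℂ) *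
      ∫ θ : Sph d, f (r • (θ : Euc d))
        ∂sphereMeasure d := by
  have : Nonempty (Fin d) := ⟨⟨0, hd⟩⟩
  have : Nontrivial (Euc d) := inferInstance
  have h0 : ∫ x, f x = ∫ x : ({0}ᶜ : Set (Euc d)), f x
      ∂((volume : Measure (Euc d)).comap (↑)) := by
    rw [integral_subtype_comap (measurableSet_singleton _).compl, restrict_compl_singleton]
  have hmp := (volume : Measure (Euc d)).measurePreserving_homeomorphUnitSphereProd
  rw [finrank_euclideanSpace_fin] at hmp
  have hcoe : ∀ x : ({0}ᶜ : Set (Euc d)),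
      f x = f ((((homeomorphUnitSphereProd (Euc d)) x).2 : ℝ) •
        (((homeomorphUnitSphereProd (Euc d)) x).1 : Euc d)) := by
    intro x
    congr 1
    have := congrArg Subtype.val ((homeomorphUnitSphereProd (Euc d)).symm_apply_apply x)
    rw [homeomorphUnitSphereProd_symm_apply_coe] at this
    exact this.symm
  have h1 : ∫ x : ({0}ᶜ : Set (Euc d)), f x
      ∂((volume : Measure (Euc d)).comap (↑)) =
      ∫ q : Sph d × Set.Ioi (0 : ℝ),
        f ((q.2 : ℝ) • (q.1 : Euc d))
        ∂((sphereMeasure d).prod (Measure.volumeIoiPow (d - 1))) := by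
    rw [← hmp.integral_comp (Homeomorph.measurableEmbedding _)]
    exact integral_congr_ae (Filter.Eventually.of_forall hcoe)
  have hint : Integrable (fun q : Sph d × Set.Ioi (0 : ℝ) =>
        f ((q.2 : ℝ) • (q.1 : Euc d)))
        ((sphereMeasure d).prod (Measure.volumeIoiPow (d - 1))) := by
    rw [← hmp.integrable_comp_emb (Homeomorph.measurableEmbedding _)]
    have : Integrable (fun x : ({0}ᶜ : Set (Euc d)) => f x)
        ((volume : Measure (Euc d)).comap (↑)) := by
      have h2 := (MeasurableEmbedding.subtype_coe (measurableSet_singleton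
        (0 : Euc d)).compl).integrableOn_range_iff_comap (μ := volume) (f := f)
      exact h2.1 hf.integrableOn
    exact this.congr (Filter.Eventually.of_forall hcoe)
  rw [h0, h1, integral_prod_symm _ hint, Measure.volumeIoiPow,
    integral_withDensity_eq_integral_toReal_smul (by fun_prop) (by simp)]
  rw [← integral_subtype_comap measurableSet_Ioi
    (fun r : ℝ => ((r ^ (d - 1) : ℝ) : ℂ) *
      ∫ θ : Sph d, f (r • (θ : Euc d))
        ∂sphereMeasure d)]
  refine integral_congr_ae (Filter.Eventually.of_forall fun r => ?_)
  simp only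
  rw [ENNReal.toReal_ofReal (pow_nonneg r.2.out.le _), Complex.real_smul]

/-! ### Bessel's equation and the Fourier decay of the sphere. -/

/-- Rotation by the angle `t` in the plane of the orthonormal vectors `a`, `b`. -/
noncomputable def planeRotation {d : ℕ} (a b : Euc d) (ha : ‖a‖ = 1) (hb : ‖b‖ = 1)
    (hab : inner ℝ a b = 0) (t : ℝ) : Euc d ≃ₗᵢ[ℝ] Euc d :=
  LinearIsometry.toLinearIsometryEquiv
    { toFun := fun v => v + ((Real.cos t - 1) * inner ℝ a v - Real.sin t * inner ℝ b v) • a +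
        (Real.sin t * inner ℝ a v + (Real.cos t - 1) * inner ℝ b v) • b
      map_add' := fun v w => by
        simp only [inner_add_right]; module
      map_smul' := fun c v => by
        simp only [inner_smul_right, RingHom.id_apply]; module
      norm_map' := fun v => by
        simp only [LinearMap.coe_mk, AddHom.coe_mk]
        rw [← sq_eq_sq₀ (norm_nonneg _) (norm_nonneg _), ← real_inner_self_eq_norm_sq,
          ← real_inner_self_eq_norm_sq]
        have hba : inner ℝ b a = 0 := by rw [real_inner_comm]; exact hab
        have haa : inner ℝ a a = 1 := by rw [real_inner_self_eq_norm_sq, ha]; norm_num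
        have hbb : inner ℝ b b = 1 := by rw [real_inner_self_eq_norm_sq, hb]; norm_num
        simp only [inner_add_left, inner_add_right, inner_smul_left, inner_smul_right, hab, hba,
          haa, hbb, real_inner_comm v a, real_inner_comm v b, conj_trivial]
        rw [real_inner_comm a v, real_inner_comm b v]
        have := Real.sin_sq_add_cos_sq t
        linear_combination ((inner ℝ a v) ^ 2 + (inner ℝ b v) ^ 2) * this }
    rfl

lemma planeRotation_apply {d : ℕ} (a b : Euc d) (ha : ‖a‖ = 1) (hb : ‖b‖ = 1)
    (hab : inner ℝ a b = 0) (t : ℝ) (v : Euc d) :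
    planeRotation a b ha hb hab t v =
      v + ((Real.cos t - 1) * inner ℝ a v - Real.sin t * inner ℝ b v) • a +
        (Real.sin t * inner ℝ a v + (Real.cos t - 1) * inner ℝ b v) • b := rfl

lemma abs_apply_le_one {d : ℕ} (θ : Sph d) (i : Fin d) : |(θ : Euc d) i| ≤ 1 := by
  have := PiLp.norm_apply_le (θ : Euc d) i
  simpa using this

lemma integrable_sphere_of_continuous {d : ℕ} {F : Type*} [NormedAddCommGroup F]
    {f : Sph d → F} (hf : Continuous f) : Integrable f (sphereMeasure d) :=
  (hf.continuousOn.integrableOn_compact (isCompact_univ (X := Sph d))).integrable_of_forall_notMem_eq_zero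
    (by simp)

/-- Infinitesimal rotation invariance of the surface measure, tested on `θⱼ sin (s θᵢ)`. -/
lemma sphere_rotation_identity {d : ℕ} {i j : Fin d} (hij : i ≠ j) (s : ℝ) :
    ∫ θ : Sph d, (θ : Euc d) i * Real.sin (s * (θ : Euc d) i) ∂sphereMeasure d =
      s * ∫ θ : Sph d, (θ : Euc d) j ^ 2 * Real.cos (s * (θ : Euc d) i) ∂sphereMeasure d := by
  set a : Euc d := EuclideanSpace.single i 1 with ha'
  set b : Euc d := EuclideanSpace.single j 1 with hb'
  have ha : ‖a‖ = 1 := by simp [a]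
  have hb : ‖b‖ = 1 := by simp [b]
  have hab : inner ℝ a b = 0 := by simp [a, b, EuclideanSpace.inner_single_left, hij]
  have hRi : ∀ t (v : Euc d), planeRotation a b ha hb hab t v i =
      v i * Real.cos t - v j * Real.sin t := by
    intro t v
    rw [planeRotation_apply]
    simp [a, b, EuclideanSpace.inner_single_left, hij]
    ring
  have hRj : ∀ t (v : Euc d), planeRotation a b ha hb hab t v j =
      v i * Real.sin t + v j * Real.cos t := by
    intro t v
    rw [planeRotation_apply]
    simp [a, b, EuclideanSpace.inner_single_left, hij.symm]
    ring
  -- The test function θⱼ sin(s θᵢ) at the point rotated by the angle `t`. Its integral does not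
  -- depend on `t`, and the vanishing of the derivative at `t = 0` is the identity sought.
  let F : ℝ → Sph d → ℝ := fun t θ =>
    ((θ : Euc d) i * Real.sin t + (θ : Euc d) j * Real.cos t) *
      Real.sin (s * ((θ : Euc d) i * Real.cos t - (θ : Euc d) j * Real.sin t))
  let F' : ℝ → Sph d → ℝ := fun t θ =>
    ((θ : Euc d) i * Real.cos t - (θ : Euc d) j * Real.sin t) *
      Real.sin (s * ((θ : Euc d) i * Real.cos t - (θ : Euc d) j * Real.sin t)) +
    ((θ : Euc d) i * Real.sin t + (θ : Euc d) j * Real.cos t) *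
      (Real.cos (s * ((θ : Euc d) i * Real.cos t - (θ : Euc d) j * Real.sin t)) *
        (s * (-((θ : Euc d) i * Real.sin t) - (θ : Euc d) j * Real.cos t)))
  have hFc : ∀ t, Continuous (F t) := fun t => by fun_prop
  have hF'c : ∀ t, Continuous (F' t) := fun t => by fun_prop
  have hconst : ∀ t, ∫ θ, F t θ ∂sphereMeasure d = ∫ θ, F 0 θ ∂sphereMeasure d := by
    intro t
    have := integral_sphereMap (planeRotation a b ha hb hab t)
      (fun v : Euc d => v j * Real.sin (s * v i))
    simp only [hRi, hRj] at this
    simpa [F] using this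
  have hder := hasDerivAt_integral_of_dominated_loc_of_deriv_le (μ := sphereMeasure d)
    (F := F) (F' := F') (x₀ := 0) (s := Set.univ) (bound := fun _ => 2 + 2 * (|s| * 2))
    Filter.univ_mem (Filter.Eventually.of_forall fun t => (hFc t).aestronglyMeasurable)
    (integrable_sphere_of_continuous (hFc 0)) (hF'c 0).aestronglyMeasurable
    (Filter.Eventually.of_forall fun θ t _ => by
      have h1 := abs_apply_le_one θ i
      have h2 := abs_apply_le_one θ j
      have hs := Real.abs_sin_le_one t
      have hc := Real.abs_cos_le_one t
      have e1 : |(θ : Euc d) i * Real.cos t - (θ : Euc d) j * Real.sin t| ≤ 2 := by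
        refine (abs_sub _ _).trans ?_
        rw [abs_mul, abs_mul]
        nlinarith [abs_nonneg ((θ : Euc d) i), abs_nonneg ((θ : Euc d) j),
          abs_nonneg (Real.sin t), abs_nonneg (Real.cos t)]
      have e2 : |(θ : Euc d) i * Real.sin t + (θ : Euc d) j * Real.cos t| ≤ 2 := by
        refine (abs_add_le _ _).trans ?_
        rw [abs_mul, abs_mul]
        nlinarith [abs_nonneg ((θ : Euc d) i), abs_nonneg ((θ : Euc d) j),
          abs_nonneg (Real.sin t), abs_nonneg (Real.cos t)]
      have e3 : |-((θ : Euc d) i * Real.sin t) - (θ : Euc d) j * Real.cos t| ≤ 2 := by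
        rw [← neg_add', abs_neg]; exact e2
      rw [Real.norm_eq_abs]
      refine (abs_add_le _ _).trans ?_
      simp only [abs_mul]
      refine add_le_add ?_ ?_
      · calc _ ≤ (2 : ℝ) * 1 := mul_le_mul e1 (Real.abs_sin_le_one _) (abs_nonneg _) (by norm_num)
          _ = 2 := by norm_num
      · calc _ ≤ (2 : ℝ) * (1 * (|s| * 2)) := by
              refine mul_le_mul e2 (mul_le_mul (Real.abs_cos_le_one _)
                (mul_le_mul_of_nonneg_left e3 (abs_nonneg s)) (by positivity) (by norm_num))
                (by positivity) (by norm_num)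
          _ = _ := by ring)
    (integrable_const _)
    (Filter.Eventually.of_forall fun θ t _ => by
      have h1 := (((Real.hasDerivAt_sin t).const_mul ((θ : Euc d) i)).add
        ((Real.hasDerivAt_cos t).const_mul ((θ : Euc d) j)))
      have h2 := ((((Real.hasDerivAt_cos t).const_mul ((θ : Euc d) i)).sub
        ((Real.hasDerivAt_sin t).const_mul ((θ : Euc d) j))).const_mul s).sin
      convert! h1.mul h2 using 1
      simp only [F', Pi.add_apply, Pi.sub_apply]
      ring)
  have h0 : ∫ θ, F' 0 θ ∂sphereMeasure d = 0 := by
    have h1 : (fun t => ∫ θ, F t θ ∂sphereMeasure d) = fun _ => ∫ θ, F 0 θ ∂sphereMeasure d :=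
      funext hconst
    have h2 := hder.2
    rw [h1] at h2
    exact h2.unique (hasDerivAt_const _ _)
  have h3 : ∀ θ : Sph d, F' 0 θ = (θ : Euc d) i * Real.sin (s * (θ : Euc d) i) -
      s * ((θ : Euc d) j ^ 2 * Real.cos (s * (θ : Euc d) i)) := by
    intro θ; simp [F']; ring
  simp only [h3] at h0
  rw [integral_sub (integrable_sphere_of_continuous (by fun_prop))
    (integrable_sphere_of_continuous (by fun_prop)), integral_const_mul] at h0
  linarith

/-- The cosine transform of the surface measure along the `i`-th axis. -/
noncomputable def besselFun {d : ℕ} (i : Fin d) (s : ℝ) : ℝ :=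
  ∫ θ : Sph d, Real.cos (s * (θ : Euc d) i) ∂sphereMeasure d

/-- The derivative of `besselFun`. -/
noncomputable def besselDer {d : ℕ} (i : Fin d) (s : ℝ) : ℝ :=
  -∫ θ : Sph d, (θ : Euc d) i * Real.sin (s * (θ : Euc d) i) ∂sphereMeasure d

lemma hasDerivAt_besselFun {d : ℕ} (i : Fin d) (s : ℝ) :
    HasDerivAt (besselFun i) (besselDer i s) s := by
  have hder := hasDerivAt_integral_of_dominated_loc_of_deriv_le (μ := sphereMeasure d)
    (F := fun s θ => Real.cos (s * (θ : Euc d) i))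
    (F' := fun s θ => -((θ : Euc d) i * Real.sin (s * (θ : Euc d) i)))
    (x₀ := s) (s := Set.univ) (bound := fun _ => 1)
    Filter.univ_mem (Filter.Eventually.of_forall fun t => (by fun_prop : Continuous
      (fun θ : Sph d => Real.cos (t * (θ : Euc d) i))).aestronglyMeasurable)
    (integrable_sphere_of_continuous (by fun_prop))
    (by fun_prop : Continuous
      (fun θ : Sph d => -((θ : Euc d) i * Real.sin (s * (θ : Euc d) i)))).aestronglyMeasurable
    (Filter.Eventually.of_forall fun θ t _ => by
      rw [norm_neg, Real.norm_eq_abs, abs_mul]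
      exact mul_le_one₀ (abs_apply_le_one θ i) (abs_nonneg _) (Real.abs_sin_le_one _))
    (integrable_const _)
    (Filter.Eventually.of_forall fun θ t _ => by
      have h2 := ((hasDerivAt_id t).mul_const ((θ : Euc d) i)).cos
      convert! h2 using 1
      simp; ring)
  have h := hder.2
  rw [integral_neg] at h
  exact h

/-- This is Bessel's equation B'' + ((d-1)/s) B' + B = 0. Differentiation under the integral gives
-∫ θᵢ² cos(s θᵢ). By the rotation identity each of the d-1 other coordinates contributes ∫ θⱼ² cos(s
θᵢ) = -B'/s, and the squares of all coordinates add up to 1. -/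
lemma hasDerivAt_besselDer {d : ℕ} (i : Fin d) {s : ℝ} (hs : 0 < s) :
    HasDerivAt (besselDer i) (-besselFun i s - ((d : ℝ) - 1) / s * besselDer i s) s := by
  have hder := hasDerivAt_integral_of_dominated_loc_of_deriv_le (μ := sphereMeasure d)
    (F := fun s θ => -((θ : Euc d) i * Real.sin (s * (θ : Euc d) i)))
    (F' := fun s θ => -((θ : Euc d) i ^ 2 * Real.cos (s * (θ : Euc d) i)))
    (x₀ := s) (s := Set.univ) (bound := fun _ => 1)
    Filter.univ_mem (Filter.Eventually.of_forall fun t => (by fun_prop : Continuous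
      (fun θ : Sph d => -((θ : Euc d) i * Real.sin (t * (θ : Euc d) i)))).aestronglyMeasurable)
    (integrable_sphere_of_continuous (by fun_prop))
    (by fun_prop : Continuous
      (fun θ : Sph d => -((θ : Euc d) i ^ 2 * Real.cos (s * (θ : Euc d) i)))).aestronglyMeasurable
    (Filter.Eventually.of_forall fun θ t _ => by
      rw [norm_neg, Real.norm_eq_abs, abs_mul, abs_pow]
      exact mul_le_one₀ (pow_le_one₀ (abs_nonneg _) (abs_apply_le_one θ i)) (abs_nonneg _)
        (Real.abs_cos_le_one _))
    (integrable_const _)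
    (Filter.Eventually.of_forall fun θ t _ => by
      have h2 := (((hasDerivAt_id t).mul_const ((θ : Euc d) i)).sin.const_mul ((θ : Euc d) i)).neg
      convert! h2 using 1
      simp; ring)
  have h := hder.2
  rw [integral_neg] at h
  have hfun : (fun t => ∫ θ : Sph d, -((θ : Euc d) i * Real.sin (t * (θ : Euc d) i))
      ∂sphereMeasure d) = besselDer i := by
    funext t; rw [integral_neg]; rfl
  rw [hfun] at h
  suffices hval : -besselFun i s - ((d : ℝ) - 1) / s * besselDer i s =
      -∫ θ : Sph d, (θ : Euc d) i ^ 2 * Real.cos (s * (θ : Euc d) i) ∂sphereMeasure d by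
    rw [hval]; exact h
  -- sum the rotation identities over the other coordinates
  have hj : ∀ j ∈ Finset.univ.erase i,
      ∫ θ : Sph d, (θ : Euc d) j ^ 2 * Real.cos (s * (θ : Euc d) i) ∂sphereMeasure d =
        -besselDer i s / s := by
    intro j hj
    have := sphere_rotation_identity (Finset.ne_of_mem_erase hj).symm s
    rw [besselDer, neg_neg, this]; field_simp
  have hsum : ∑ j, ∫ θ : Sph d, (θ : Euc d) j ^ 2 * Real.cos (s * (θ : Euc d) i)
      ∂sphereMeasure d = besselFun i s := by
    rw [← integral_finsetSum _ fun j _ => integrable_sphere_of_continuous (by fun_prop)]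
    refine integral_congr_ae (Filter.Eventually.of_forall fun θ => ?_)
    simp only
    rw [← Finset.sum_mul, ← EuclideanSpace.real_norm_sq_eq]
    simp
  rw [← Finset.add_sum_erase _ _ (Finset.mem_univ i), Finset.sum_congr rfl hj, Finset.sum_const,
    Finset.card_erase_of_mem (Finset.mem_univ i), Finset.card_univ, Fintype.card_fin,
    nsmul_eq_mul, Nat.cast_sub (by have := i.2; omega)] at hsum
  push_cast at hsum
  have hs' := hs.ne'
  rw [← hsum]
  field_simp
  ring_nf

lemma abs_besselFun_le {d : ℕ} (i : Fin d) (s : ℝ) :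
    |besselFun i s| ≤ (sphereMeasure d).real Set.univ := by
  have := norm_integral_le_of_norm_le_const (μ := sphereMeasure d) (C := 1)
    (f := fun θ : Sph d => Real.cos (s * (θ : Euc d) i))
    (Filter.Eventually.of_forall fun θ => Real.abs_cos_le_one _)
  simpa [besselFun] using this

/-- Decay of the Fourier transform of surface measure: an energy estimate for Bessel's equation. -/
lemma exists_besselFun_decay {d : ℕ} (hd : 3 ≤ d) (i : Fin d) :
    ∃ C : ℝ, 0 < C ∧ ∀ s : ℝ, 0 < s → s ^ (d - 1) * besselFun i s ^ 2 ≤ C := by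
  obtain ⟨n, rfl⟩ : ∃ n, d = n + 3 := ⟨d - 3, by omega⟩
  set N : ℝ := (n : ℝ) + 2 with hN
  have hN2 : 2 ≤ N := by rw [hN]; linarith [(Nat.cast_nonneg n : (0 : ℝ) ≤ n)]
  set c : ℝ := N * (N - 2) / 4 with hc
  have hc0 : 0 ≤ c := by rw [hc]; nlinarith
  set B := besselFun i with hB
  set D := besselDer i with hD
  set S := (sphereMeasure (n + 3)).real Set.univ with hS
  -- With N = d-1, the function w = s^{N/2} B satisfies w'' + (1 - c/s²) w = 0, and this is its
  -- energy w'² + (1 - c/s²) w². Only the variable coefficient contributes to the derivative, which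
  -- is (2c/s³) w².
  let En : ℝ → ℝ := fun s => s ^ (n + 2) * ((D s + N / 2 * (B s / s)) ^ 2 + (1 - c / s ^ 2) * B s ^ 2)
  -- The exponential has logarithmic derivative -4c/s³, which absorbs the growth of the energy as
  -- soon as w² ≤ 2 `En`.
  let H : ℝ → ℝ := fun s => En s * Real.exp (2 * c / s ^ 2)
  have hEn : ∀ s, 0 < s → HasDerivAt En (2 * c / s ^ 3 * (s ^ (n + 2) * B s ^ 2)) s := by
    intro s hs
    have hs' := hs.ne'
    have hBd := hasDerivAt_besselFun i s
    have hDd := hasDerivAt_besselDer i hs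
    have h1 : HasDerivAt (fun s : ℝ => s ^ (n + 2)) (((n + 2 : ℕ) : ℝ) * s ^ (n + 1)) s := by
      simpa using hasDerivAt_pow (n + 2) s
    have h2 := (hDd.add ((hBd.div (hasDerivAt_id s) hs').const_mul (N / 2))).pow 2
    have h3 : HasDerivAt (fun s : ℝ => 1 - c / s ^ 2) (2 * c / s ^ 3) s := by
      have := ((hasDerivAt_const s c).div (hasDerivAt_pow 2 s) (by positivity)).const_sub 1
      convert! this using 1
      field_simp; ring
    have h4 := h1.mul (h2.add (h3.mul (hBd.pow 2)))
    convert! h4 using 1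
    simp only [Pi.add_apply, Pi.mul_apply, Pi.div_apply, Pi.pow_apply, id]
    push_cast
    have e : (n : ℝ) = N - 2 := by rw [hN]; ring
    rw [e, ← hB, ← hD, pow_succ s (n + 1)]
    rw [show N - 2 + 3 = N + 1 by ring, hc]
    generalize s ^ (n + 1) = P
    generalize B s = b
    generalize D s = δ
    field_simp
    ring
  -- Beyond this point c/s² ≤ 1/2, so the energy dominates w²/2.
  set s₀ : ℝ := 1 + 2 * c with hs₀
  have hs₀1 : 1 ≤ s₀ := by rw [hs₀]; linarith
  have hhalf : ∀ s, s₀ ≤ s → s ^ (n + 2) * B s ^ 2 ≤ 2 * En s := by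
    intro s hs
    have hs1 : 1 ≤ s := hs₀1.trans hs
    have h1 : c / s ^ 2 ≤ 1 / 2 := by
      rw [div_le_iff₀ (by positivity)]
      nlinarith
    have h2 : 0 ≤ s ^ (n + 2) := by positivity
    simp only [En]
    nlinarith [mul_nonneg h2 (sq_nonneg (D s + N / 2 * (B s / s))), mul_nonneg h2 (sq_nonneg (B s)),
      mul_le_mul_of_nonneg_right h1 (mul_nonneg h2 (sq_nonneg (B s)))]
  have hH : ∀ s, 0 < s → HasDerivAt H ((2 * c / s ^ 3 * (s ^ (n + 2) * B s ^ 2)) *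
      Real.exp (2 * c / s ^ 2) + En s * (Real.exp (2 * c / s ^ 2) * (-(4 * c) / s ^ 3))) s := by
    intro s hs
    have h3 : HasDerivAt (fun s : ℝ => 2 * c / s ^ 2) (-(4 * c) / s ^ 3) s := by
      have := ((hasDerivAt_const s (2 * c)).div (hasDerivAt_pow 2 s) (by positivity))
      convert! this using 1
      field_simp; ring
    exact (hEn s hs).mul h3.exp
  have hanti : AntitoneOn H (Set.Ici s₀) := by
    refine antitoneOn_of_deriv_nonpos (convex_Ici _) ?_ ?_ ?_
    · intro s hs
      exact (hH s (by have : s₀ ≤ s := hs; linarith)).continuousAt.continuousWithinAt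
    · intro s hs
      rw [interior_Ici] at hs
      exact (hH s (by have : s₀ < s := hs; linarith)).differentiableAt.differentiableWithinAt
    · intro s hs
      rw [interior_Ici] at hs
      have hs1 : s₀ < s := hs
      have hpos : 0 < s := by linarith
      rw [(hH s hpos).deriv]
      have := hhalf s hs1.le
      have h5 : 0 ≤ 2 * c / s ^ 3 := by positivity
      have h6 : (2 * c / s ^ 3 * (s ^ (n + 2) * B s ^ 2)) * Real.exp (2 * c / s ^ 2) +
          En s * (Real.exp (2 * c / s ^ 2) * (-(4 * c) / s ^ 3)) =
          (2 * c / s ^ 3) * Real.exp (2 * c / s ^ 2) * (s ^ (n + 2) * B s ^ 2 - 2 * En s) := by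
        ring
      rw [h6]
      exact mul_nonpos_of_nonneg_of_nonpos (by positivity) (by linarith)
  refine ⟨s₀ ^ (n + 2) * S ^ 2 + 2 * |H s₀| + 1, by positivity, fun s hs => ?_⟩
  have hSn : 0 ≤ S := measureReal_nonneg
  rw [show n + 3 - 1 = n + 2 by omega]
  rcases le_total s s₀ with h | h
  · have h1 : s ^ (n + 2) ≤ s₀ ^ (n + 2) := pow_le_pow_left₀ hs.le h _
    have h2 : B s ^ 2 ≤ S ^ 2 := by
      rw [← sq_abs]; exact pow_le_pow_left₀ (abs_nonneg _) (abs_besselFun_le i s) _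
    have h3 := mul_le_mul h1 h2 (sq_nonneg _) (by positivity)
    linarith [abs_nonneg (H s₀)]
  · have h1 := hanti (Set.mem_Ici.2 le_rfl) (Set.mem_Ici.2 h) h
    have h2 := hhalf s h
    have h3 : En s ≤ H s := by
      have : 0 ≤ En s := by
        have : 0 ≤ s ^ (n + 2) * B s ^ 2 := by positivity
        linarith
      exact le_mul_of_one_le_right this (Real.one_le_exp (by positivity))
    have h4 := le_abs_self (H s₀)
    have h5 : 0 ≤ s₀ ^ (n + 2) * S ^ 2 := by positivity
    linarith

/-! ### Spherical averages and their Fourier transforms. -/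

/-- The integral of `ψ` over the sphere of radius `r` about `x`, in the normalization of the unit
sphere. -/
noncomputable def sphAvg {d : ℕ} {F : Type*} [NormedAddCommGroup F] [NormedSpace ℝ F]
    (ψ : Euc d → F) (r : ℝ) (x : Euc d) : F :=
  ∫ θ : Sph d, ψ (x - r • (θ : Euc d)) ∂sphereMeasure d

lemma continuous_sphAvg {d : ℕ} {F : Type*} [NormedAddCommGroup F] [NormedSpace ℝ F]
    {ψ : Euc d → F} (hψ : Continuous ψ) :
    Continuous fun q : ℝ × Euc d => sphAvg ψ q.1 q.2 := by
  have h := continuous_parametric_integral_of_continuous (μ := sphereMeasure d)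
    (f := fun (q : ℝ × Euc d) (θ : Sph d) => ψ (q.2 - q.1 • (θ : Euc d))) (by
      unfold Function.uncurry; fun_prop) (isCompact_univ (X := Sph d))
  simpa [sphAvg] using h

lemma norm_sphAvg_le {d : ℕ} {F : Type*} [NormedAddCommGroup F] [NormedSpace ℝ F]
    {ψ : Euc d → F} {C : ℝ} (hC : ∀ x, ‖ψ x‖ ≤ C) (r : ℝ) (x : Euc d) :
    ‖sphAvg ψ r x‖ ≤ C * (sphereMeasure d).real Set.univ :=
  norm_integral_le_of_norm_le_const (Filter.Eventually.of_forall fun _ => hC _)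

lemma sphAvg_ne_zero {d : ℕ} {F : Type*} [NormedAddCommGroup F] [NormedSpace ℝ F]
    {ψ : Euc d → F} {ρ : ℝ} (hψ : Function.support ψ ⊆ Metric.closedBall 0 ρ) {r : ℝ} (hr : 0 ≤ r)
    {x : Euc d} (hx : sphAvg ψ r x ≠ 0) : |‖x‖ - r| ≤ ρ := by
  have : ∃ θ : Sph d, ψ (x - r • (θ : Euc d)) ≠ 0 := by
    by_contra! h
    exact hx (by simp [sphAvg, h])
  obtain ⟨θ, hθ⟩ := this
  have h1 := hψ hθ
  rw [mem_closedBall_zero_iff] at h1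
  have h2 := abs_norm_sub_norm_le x (r • (θ : Euc d))
  rw [norm_smul, Real.norm_of_nonneg hr] at h2
  simp only [norm_eq_of_mem_sphere, mul_one] at h2
  exact h2.trans h1

lemma hasCompactSupport_sphAvg {d : ℕ} {F : Type*} [NormedAddCommGroup F] [NormedSpace ℝ F]
    {ψ : Euc d → F} (hψ : HasCompactSupport ψ) (r : ℝ) : HasCompactSupport (sphAvg ψ r) := by
  obtain ⟨ρ, hρ⟩ := hψ.isCompact.isBounded.subset_closedBall (0 : Euc d)
  refine HasCompactSupport.intro (isCompact_closedBall (0 : Euc d) (ρ + |r|)) fun x hx => ?_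
  have : ∀ θ : Sph d, ψ (x - r • (θ : Euc d)) = 0 := by
    intro θ
    by_contra h
    have h1 := hρ (subset_tsupport _ h)
    rw [mem_closedBall_zero_iff] at h1 hx
    apply hx
    have h2 := norm_sub_norm_le x (r • (θ : Euc d))
    rw [norm_smul] at h2
    simp only [norm_eq_of_mem_sphere, mul_one, Real.norm_eq_abs] at h2
    linarith
  simp [sphAvg, this]

lemma hasFDerivAt_sphAvg {d : ℕ} {F : Type*} [NormedAddCommGroup F] [NormedSpace ℝ F]
    {ψ : Euc d → F} (hψ : ContDiff ℝ ∞ ψ) (hc : HasCompactSupport ψ) (r : ℝ) (x : Euc d) :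
    HasFDerivAt (sphAvg ψ r) (sphAvg (fderiv ℝ ψ) r x) x := by
  have hcont : Continuous (fderiv ℝ ψ) := hψ.continuous_fderiv (by simp)
  obtain ⟨C, hC⟩ := (hc.fderiv (𝕜 := ℝ)).exists_bound_of_continuous hcont
  refine hasFDerivAt_integral_of_dominated_of_fderiv_le (s := Set.univ) (bound := fun _ => C)
    (F := fun x (θ : Sph d) => ψ (x - r • (θ : Euc d)))
    (F' := fun x (θ : Sph d) => fderiv ℝ ψ (x - r • (θ : Euc d))) Filter.univ_mem
    (Filter.Eventually.of_forall fun y => ?_) ?_ ?_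
    (Filter.Eventually.of_forall fun θ y _ => hC _) (integrable_const _)
    (Filter.Eventually.of_forall fun θ y _ => ?_)
  · have := hψ.continuous
    exact (integrable_sphere_of_continuous (by fun_prop)).aestronglyMeasurable
  · have := hψ.continuous
    exact integrable_sphere_of_continuous (by fun_prop)
  · exact (integrable_sphere_of_continuous (by fun_prop)).aestronglyMeasurable
  · have h1 : HasFDerivAt ψ (fderiv ℝ ψ (y - r • (θ : Euc d))) (y - r • (θ : Euc d)) :=
      (hψ.differentiable (by simp) _).hasFDerivAt
    exact h1.comp y (((hasFDerivAt_id y).sub_const (r • (θ : Euc d))))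

/-- The derivative of an average is the average of the derivative, which takes values in a different
space; the target is therefore quantified inside the induction. -/
lemma contDiff_sphAvg_nat {d : ℕ} (r : ℝ) (n : ℕ) : ∀ {F : Type} [NormedAddCommGroup F]
    [NormedSpace ℝ F] {ψ : Euc d → F}, ContDiff ℝ ∞ ψ → HasCompactSupport ψ →
    ContDiff ℝ n (sphAvg ψ r) := by
  induction n with
  | zero =>
    intro F _ _ ψ hψ hc
    exact contDiff_zero.2 ((continuous_sphAvg hψ.continuous).comp (by fun_prop :
      Continuous fun x : Euc d => (r, x)))
  | succ n ih =>
    intro F _ _ ψ hψ hc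
    have h1 := ih (hψ.fderiv_right (m := ∞) (by simp)) (hc.fderiv (𝕜 := ℝ))
    exact_mod_cast contDiff_succ_iff_hasFDerivAt.2 ⟨_, h1, hasFDerivAt_sphAvg hψ hc r⟩

lemma contDiff_sphAvg {d : ℕ} (r : ℝ) {F : Type} [NormedAddCommGroup F]
    [NormedSpace ℝ F] {ψ : Euc d → F} (hψ : ContDiff ℝ ∞ ψ) (hc : HasCompactSupport ψ) :
    ContDiff ℝ ∞ (sphAvg ψ r) :=
  contDiff_infty.2 fun n => contDiff_sphAvg_nat r n hψ hc

lemma lintegral_enorm_sphAvg_le {d : ℕ} {ψ : Euc d → ℂ} (hψ : Continuous ψ) (r : ℝ) :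
    ∫⁻ x, ‖sphAvg ψ r x‖ₑ ≤ sphereMeasure d Set.univ * ∫⁻ x, ‖ψ x‖ₑ := by
  calc ∫⁻ x, ‖sphAvg ψ r x‖ₑ
      ≤ ∫⁻ x, ∫⁻ θ : Sph d, ‖ψ (x - r • (θ : Euc d))‖ₑ ∂sphereMeasure d :=
        lintegral_mono fun x => enorm_integral_le_lintegral_enorm _
    _ = ∫⁻ θ : Sph d, (∫⁻ x : Euc d, ‖ψ (x - r • (θ : Euc d))‖ₑ) ∂sphereMeasure d := by
        refine lintegral_lintegral_swap (Measurable.aemeasurable ?_)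
        have : Continuous fun q : Euc d × Sph d => ψ (q.1 - r • (q.2 : Euc d)) := by fun_prop
        exact this.measurable.enorm
    _ = ∫⁻ _ : Sph d, (∫⁻ x : Euc d, ‖ψ x‖ₑ) ∂sphereMeasure d := by
        refine lintegral_congr fun θ => ?_
        exact lintegral_sub_right_eq_self (fun x => ‖ψ x‖ₑ) (r • (θ : Euc d))
    _ = _ := by rw [lintegral_const, mul_comm]

/-- An isometry carrying one vector to another of the same length. -/
lemma exists_isometry_apply_eq {d : ℕ} {x y : Euc d} (h : ‖x‖ = ‖y‖) :
    ∃ R : Euc d ≃ₗᵢ[ℝ] Euc d, R x = y :=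
  ⟨_, Submodule.reflection_sub h⟩

/-- The Fourier transform of surface measure. -/
lemma integral_sphere_exp {d : ℕ} (i : Fin d) (r : ℝ) (ξ : Euc d) :
    ∫ θ : Sph d, Complex.exp ((r * inner ℝ (θ : Euc d) ξ : ℝ) * Complex.I) ∂sphereMeasure d =
      (besselFun i (r * ‖ξ‖) : ℂ) := by
  -- A rotation carrying the `i`-th axis to the direction of ξ reduces the integral to one
  -- coordinate.
  obtain ⟨R, hR⟩ := exists_isometry_apply_eq (x := EuclideanSpace.single i ‖ξ‖) (y := ξ) (by simp)
  have h1 := integral_sphereMap R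
    (fun v : Euc d => Complex.exp ((r * inner ℝ v ξ : ℝ) * Complex.I))
  have h2 : ∀ v : Euc d, inner ℝ (R v) ξ = ‖ξ‖ * v i := by
    intro v
    conv_lhs => rw [← hR]
    rw [R.inner_map_map, EuclideanSpace.inner_single_right]
    simp
  rw [← h1]
  simp only [h2]
  have h3 : ∀ θ : Sph d, Complex.exp ((r * (‖ξ‖ * (θ : Euc d) i) : ℝ) * Complex.I) =
      ((Real.cos (r * ‖ξ‖ * (θ : Euc d) i) : ℝ) : ℂ) +
        ((Real.sin (r * ‖ξ‖ * (θ : Euc d) i) : ℝ) : ℂ) * Complex.I := by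
    intro θ
    rw [Complex.exp_mul_I, ← mul_assoc, ← Complex.ofReal_cos, ← Complex.ofReal_sin]
  simp only [h3]
  -- The antipodal map removes the sine part.
  have hneg := integral_sphereMap (LinearIsometryEquiv.neg ℝ (E := Euc d))
    (fun v : Euc d => Real.sin (r * ‖ξ‖ * v i))
  have hsin : ∫ θ : Sph d, Real.sin (r * ‖ξ‖ * (θ : Euc d) i) ∂sphereMeasure d = 0 := by
    have h4 : ∀ θ : Sph d, Real.sin (r * ‖ξ‖ * (LinearIsometryEquiv.neg ℝ (θ : Euc d)) i) =
        -Real.sin (r * ‖ξ‖ * (θ : Euc d) i) := by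
      intro θ; rw [← Real.sin_neg]; simp
    simp only [h4, integral_neg] at hneg
    linarith
  rw [integral_add (integrable_sphere_of_continuous (by fun_prop))
    (integrable_sphere_of_continuous (by fun_prop)), integral_mul_const, integral_complex_ofReal,
    integral_complex_ofReal, hsin]
  simp [besselFun]

lemma exists_besselFun_decay_rpow {d : ℕ} (hd : 3 ≤ d) (i : Fin d) :
    ∃ C : ℝ, 0 < C ∧ ∀ s : ℝ, 0 < s → |besselFun i s| ≤ C * s ^ (-(((d : ℝ) - 1) / 2)) := by
  obtain ⟨C, hC, h⟩ := exists_besselFun_decay hd i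
  refine ⟨√C, Real.sqrt_pos.2 hC, fun s hs => ?_⟩
  rw [Real.rpow_neg hs.le, ← div_eq_mul_inv, le_div_iff₀ (by positivity)]
  refine abs_le_of_sq_le_sq' ?_ (Real.sqrt_nonneg _) |>.2
  rw [mul_pow, sq_abs, Real.sq_sqrt hC.le, ← Real.rpow_natCast (s ^ _), ← Real.rpow_mul hs.le]
  have := h s hs
  rw [← Real.rpow_natCast, Nat.cast_sub (by omega)] at this
  push_cast at this ⊢
  rw [div_mul_cancel₀ _ (by norm_num), mul_comm]
  exact this

/-- The average is the convolution of ψ with surface measure dilated by `r`, so by Fubini the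
transforms multiply. -/
lemma fourier_sphAvg {d : ℕ} (i : Fin d) {ψ : Euc d → ℂ} (hψ : Continuous ψ)
    (hc : HasCompactSupport ψ) (r : ℝ) (ξ : Euc d) :
    𝓕 (sphAvg ψ r) ξ = 𝓕 ψ ξ * (besselFun i (2 * Real.pi * r * ‖ξ‖) : ℂ) := by
  have hint : Integrable ψ := hψ.integrable_of_hasCompactSupport hc
  have hI : Integrable (fun q : Euc d × Sph d =>
      ψ (q.1 - r • (q.2 : Euc d))) (volume.prod (sphereMeasure d)) := by
    have hcont : Continuous fun q : Euc d × Sph d => ψ (q.1 - r • (q.2 : Euc d)) := by fun_prop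
    obtain ⟨ρ, hρ⟩ := hc.isCompact.isBounded.subset_closedBall (0 : Euc d)
    refine hcont.integrable_of_hasCompactSupport ?_
    refine HasCompactSupport.intro ((isCompact_closedBall (0 : Euc d) (ρ + |r|)).prod
      (isCompact_univ (X := Sph d))) fun q hq => ?_
    by_contra h
    have h1 := hρ (subset_tsupport _ h)
    rw [mem_closedBall_zero_iff] at h1
    apply hq
    refine ⟨?_, Set.mem_univ _⟩
    have h2 := norm_sub_norm_le q.1 (r • (q.2 : Euc d))
    rw [norm_smul] at h2
    simp only [norm_eq_of_mem_sphere, mul_one, Real.norm_eq_abs] at h2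
    rw [mem_closedBall_zero_iff]
    linarith
  have hI' : Integrable (fun q : Euc d × Sph d =>
      Real.fourierChar (-inner ℝ q.1 ξ) • ψ (q.1 - r • (q.2 : Euc d)))
      (volume.prod (sphereMeasure d)) := by
    refine hI.congr' ?_ ?_
    · refine AEStronglyMeasurable.smul ?_ hI.aestronglyMeasurable
      have hcf : Continuous fun q : Euc d × Sph d => -inner ℝ q.1 ξ := by fun_prop
      exact (continuous_subtype_val.comp
        (Real.continuous_fourierChar.comp hcf)).aestronglyMeasurable
    · exact Filter.Eventually.of_forall fun q => by simp
  calc 𝓕 (sphAvg ψ r) ξ = ∫ x, ∫ θ : Sph d, Real.fourierChar (-inner ℝ x ξ) •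
        ψ (x - r • (θ : Euc d)) ∂sphereMeasure d := by
        rw [Real.fourier_eq]
        refine integral_congr_ae (Filter.Eventually.of_forall fun x => ?_)
        simp only [sphAvg, Circle.smul_def]
        rw [integral_smul]
    _ = ∫ θ : Sph d, (∫ x : Euc d, Real.fourierChar (-inner ℝ x ξ) •
        ψ (x - r • (θ : Euc d))) ∂sphereMeasure d := integral_integral_swap hI'
    _ = ∫ θ : Sph d, Complex.exp ((-(2 * Real.pi * r) * inner ℝ (θ : Euc d) ξ : ℝ) * Complex.I) *
          𝓕 ψ ξ ∂sphereMeasure d := by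
        refine integral_congr_ae (Filter.Eventually.of_forall fun θ => ?_)
        simp only
        rw [← integral_add_right_eq_self (μ := volume) _ (r • (θ : Euc d)), Real.fourier_eq,
          ← integral_const_mul]
        refine integral_congr_ae (Filter.Eventually.of_forall fun x => ?_)
        simp only [add_sub_cancel_right, inner_add_left, neg_add, Circle.smul_def, smul_eq_mul,
          AddChar.map_add_eq_mul, Circle.coe_mul, inner_smul_left, conj_trivial]
        rw [Real.fourierChar_apply (-(r * _))]
        rw [show (2 * Real.pi * -(r * inner ℝ (θ : Euc d) ξ)) =
          -(2 * Real.pi * r) * inner ℝ (θ : Euc d) ξ by ring]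
        ring
    _ = _ := by
        rw [integral_mul_const, integral_sphere_exp i, mul_comm]
        congr 2
        rw [neg_mul, besselFun, besselFun]
        simp

/-! ### Fourier size of admissible functions. -/

/-- A Schwartz function whose derivatives of order at most `n` vanish at the origin is
`O(|ξ|^{n+1})`. -/
lemma exists_norm_le_pow_of_iteratedFDeriv_eq_zero {d : ℕ} (f : SchwartzMap (Euc d) ℂ) (n : ℕ)
    (h : ∀ k ≤ n, iteratedFDeriv ℝ k f 0 = 0) :
    ∃ C : ℝ, 0 < C ∧ ∀ ξ, ‖f ξ‖ ≤ C * ‖ξ‖ ^ (n + 1) := by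
  obtain ⟨C, hC0, hC⟩ := f.decay 0 (n + 1)
  refine ⟨C, hC0, fun ξ => ?_⟩
  -- Taylor's formula is applied on [0, 1] to t ↦ f(tξ), whose Taylor polynomial of degree `n` at 0
  -- is zero by hypothesis.
  set L : ℝ →L[ℝ] Euc d := ContinuousLinearMap.toSpanSingleton ℝ ξ with hL
  have hf : ContDiff ℝ ∞ f := f.smooth ⊤
  have hcd : ContDiff ℝ ∞ (f ∘ L) := hf.comp L.contDiff
  have hder : ∀ (k : ℕ) (t : ℝ), iteratedDeriv k (f ∘ L) t =
      iteratedFDeriv ℝ k f (L t) fun _ => ξ := by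
    intro k t
    rw [iteratedDeriv_eq_iteratedFDeriv, L.iteratedFDeriv_comp_right hf t (i := k)
      (by exact_mod_cast le_top)]
    simp [hL]
  have hw : ∀ (k : ℕ), ∀ t ∈ Set.Icc (0 : ℝ) 1, iteratedDerivWithin k (f ∘ L) (Set.Icc 0 1) t =
      iteratedFDeriv ℝ k f (L t) fun _ => ξ := by
    intro k t ht
    rw [iteratedDerivWithin_eq_iteratedDeriv (uniqueDiffOn_Icc one_pos)
      (hcd.of_le (by exact_mod_cast le_top)).contDiffAt ht, hder]
  have h1 := taylor_mean_remainder_bound (f := f ∘ L) (a := 0) (b := 1) (x := 1) (n := n)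
    (C := C * ‖ξ‖ ^ (n + 1)) zero_le_one
    ((hcd.of_le (by exact_mod_cast le_top)).contDiffOn) (by simp) (fun t ht => by
      rw [hw _ t ht]
      refine (ContinuousMultilinearMap.le_opNorm _ _).trans ?_
      rw [Finset.prod_const, Finset.card_univ, Fintype.card_fin]
      have := hC (L t)
      rw [pow_zero, one_mul] at this
      gcongr)
  have h2 : taylorWithinEval (f ∘ L) n (Set.Icc 0 1) 0 1 = 0 := by
    rw [taylor_within_apply]
    refine Finset.sum_eq_zero fun k hk => ?_
    rw [hw k 0 (by simp), map_zero, h k (by simpa [Nat.lt_succ_iff] using hk)]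
    simp
  rw [h2, sub_zero, sub_zero, one_pow, mul_one] at h1
  have h3 : (f ∘ L) 1 = f ξ := by simp [hL]
  rw [h3] at h1
  refine h1.trans (div_le_self (by positivity) ?_)
  exact_mod_cast Nat.one_le_iff_ne_zero.2 (Nat.factorial_ne_zero n)

lemma IsAdmissible.hasCompactSupport {d : ℕ} {ψ₀ : Euc d → ℂ} (h : IsAdmissible ψ₀) :
    HasCompactSupport ψ₀ :=
  HasCompactSupport.of_support_subset_isCompact (isCompact_closedBall _ _) h.support_subset

/-- An admissible function, as a Schwartz function. -/
noncomputable def IsAdmissible.toSchwartz {d : ℕ} {ψ₀ : Euc d → ℂ} (h : IsAdmissible ψ₀) :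
    SchwartzMap (Euc d) ℂ :=
  h.hasCompactSupport.toSchwartzMap h.smooth

lemma IsAdmissible.fourier_radial {d : ℕ} {ψ₀ : Euc d → ℂ} (h : IsAdmissible ψ₀) :
    IsRadial (𝓕 ψ₀) := by
  intro x y hxy
  obtain ⟨R, rfl⟩ := exists_isometry_apply_eq hxy
  rw [← Real.fourier_comp_linearIsometry]
  have hR : ψ₀ ∘ R = ψ₀ := funext fun z => h.radial _ _ (by simp)
  rw [hR]

/-- Bounds for the Fourier transform of an admissible function near the origin and at infinity. -/
lemma IsAdmissible.exists_fourier_bound {d : ℕ} (hd : 1 ≤ d) {ψ₀ : Euc d → ℂ}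
    (h : IsAdmissible ψ₀) (N : ℕ) :
    ∃ C : ℝ, 0 < C ∧ ∀ ξ, ‖𝓕 ψ₀ ξ‖ ≤ C * ‖ξ‖ ^ d ∧ (1 + ‖ξ‖) ^ N * ‖𝓕 ψ₀ ξ‖ ≤ C := by
  set g : SchwartzMap (Euc d) ℂ := 𝓕 h.toSchwartz with hg
  have hgc : ∀ ξ, g ξ = 𝓕 ψ₀ ξ := fun ξ => rfl
  have hgf : (g : Euc d → ℂ) = 𝓕 ψ₀ := rfl
  -- Vanishing of the derivatives of order at most d-1 yields the factor |ξ|^d, which beats the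
  -- singularity |ξ|^{-(d-1)/2} coming from the Bessel decay.
  obtain ⟨C, hC, h1⟩ := exists_norm_le_pow_of_iteratedFDeriv_eq_zero g (d - 1) (fun k hk => by
    rw [hgf]; exact h.fourier_vanishes k (by omega))
  have h2 := fun ξ => SchwartzMap.one_add_le_sup_seminorm_apply (𝕜 := ℝ) (m := (N, 0)) (k := N)
    (n := 0) le_rfl le_rfl g ξ
  set D := 2 ^ (N, 0).1 * ((Finset.Iic (N, 0)).sup fun m => SchwartzMap.seminorm ℝ m.1 m.2) g
  refine ⟨max C D, lt_max_of_lt_left hC, fun ξ => ⟨?_, ?_⟩⟩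
  · have := h1 ξ
    rw [Nat.sub_add_cancel hd] at this
    rw [← hgc]
    exact this.trans (mul_le_mul_of_nonneg_right (le_max_left _ _) (by positivity))
  · have := h2 ξ
    rw [norm_iteratedFDeriv_zero] at this
    exact this.trans (le_max_right _ _)

/-! ### The L² and inner product bounds for smoothed spheres. -/

/-- Young's inequality `‖b * φ‖₂ ≤ ‖φ‖₁ ‖b‖₂`, squared. -/
lemma lintegral_enorm_conv_sq_le {d : ℕ} {b φ : Euc d → ℂ} (hb : Measurable b)
    (hφ : Measurable φ) :
    ∫⁻ x, ‖∫ y, b y * φ (x - y)‖ₑ ^ 2 ≤ (∫⁻ x, ‖φ x‖ₑ) ^ 2 * ∫⁻ x, ‖b x‖ₑ ^ 2 := by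
  set A := ∫⁻ x, ‖φ x‖ₑ with hA
  have hφx : ∀ x, ∫⁻ y, ‖φ (x - y)‖ₑ = A := fun x =>
    lintegral_sub_left_eq_self (fun y => ‖φ y‖ₑ) x
  have hpt : ∀ x, ‖∫ y, b y * φ (x - y)‖ₑ ^ 2 ≤ A * ∫⁻ y, ‖b y‖ₑ ^ 2 * ‖φ (x - y)‖ₑ := by
    intro x
    -- Cauchy-Schwarz with |φ| split into two square roots.
    have h1 : ‖∫ y, b y * φ (x - y)‖ₑ ≤
        ∫⁻ y, (‖b y‖ₑ * ‖φ (x - y)‖ₑ ^ (1 / 2 : ℝ)) * ‖φ (x - y)‖ₑ ^ (1 / 2 : ℝ) := by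
      refine (enorm_integral_le_lintegral_enorm _).trans (le_of_eq ?_)
      refine lintegral_congr fun y => ?_
      rw [mul_assoc, ← ENNReal.rpow_add_of_nonneg _ _ (by norm_num) (by norm_num), enorm_mul]
      norm_num
    have hm : Measurable fun y => φ (x - y) := by fun_prop
    have h2 := ENNReal.lintegral_mul_le_Lp_mul_Lq volume Real.HolderConjugate.two_two
      (f := fun y => ‖b y‖ₑ * ‖φ (x - y)‖ₑ ^ (1 / 2 : ℝ))
      (g := fun y => ‖φ (x - y)‖ₑ ^ (1 / 2 : ℝ)) (by fun_prop) (by fun_prop)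
    simp only [Pi.mul_apply] at h2
    have h3 := pow_le_pow_left' (h1.trans h2) 2
    refine h3.trans (le_of_eq ?_)
    have e1 : ∀ z : ℝ≥0∞, (z ^ (1 / 2 : ℝ)) ^ (2 : ℝ) = z := fun z => by
      rw [← ENNReal.rpow_mul]; norm_num
    have e2 : ∀ z : ℝ≥0∞, (z ^ (1 / 2 : ℝ)) ^ 2 = z := fun z => by
      rw [← ENNReal.rpow_natCast]; exact_mod_cast e1 z
    simp only [ENNReal.mul_rpow_of_nonneg _ _ (zero_le_two : (0 : ℝ) ≤ 2), e1]
    rw [mul_pow, e2, e2, hφx, mul_comm]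
    simp
  calc ∫⁻ x, ‖∫ y, b y * φ (x - y)‖ₑ ^ 2
      ≤ ∫⁻ x, A * ∫⁻ y, ‖b y‖ₑ ^ 2 * ‖φ (x - y)‖ₑ := lintegral_mono hpt
    _ = A * ∫⁻ x, ∫⁻ y, ‖b y‖ₑ ^ 2 * ‖φ (x - y)‖ₑ := by
        rw [lintegral_const_mul]
        have hm : Measurable fun q : Euc d × Euc d => ‖b q.2‖ₑ ^ 2 * ‖φ (q.1 - q.2)‖ₑ := by
          fun_prop
        exact hm.lintegral_prod_right'
    _ = A * ∫⁻ y, ∫⁻ x, ‖b y‖ₑ ^ 2 * ‖φ (x - y)‖ₑ := by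
        rw [lintegral_lintegral_swap]
        exact Measurable.aemeasurable (by fun_prop)
    _ = A * ∫⁻ y, ‖b y‖ₑ ^ 2 * A := by
        congr 1
        refine lintegral_congr fun y => ?_
        rw [lintegral_const_mul _ (by fun_prop), lintegral_sub_right_eq_self (fun x => ‖φ x‖ₑ) y]
    _ = _ := by
        rw [lintegral_mul_const _ (by fun_prop)]
        ring

/-- The properties of the kernels `F_r = σ_r * ψ` (`σ_r` being surface measure on the sphere of
radius `r`, of total mass independent of `r`) on which the estimates rest. -/
structure IsSphericalKernel {d : ℕ} (F : ℝ → Euc d → ℂ) (C : ℝ) : Prop where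
  pos : 0 < C
  cont : Continuous fun q : ℝ × Euc d => F q.1 q.2
  bound : ∀ r x, ‖F r x‖ ≤ C
  supp : ∀ r x, 0 ≤ r → F r x ≠ 0 → |‖x‖ - r| ≤ 1 / 5
  l1 : ∀ r, ∫⁻ x, ‖F r x‖ₑ ≤ ENNReal.ofReal C
  l2 : ∀ r, 0 < r → ∀ b : Euc d → ℂ, Measurable b → (∃ B, ∀ x, ‖b x‖ ≤ B) →
    (∃ R, ∀ x, b x ≠ 0 → ‖x‖ ≤ R) →
    ∫⁻ x, ‖∫ y, b y * F r (x - y)‖ₑ ^ 2 ≤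
      ENNReal.ofReal (C * r ^ (-((d : ℝ) - 1))) * ∫⁻ x, ‖b x‖ₑ ^ 2
  inner_le : ∀ r r', 0 < r → 0 < r' → ∀ y y', y ≠ y' →
    ‖∫ x, F r (x - y) * (starRingEnd ℂ) (F r' (x - y'))‖ ≤
      C * (r * r' * ‖y - y'‖) ^ (-(((d : ℝ) - 1) / 2))

lemma hasCompactSupport_conv {d : ℕ} {f g : Euc d → ℂ} (hf : HasCompactSupport f)
    (hg : HasCompactSupport g) : HasCompactSupport (conv f g) :=
  hf.convolution _ hg

lemma contDiff_conv {d : ℕ} {f g : Euc d → ℂ} (hf : LocallyIntegrable f)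
    (hgc : HasCompactSupport g) (hg : ContDiff ℝ ∞ g) : ContDiff ℝ ∞ (conv f g) :=
  HasCompactSupport.contDiff_convolution_right (n := ⊤) _ hgc hf hg

lemma fourier_conv {d : ℕ} {f g : Euc d → ℂ} (hf : Integrable f) (hg : Integrable g) (ξ : Euc d) :
    𝓕 (conv f g) ξ = 𝓕 f ξ * 𝓕 g ξ :=
  Real.fourier_mul_convolution_eq hf hg ξ

lemma conv_apply {d : ℕ} (f g : Euc d → ℂ) (x : Euc d) :
    conv f g x = ∫ y, f y * g (x - y) := rfl

lemma IsAdmissible.integrable {d : ℕ} {ψ₀ : Euc d → ℂ} (h : IsAdmissible ψ₀) :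
    Integrable ψ₀ :=
  h.smooth.continuous.integrable_of_hasCompactSupport h.hasCompactSupport

lemma IsAdmissible.contDiff_conv_self {d : ℕ} {ψ₀ : Euc d → ℂ} (h : IsAdmissible ψ₀) :
    ContDiff ℝ ∞ (conv ψ₀ ψ₀) :=
  contDiff_conv h.integrable.locallyIntegrable h.hasCompactSupport h.smooth

lemma IsAdmissible.hasCompactSupport_conv_self {d : ℕ} {ψ₀ : Euc d → ℂ} (h : IsAdmissible ψ₀) :
    HasCompactSupport (conv ψ₀ ψ₀) :=
  hasCompactSupport_conv h.hasCompactSupport h.hasCompactSupport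

lemma IsAdmissible.support_conv_self_subset {d : ℕ} {ψ₀ : Euc d → ℂ} (h : IsAdmissible ψ₀) :
    Function.support (conv ψ₀ ψ₀) ⊆ Metric.closedBall 0 (1 / 5) := by
  intro x hx
  have hx' : ∃ y, ψ₀ y * ψ₀ (x - y) ≠ 0 := by
    by_contra! hall
    exact hx (by simp [conv_apply, hall])
  obtain ⟨y, hy⟩ := hx'
  have h1 := h.support_subset (left_ne_zero_of_mul hy)
  have h2 := h.support_subset (right_ne_zero_of_mul hy)
  rw [mem_closedBall_zero_iff] at h1 h2 ⊢
  have := norm_add_le y (x - y)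
  rw [add_sub_cancel] at this
  linarith

/-- Plancherel's theorem for smooth compactly supported functions, as lower integrals. -/
lemma lintegral_enorm_sq_fourier {d : ℕ} {f : Euc d → ℂ} (hf : ContDiff ℝ ∞ f)
    (hc : HasCompactSupport f) : ∫⁻ ξ, ‖𝓕 f ξ‖ₑ ^ 2 = ∫⁻ x, ‖f x‖ₑ ^ 2 := by
  set S := hc.toSchwartzMap hf
  have h1 : ∫ ξ, ‖(𝓕 S) ξ‖ ^ 2 = ∫ x, ‖S x‖ ^ 2 := SchwartzMap.integral_norm_sq_fourier S
  have h2 : ∀ T : SchwartzMap (Euc d) ℂ, ∫⁻ x, ‖T x‖ₑ ^ 2 = ENNReal.ofReal (∫ x, ‖T x‖ ^ 2) := by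
    intro T
    have hT : MemLp T 2 volume := T.memLp 2 volume
    rw [ofReal_integral_eq_lintegral_ofReal (hT.integrable_norm_pow two_ne_zero)]
    · refine lintegral_congr fun x => ?_
      rw [ENNReal.ofReal_pow (norm_nonneg _), ofReal_norm]
    · exact Filter.Eventually.of_forall fun x => by positivity
  have h3 := h2 (𝓕 S)
  rw [h1, ← h2 S] at h3
  exact h3

lemma fourier_comp_sub {d : ℕ} (f : Euc d → ℂ) (a ξ : Euc d) :
    𝓕 (fun x => f (x - a)) ξ = Complex.exp ((-(2 * Real.pi) * inner ℝ a ξ : ℝ) * Complex.I) *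
      𝓕 f ξ := by
  rw [Real.fourier_eq, ← integral_add_right_eq_self (μ := volume) _ a, Real.fourier_eq,
    ← integral_const_mul]
  refine integral_congr_ae (Filter.Eventually.of_forall fun x => ?_)
  simp only [add_sub_cancel_right, inner_add_left, neg_add, Circle.smul_def, smul_eq_mul,
    AddChar.map_add_eq_mul, Circle.coe_mul]
  rw [Real.fourierChar_apply (-(inner ℝ a ξ)),
    show (2 * Real.pi * -(inner ℝ a ξ)) = -(2 * Real.pi) * inner ℝ a ξ by ring]
  ring

/-- Combined size of the Fourier transforms of an admissible function and of a sphere. -/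
lemma IsAdmissible.exists_fourier_mul_besselFun_le {d : ℕ} (hd : 3 ≤ d) (i : Fin d)
    {ψ₀ : Euc d → ℂ} (h : IsAdmissible ψ₀) :
    ∃ C : ℝ, 0 < C ∧ ∀ ξ r, 0 < r →
      ‖𝓕 ψ₀ ξ‖ * |besselFun i (2 * Real.pi * r * ‖ξ‖)| ≤ C * r ^ (-(((d : ℝ) - 1) / 2)) := by
  obtain ⟨C₀, hC₀, h0⟩ := h.exists_fourier_bound (by omega) 0
  obtain ⟨C₁, hC₁, h1⟩ := exists_besselFun_decay_rpow hd i
  refine ⟨C₀ * C₁, by positivity, fun ξ r hr => ?_⟩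
  have hd' : (3 : ℝ) ≤ d := by exact_mod_cast hd
  set β : ℝ := ((d : ℝ) - 1) / 2 with hβ
  rcases eq_or_ne ξ 0 with rfl | hξ
  · have := (h0 0).1
    rw [norm_zero, zero_pow (by omega), mul_zero] at this
    have h00 : ‖𝓕 ψ₀ 0‖ = 0 := le_antisymm this (norm_nonneg _)
    rw [h00, zero_mul]; positivity
  · have hρ : 0 < ‖ξ‖ := norm_pos_iff.2 hξ
    -- One factor of the transform of ψ₀ pays for one Bessel factor: near the origin through the
    -- order of vanishing `d` ≥ β, away from it through boundedness alone.
    have hg : ‖𝓕 ψ₀ ξ‖ * ‖ξ‖ ^ (-β) ≤ C₀ := by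
      rcases le_total ‖ξ‖ 1 with hle | hle
      · calc ‖𝓕 ψ₀ ξ‖ * ‖ξ‖ ^ (-β) ≤ (C₀ * ‖ξ‖ ^ d) * ‖ξ‖ ^ (-β) := by
              gcongr; exact (h0 ξ).1
          _ = C₀ * ‖ξ‖ ^ ((d : ℝ) + -β) := by
              rw [Real.rpow_add hρ, Real.rpow_natCast]; ring
          _ ≤ C₀ * 1 := by
              gcongr
              exact Real.rpow_le_one hρ.le hle (by rw [hβ]; linarith)
          _ = C₀ := mul_one _
      · have h2 := (h0 ξ).2
        rw [pow_zero, one_mul] at h2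
        calc ‖𝓕 ψ₀ ξ‖ * ‖ξ‖ ^ (-β) ≤ C₀ * 1 := by
              gcongr
              exact Real.rpow_le_one_of_one_le_of_nonpos hle (by rw [hβ]; linarith)
          _ = C₀ := mul_one _
    have hpi : 1 ≤ 2 * Real.pi := by linarith [Real.pi_gt_three]
    calc ‖𝓕 ψ₀ ξ‖ * |besselFun i (2 * Real.pi * r * ‖ξ‖)|
        ≤ ‖𝓕 ψ₀ ξ‖ * (C₁ * (2 * Real.pi * r * ‖ξ‖) ^ (-β)) := by
          gcongr; exact h1 _ (by positivity)
      _ = (‖𝓕 ψ₀ ξ‖ * ‖ξ‖ ^ (-β)) * C₁ * ((2 * Real.pi) ^ (-β) * r ^ (-β)) := by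
          rw [Real.mul_rpow (by positivity) hρ.le, Real.mul_rpow (by positivity) hr.le]; ring
      _ ≤ C₀ * C₁ * (1 * r ^ (-β)) := by
          gcongr
          exact Real.rpow_le_one_of_one_le_of_nonpos hpi (by rw [hβ]; linarith)
      _ = _ := by ring

lemma IsAdmissible.fourier_sphAvg_conv {d : ℕ} (i : Fin d) {ψ₀ : Euc d → ℂ} (h : IsAdmissible ψ₀)
    (r : ℝ) (ξ : Euc d) :
    𝓕 (sphAvg (conv ψ₀ ψ₀) r) ξ =
      𝓕 ψ₀ ξ ^ 2 * (besselFun i (2 * Real.pi * r * ‖ξ‖) : ℂ) := by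
  rw [fourier_sphAvg i h.contDiff_conv_self.continuous h.hasCompactSupport_conv_self,
    fourier_conv h.integrable h.integrable, sq]

/-- The multiplier of F_r is the square of the transform of ψ₀ times a Bessel factor. One copy with
the Bessel factor is O(r^{-(d-1)/2}) uniformly. The other copy stays with `b`, so that Plancherel is
used for the smooth compactly supported function b*ψ₀, and Young's inequality returns to `b`. -/
lemma IsAdmissible.exists_sphAvg_l2_bound {d : ℕ} (hd : 3 ≤ d) {ψ₀ : Euc d → ℂ}
    (h : IsAdmissible ψ₀) :
    ∃ C : ℝ, 0 < C ∧ ∀ r, 0 < r → ∀ b : Euc d → ℂ, Measurable b → (∃ B, ∀ x, ‖b x‖ ≤ B) →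
      (∃ R, ∀ x, b x ≠ 0 → ‖x‖ ≤ R) →
      ∫⁻ x, ‖∫ y, b y * sphAvg (conv ψ₀ ψ₀) r (x - y)‖ₑ ^ 2 ≤
        ENNReal.ofReal (C * r ^ (-((d : ℝ) - 1))) * ∫⁻ x, ‖b x‖ₑ ^ 2 := by
  obtain ⟨i⟩ : Nonempty (Fin d) := ⟨⟨0, by omega⟩⟩
  obtain ⟨C, hC, hb⟩ := h.exists_fourier_mul_besselFun_le hd i
  set A : ℝ := ∫ x, ‖ψ₀ x‖ with hA
  have hA0 : 0 ≤ A := integral_nonneg fun _ => norm_nonneg _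
  have hAe : ∫⁻ x, ‖ψ₀ x‖ₑ = ENNReal.ofReal A := by
    rw [hA, ofReal_integral_norm_eq_lintegral_enorm h.integrable]
  refine ⟨C ^ 2 * A ^ 2 + 1, by positivity, fun r hr b hbm ⟨B, hB⟩ ⟨R, hR⟩ => ?_⟩
  have hbc : HasCompactSupport b :=
    HasCompactSupport.intro (isCompact_closedBall (0 : Euc d) R) fun x hx => by
      by_contra hne
      exact hx (mem_closedBall_zero_iff.2 (hR x hne))
  have hbi : Integrable b := by
    have : IntegrableOn b (Metric.closedBall 0 R) :=
      Measure.integrableOn_of_bounded (M := B) measure_closedBall_lt_top.ne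
        hbm.aestronglyMeasurable (Filter.Eventually.of_forall hB)
    refine (integrableOn_iff_integrable_of_support_subset fun x hx => ?_).1 this
    exact mem_closedBall_zero_iff.2 (hR x hx)
  set G := sphAvg (conv ψ₀ ψ₀) r with hG
  have hGd : ContDiff ℝ ∞ G := contDiff_sphAvg r h.contDiff_conv_self h.hasCompactSupport_conv_self
  have hGc : HasCompactSupport G := hasCompactSupport_sphAvg h.hasCompactSupport_conv_self r
  have hGi : Integrable G := hGd.continuous.integrable_of_hasCompactSupport hGc
  have h1 := lintegral_enorm_sq_fourier (contDiff_conv hbi.locallyIntegrable hGc hGd)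
    (hasCompactSupport_conv hbc hGc)
  have h2 := lintegral_enorm_sq_fourier
    (contDiff_conv hbi.locallyIntegrable h.hasCompactSupport h.smooth)
    (hasCompactSupport_conv hbc h.hasCompactSupport)
  have h3 := lintegral_enorm_conv_sq_le hbm h.smooth.continuous.measurable
  set D : ℝ := C * r ^ (-(((d : ℝ) - 1) / 2)) with hD
  have hD0 : 0 ≤ D := by positivity
  calc ∫⁻ x, ‖∫ y, b y * G (x - y)‖ₑ ^ 2 = ∫⁻ x, ‖conv b G x‖ₑ ^ 2 := rfl
    _ = ∫⁻ ξ, ‖𝓕 (conv b G) ξ‖ₑ ^ 2 := h1.symm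
    _ ≤ ∫⁻ ξ, ENNReal.ofReal D ^ 2 * ‖𝓕 (conv b ψ₀) ξ‖ₑ ^ 2 := by
        refine lintegral_mono fun ξ => ?_
        rw [← mul_pow]
        gcongr
        rw [fourier_conv hbi hGi, fourier_conv hbi h.integrable, hG,
          h.fourier_sphAvg_conv i, ← ofReal_norm, ← ofReal_norm,
          ← ENNReal.ofReal_mul hD0]
        refine ENNReal.ofReal_le_ofReal ?_
        rw [norm_mul, norm_mul, norm_mul, norm_pow, Complex.norm_real, Real.norm_eq_abs]
        have := hb ξ r hr
        calc _ = ‖𝓕 b ξ‖ * ‖𝓕 ψ₀ ξ‖ *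
              (‖𝓕 ψ₀ ξ‖ * |besselFun i (2 * Real.pi * r * ‖ξ‖)|) := by ring
          _ ≤ ‖𝓕 b ξ‖ * ‖𝓕 ψ₀ ξ‖ * D := by gcongr
          _ = _ := by ring
    _ = ENNReal.ofReal D ^ 2 * ∫⁻ ξ, ‖𝓕 (conv b ψ₀) ξ‖ₑ ^ 2 := by
        rw [lintegral_const_mul']
        exact ENNReal.pow_ne_top ENNReal.ofReal_ne_top
    _ = ENNReal.ofReal D ^ 2 * ∫⁻ x, ‖conv b ψ₀ x‖ₑ ^ 2 := by rw [h2]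
    _ ≤ ENNReal.ofReal D ^ 2 * (ENNReal.ofReal A ^ 2 * ∫⁻ x, ‖b x‖ₑ ^ 2) := by
        gcongr
        rw [← hAe]
        exact h3
    _ ≤ _ := by
        rw [← mul_assoc, ← ENNReal.ofReal_pow hD0, ← ENNReal.ofReal_pow hA0,
          ← ENNReal.ofReal_mul (by positivity)]
        gcongr ENNReal.ofReal ?_ * _
        rw [hD, mul_pow, ← Real.rpow_natCast (r ^ _), ← Real.rpow_mul hr.le]
        push_cast
        rw [show -(((d : ℝ) - 1) / 2) * 2 = -((d : ℝ) - 1) by ring]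
        have : 0 < r ^ (-((d : ℝ) - 1)) := by positivity
        nlinarith

/-- By Parseval the inner product is the integral of a radial function against the character of y -
y'. Integration over the spheres |ξ| = ρ turns the character into a third Bessel factor, with
argument 2π|y - y'|ρ. Of the four factors of the transform of ψ₀, three are paired with the Bessel
factors and produce r, r' and |y - y'| to the power -(d-1)/2; the fourth makes the integral in ρ
converge. -/
lemma IsAdmissible.exists_sphAvg_inner_bound {d : ℕ} (hd : 3 ≤ d) {ψ₀ : Euc d → ℂ}
    (h : IsAdmissible ψ₀) :
    ∃ C : ℝ, 0 < C ∧ ∀ r r', 0 < r → 0 < r' → ∀ y y' : Euc d, y ≠ y' →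
      ‖∫ x, sphAvg (conv ψ₀ ψ₀) r (x - y) *
        (starRingEnd ℂ) (sphAvg (conv ψ₀ ψ₀) r' (x - y'))‖ ≤
        C * (r * r' * ‖y - y'‖) ^ (-(((d : ℝ) - 1) / 2)) := by
  set i : Fin d := ⟨0, by omega⟩ with hi
  obtain ⟨C₁, hC₁, hb⟩ := h.exists_fourier_mul_besselFun_le hd i
  -- Decay of order d+1 covers the polar weight ρ^{d-1} and leaves the integrable (1+ρ)^{-2}.
  obtain ⟨C₀, hC₀, h0⟩ := h.exists_fourier_bound (by omega) (d + 1)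
  set J : ℝ := ∫ ρ in Set.Ioi (0 : ℝ), (1 + ‖ρ‖) ^ (-(2 : ℝ)) with hJ
  have hJi : Integrable (fun ρ : ℝ => (1 + ‖ρ‖) ^ (-(2 : ℝ))) :=
    integrable_one_add_norm (by simp)
  have hJ0 : 0 ≤ J := integral_nonneg fun ρ => by positivity
  set β : ℝ := ((d : ℝ) - 1) / 2 with hβ
  refine ⟨C₁ ^ 3 * C₀ * J + 1, by positivity, fun r r' hr hr' y y' hyy => ?_⟩
  have hv : 0 < ‖y - y'‖ := norm_pos_iff.2 (sub_ne_zero.2 hyy)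
  let T : ℝ → SchwartzMap (Euc d) ℂ := fun r =>
    (hasCompactSupport_sphAvg h.hasCompactSupport_conv_self r).toSchwartzMap
      (contDiff_sphAvg r h.contDiff_conv_self h.hasCompactSupport_conv_self)
  let e : Euc d → Euc d → ℂ := fun a ξ =>
    Complex.exp ((-(2 * Real.pi) * inner ℝ a ξ : ℝ) * Complex.I)
  let m : Euc d → ℝ := fun ξ => ‖𝓕 ψ₀ ξ‖ ^ 4 * (besselFun i (2 * Real.pi * r * ‖ξ‖) *
    besselFun i (2 * Real.pi * r' * ‖ξ‖))
  have hF : ∀ r (a ξ : Euc d), (𝓕 (SchwartzMap.compSubConstCLM ℂ a (T r))) ξ =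
      e a ξ * (𝓕 ψ₀ ξ ^ 2 * (besselFun i (2 * Real.pi * r * ‖ξ‖) : ℂ)) := by
    intro r a ξ
    rw [← h.fourier_sphAvg_conv i]
    exact fourier_comp_sub (sphAvg (conv ψ₀ ψ₀) r) a ξ
  have hPl := SchwartzMap.integral_inner_fourier_fourier
    (SchwartzMap.compSubConstCLM ℂ y' (T r')) (SchwartzMap.compSubConstCLM ℂ y (T r))
  have hL : ∀ ξ : Euc d, inner ℂ ((𝓕 (SchwartzMap.compSubConstCLM ℂ y' (T r'))) ξ)
      ((𝓕 (SchwartzMap.compSubConstCLM ℂ y (T r))) ξ) = e (y - y') ξ * (m ξ : ℂ) := by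
    intro ξ
    rw [hF, hF, RCLike.inner_apply]
    simp only [map_mul, map_pow, Complex.conj_ofReal, e, m, ← Complex.exp_conj, Complex.conj_I]
    rw [inner_sub_left, mul_sub, Complex.ofReal_sub, sub_mul, Complex.exp_sub]
    rw [show ((-(2 * Real.pi) * inner ℝ y' ξ : ℝ) : ℂ) * -Complex.I =
      -(((-(2 * Real.pi) * inner ℝ y' ξ : ℝ) : ℂ) * Complex.I) by ring, Complex.exp_neg]
    push_cast
    rw [show ((‖𝓕 ψ₀ ξ‖ : ℂ)) ^ 4 = (‖𝓕 ψ₀ ξ‖ ^ 2 : ℂ) ^ 2 by ring, ← Complex.mul_conj']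
    ring
  have hR : ∀ x : Euc d, inner ℂ ((SchwartzMap.compSubConstCLM ℂ y' (T r')) x)
      ((SchwartzMap.compSubConstCLM ℂ y (T r)) x) = sphAvg (conv ψ₀ ψ₀) r (x - y) *
        (starRingEnd ℂ) (sphAvg (conv ψ₀ ψ₀) r' (x - y')) := by
    intro x
    rw [RCLike.inner_apply]
    rfl
  simp only [hL, hR] at hPl
  rw [← hPl]
  have hint : Integrable fun ξ : Euc d => e (y - y') ξ * (m ξ : ℂ) := by
    have : Integrable fun ξ : Euc d => inner ℂ ((𝓕 (SchwartzMap.compSubConstCLM ℂ y' (T r'))) ξ)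
      ((𝓕 (SchwartzMap.compSubConstCLM ℂ y (T r))) ξ) :=
      (SchwartzMap.memLp (𝓕 (SchwartzMap.compSubConstCLM ℂ y (T r))) 2 volume).integrable_mul
        (SchwartzMap.memLp (𝓕 (SchwartzMap.compSubConstCLM ℂ y' (T r'))) 2 volume).star
    simpa only [hL] using this
  rw [integral_polar (by omega) hint]
  have hinner : ∀ ρ : ℝ, 0 < ρ → ∫ θ : Sph d, e (y - y') (ρ • (θ : Euc d)) *
      (m (ρ • (θ : Euc d)) : ℂ) ∂sphereMeasure d =
      (m (EuclideanSpace.single i ρ) : ℂ) * (besselFun i (2 * Real.pi * ‖y - y'‖ * ρ) : ℂ) := by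
    intro ρ hρ
    have hm : ∀ θ : Sph d, m (ρ • (θ : Euc d)) = m (EuclideanSpace.single i ρ) := by
      intro θ
      have hn : ‖ρ • (θ : Euc d)‖ = ‖(EuclideanSpace.single i ρ : Euc d)‖ := by
        simp [norm_smul]
      simp only [m, hn, h.fourier_radial _ _ hn]
    have he : ∀ θ : Sph d, e (y - y') (ρ • (θ : Euc d)) =
        Complex.exp ((-(2 * Real.pi * ρ) * inner ℝ (θ : Euc d) (y - y') : ℝ) * Complex.I) := by
      intro θ
      simp only [e]
      rw [inner_smul_right, real_inner_comm]
      congr 3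
      ring
    simp only [hm, he]
    rw [integral_mul_const, integral_sphere_exp i, mul_comm]
    congr 2
    rw [besselFun, besselFun]
    congr 1
    funext θ
    rw [← Real.cos_neg]
    congr 1
    ring
  have hsc : ∀ ρ : ℝ, 0 < ρ → ‖(EuclideanSpace.single i ρ : Euc d)‖ = ρ := by
    intro ρ hρ
    simp [hρ.le]
  have hbd : ∀ ρ ∈ Set.Ioi (0 : ℝ), ‖((ρ ^ (d - 1) : ℝ) : ℂ) *
      ∫ θ : Sph d, e (y - y') (ρ • (θ : Euc d)) * (m (ρ • (θ : Euc d)) : ℂ) ∂sphereMeasure d‖ ≤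
      C₁ ^ 3 * (r * r' * ‖y - y'‖) ^ (-β) * C₀ * (1 + ‖ρ‖) ^ (-(2 : ℝ)) := by
    intro ρ hρ
    have hρ' : 0 < ρ := hρ
    rw [hinner ρ hρ', norm_mul, norm_mul, Complex.norm_real, Complex.norm_real, Complex.norm_real,
      Real.norm_of_nonneg (by positivity)]
    have hs := hsc ρ hρ'
    simp only [m, hs, norm_mul, norm_pow, Real.norm_eq_abs, abs_norm]
    have b1 := hb (EuclideanSpace.single i ρ) r hr
    have b2 := hb (EuclideanSpace.single i ρ) r' hr'
    have b3 := hb (EuclideanSpace.single i ρ) ‖y - y'‖ hv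
    have b4 := (h0 (EuclideanSpace.single i ρ)).2
    rw [hs] at b1 b2 b3 b4
    set g := ‖𝓕 ψ₀ (EuclideanSpace.single i ρ)‖
    have hg : 0 ≤ g := norm_nonneg _
    rw [Real.mul_rpow (by positivity) hv.le, Real.mul_rpow hr.le hr'.le]
    have habs : |ρ| = ρ := abs_of_pos hρ'
    have hlast : ρ ^ (d - 1) * g ≤ C₀ * (1 + |ρ|) ^ (-(2 : ℝ)) := by
      rw [habs, Real.rpow_neg (by positivity), ← div_eq_mul_inv, le_div_iff₀ (by positivity)]
      refine le_trans ?_ b4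
      rw [show (2 : ℝ) = ((2 : ℕ) : ℝ) by norm_num, Real.rpow_natCast]
      calc ρ ^ (d - 1) * g * (1 + ρ) ^ 2 ≤ (1 + ρ) ^ (d - 1) * g * (1 + ρ) ^ 2 := by
            gcongr; linarith
        _ = (1 + ρ) ^ (d - 1 + 2) * g := by rw [pow_add]; ring
        _ = (1 + ρ) ^ (d + 1) * g := by congr 2; omega
    calc _ = (ρ ^ (d - 1) * g) * ((g * |besselFun i (2 * Real.pi * r * ρ)|) *
          (g * |besselFun i (2 * Real.pi * r' * ρ)|) *
          (g * |besselFun i (2 * Real.pi * ‖y - y'‖ * ρ)|)) := by ring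
      _ ≤ (C₀ * (1 + |ρ|) ^ (-(2 : ℝ))) * ((C₁ * r ^ (-β)) * (C₁ * r' ^ (-β)) *
          (C₁ * ‖y - y'‖ ^ (-β))) := by gcongr
      _ = _ := by ring
  have hnorm := norm_integral_le_of_norm_le (μ := volume.restrict (Set.Ioi (0 : ℝ)))
    (hJi.integrableOn.const_mul (C₁ ^ 3 * (r * r' * ‖y - y'‖) ^ (-β) * C₀))
    ((ae_restrict_iff' measurableSet_Ioi).2 (Filter.Eventually.of_forall hbd))
  refine hnorm.trans ?_
  rw [integral_const_mul]
  have : 0 ≤ (r * r' * ‖y - y'‖) ^ (-β) := by positivity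
  rw [← hJ]
  nlinarith

/-- The spherical averages of `ψ₀ * ψ₀` form a spherical kernel. -/
lemma IsAdmissible.exists_isSphericalKernel {d : ℕ} (hd : 3 ≤ d) {ψ₀ : Euc d → ℂ}
    (h : IsAdmissible ψ₀) : ∃ C, IsSphericalKernel (fun r => sphAvg (conv ψ₀ ψ₀) r) C := by
  obtain ⟨C₁, hC₁, h1⟩ := h.exists_sphAvg_l2_bound hd
  obtain ⟨C₂, hC₂, h2⟩ := h.exists_sphAvg_inner_bound hd
  obtain ⟨B, hB⟩ := h.hasCompactSupport_conv_self.exists_bound_of_continuous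
    h.contDiff_conv_self.continuous
  have hi : Integrable (conv ψ₀ ψ₀) :=
    h.contDiff_conv_self.continuous.integrable_of_hasCompactSupport h.hasCompactSupport_conv_self
  set S := (sphereMeasure d).real Set.univ with hS
  set A := ∫ x, ‖conv ψ₀ ψ₀ x‖ with hA
  have hA0 : 0 ≤ A := integral_nonneg fun _ => norm_nonneg _
  have hS0 : 0 ≤ S := measureReal_nonneg
  have hB0 : 0 ≤ B := (norm_nonneg _).trans (hB 0)
  have hBS : 0 ≤ B * S := mul_nonneg hB0 hS0
  have hSA : 0 ≤ S * A := mul_nonneg hS0 hA0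
  refine ⟨C₁ + C₂ + B * S + S * A, by positivity, ?_, ?_, ?_, ?_, ?_, ?_⟩
  · exact continuous_sphAvg h.contDiff_conv_self.continuous
  · intro r x
    have := norm_sphAvg_le hB r x
    linarith
  · exact fun r x hr hx => sphAvg_ne_zero h.support_conv_self_subset hr hx
  · intro r
    refine (lintegral_enorm_sphAvg_le h.contDiff_conv_self.continuous r).trans ?_
    rw [← ofReal_integral_norm_eq_lintegral_enorm hi, ← hA,
      ← ENNReal.ofReal_toReal (measure_ne_top (sphereMeasure d) Set.univ),
      ← ENNReal.ofReal_mul ENNReal.toReal_nonneg]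
    refine ENNReal.ofReal_le_ofReal ?_
    change S * A ≤ _
    linarith
  · intro r hr b hb hB' hR
    refine (h1 r hr b hb hB' hR).trans ?_
    have : 0 ≤ r ^ (-((d : ℝ) - 1)) := by positivity
    gcongr
    linarith
  · intro r r' hr hr' y y' hyy
    refine (h2 r r' hr hr' y y' hyy).trans ?_
    have : 0 ≤ (r * r' * ‖y - y'‖) ^ (-(((d : ℝ) - 1) / 2)) := by positivity
    gcongr
    linarith

/-! ### Dyadic cubes, volumes of shells and a geometric series. -/

/-- The index of the dyadic cube of generation `ν` containing `x`. -/
noncomputable def cubeIndex {d : ℕ} (ν : ℤ) (x : Euc d) : Fin d → ℤ :=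
  fun i => ⌊x i / (2 : ℝ) ^ ν⌋

lemma mem_dyadicCube_iff {d : ℕ} {ν : ℤ} {z : Fin d → ℤ} {x : Euc d} :
    x ∈ dyadicCube ν z ↔ cubeIndex ν x = z := by
  have h2 : (0 : ℝ) < 2 ^ ν := by positivity
  simp only [dyadicCube, Set.mem_ofPred_eq, funext_iff, cubeIndex, Int.floor_eq_iff,
    le_div_iff₀ h2, div_lt_iff₀ h2]

lemma mem_dyadicCube_cubeIndex {d : ℕ} (ν : ℤ) (x : Euc d) : x ∈ dyadicCube ν (cubeIndex ν x) :=
  mem_dyadicCube_iff.2 rfl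

lemma measurable_cubeIndex {d : ℕ} (ν : ℤ) : Measurable (cubeIndex (d := d) ν) := by
  refine measurable_pi_iff.2 fun i => Int.measurable_floor.comp ?_
  have : Measurable fun x : Euc d => x i := by fun_prop
  exact this.div_const _

lemma measurableSet_dyadicCube {d : ℕ} (ν : ℤ) (z : Fin d → ℤ) :
    MeasurableSet (dyadicCube ν z) := by
  have : dyadicCube ν z = cubeIndex ν ⁻¹' {z} := by
    ext x; simp [mem_dyadicCube_iff]
  rw [this]
  exact measurable_cubeIndex ν (measurableSet_singleton z)

lemma pairwise_disjoint_dyadicCube {d : ℕ} (ν : ℤ) :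
    Pairwise (Function.onFun Disjoint (dyadicCube (d := d) ν)) := by
  intro z z' hz
  refine Set.disjoint_left.2 fun x hx hx' => hz ?_
  rw [mem_dyadicCube_iff] at hx hx'
  exact hx.symm.trans hx'

lemma iUnion_dyadicCube {d : ℕ} (ν : ℤ) : ⋃ z, dyadicCube (d := d) ν z = Set.univ :=
  Set.eq_univ_of_forall fun x => Set.mem_iUnion.2 ⟨_, mem_dyadicCube_cubeIndex ν x⟩

lemma volume_dyadicCube {d : ℕ} (ν : ℤ) (z : Fin d → ℤ) :
    volume (dyadicCube ν z) = ENNReal.ofReal ((2 : ℝ) ^ ν) ^ d := by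
  have h1 : dyadicCube ν z = (WithLp.ofLp : Euc d → Fin d → ℝ) ⁻¹' (Set.univ.pi fun i =>
      Set.Ico ((z i : ℝ) * 2 ^ ν) (((z i : ℝ) + 1) * 2 ^ ν)) := by
    ext x; simp [dyadicCube]
  rw [h1, (PiLp.volume_preserving_ofLp (Fin d)).measure_preimage
    (MeasurableSet.univ_pi fun i => measurableSet_Ico).nullMeasurableSet, Real.volume_pi_Ico]
  have : ∀ i, ((z i : ℝ) + 1) * 2 ^ ν - (z i : ℝ) * 2 ^ ν = 2 ^ ν := fun i => by ring
  simp [this]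

lemma norm_sub_le_of_mem_dyadicCube {d : ℕ} {ν : ℤ} {z : Fin d → ℤ} {x y : Euc d}
    (hx : x ∈ dyadicCube ν z) (hy : y ∈ dyadicCube ν z) : ‖y - x‖ ≤ d * (2 : ℝ) ^ ν := by
  rw [EuclideanSpace.norm_eq]
  refine Real.sqrt_le_iff.2 ⟨by positivity, ?_⟩
  calc ∑ i, ‖(y - x) i‖ ^ 2 ≤ ∑ _i : Fin d, ((2 : ℝ) ^ ν) ^ 2 := by
        refine Finset.sum_le_sum fun i _ => ?_
        refine pow_le_pow_left₀ (norm_nonneg _) ?_ 2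
        have h1 := hx i
        have h2 := hy i
        rw [Real.norm_eq_abs, PiLp.sub_apply, abs_le]
        constructor <;> nlinarith
    _ = d * ((2 : ℝ) ^ ν) ^ 2 := by simp
    _ ≤ (d * (2 : ℝ) ^ ν) ^ 2 := by
        rw [mul_pow]
        gcongr
        rcases Nat.eq_zero_or_pos d with rfl | hd
        · simp
        · have : (1 : ℝ) ≤ d := by exact_mod_cast hd
          nlinarith

lemma lintegral_eq_tsum_dyadicCube {d : ℕ} (ν : ℤ) (f : Euc d → ℝ≥0∞) :
    ∫⁻ x, f x = ∑' z, ∫⁻ x in dyadicCube ν z, f x := by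
  rw [← lintegral_iUnion (measurableSet_dyadicCube ν) (pairwise_disjoint_dyadicCube ν),
    iUnion_dyadicCube, Measure.restrict_univ]

/-- If the integral of `f` over each cube is at most `A`, its integral over `S` is at most `A` times
the number of cubes meeting `S`, hence controlled by the volume of a neighbourhood `T` of `S`. -/
lemma lintegral_le_of_dyadicCube_bound {d : ℕ} (ν : ℤ) {f : Euc d → ℝ≥0∞} {A : ℝ≥0∞}
    (hf : ∀ z, ∫⁻ y in dyadicCube ν z, f y ≤ A) {S T : Set (Euc d)}
    (hT : ∀ x ∈ S, ∀ y, ‖y - x‖ ≤ d * (2 : ℝ) ^ ν → y ∈ T) :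
    ∫⁻ y in S, f y ≤ A * (ENNReal.ofReal ((2 : ℝ) ^ ν) ^ d)⁻¹ * volume T := by
  let I := {z : Fin d → ℤ // (S ∩ dyadicCube ν z).Nonempty}
  set V := ENNReal.ofReal ((2 : ℝ) ^ ν) ^ d with hV
  have hV0 : V ≠ 0 := by
    refine pow_ne_zero _ ?_
    rw [Ne, ENNReal.ofReal_eq_zero, not_le]; positivity
  have hVt : V ≠ ⊤ := ENNReal.pow_ne_top ENNReal.ofReal_ne_top
  have hS : S ⊆ ⋃ z : I, dyadicCube ν z.1 := fun x hx =>
    Set.mem_iUnion.2 ⟨⟨cubeIndex ν x, x, hx, mem_dyadicCube_cubeIndex ν x⟩,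
      mem_dyadicCube_cubeIndex ν x⟩
  calc ∫⁻ y in S, f y ≤ ∫⁻ y in ⋃ z : I, dyadicCube ν z.1, f y := lintegral_mono_set hS
    _ ≤ ∑' z : I, ∫⁻ y in dyadicCube ν z.1, f y := lintegral_iUnion_le _ _
    _ ≤ ∑' _z : I, A := ENNReal.tsum_le_tsum fun z => hf z.1
    -- Counting cubes is replaced by adding their volumes: they are disjoint and contained in `T`.
    _ = ∑' z : I, A * V⁻¹ * volume (dyadicCube ν z.1) := by
        refine tsum_congr fun z => ?_
        rw [volume_dyadicCube, ← hV, mul_assoc, ENNReal.inv_mul_cancel hV0 hVt, mul_one]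
    _ = A * V⁻¹ * volume (⋃ z : I, dyadicCube ν z.1) := by
        have hdis : Pairwise (Function.onFun Disjoint fun z : I => dyadicCube ν z.1) :=
          fun z z' hz => pairwise_disjoint_dyadicCube ν fun h => hz (Subtype.ext h)
        rw [ENNReal.tsum_mul_left, measure_iUnion hdis fun z => measurableSet_dyadicCube ν z.1]
    _ ≤ A * V⁻¹ * volume T := by
        gcongr
        refine Set.iUnion_subset fun z y hy => ?_
        obtain ⟨x, hx, hxz⟩ := z.2
        exact hT x hx y (norm_sub_le_of_mem_dyadicCube hxz hy)

/-- Volume of a spherical shell. -/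
lemma volume_shell_le {d : ℕ} (hd : 0 < d) (y : Euc d) {r t : ℝ} (hr : 0 ≤ r) (ht : 0 ≤ t) :
    volume {x : Euc d | |‖x - y‖ - r| ≤ t} ≤
      sphereMeasure d Set.univ * ENNReal.ofReal (2 * t * (r + t) ^ (d - 1)) := by
  have hm : MeasurableSet {x : Euc d | |‖x‖ - r| ≤ t} :=
    measurableSet_le (by fun_prop) measurable_const
  have htr : volume {x : Euc d | |‖x - y‖ - r| ≤ t} = volume {x : Euc d | |‖x‖ - r| ≤ t} := by
    simp_rw [sub_eq_add_neg _ y]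
    exact measure_preimage_add_right volume (-y) {x : Euc d | |‖x‖ - r| ≤ t}
  rw [htr, ← lintegral_indicator_one hm,
    lintegral_polar hd (measurable_one.indicator hm)]
  have hsph : ∀ ρ ∈ Set.Ioi (0 : ℝ), ENNReal.ofReal (ρ ^ (d - 1)) *
      ∫⁻ θ : Sph d, ({x : Euc d | |‖x‖ - r| ≤ t}.indicator 1 (ρ • (θ : Euc d)) : ℝ≥0∞)
        ∂sphereMeasure d ≤
      (Set.Icc (r - t) (r + t)).indicator (fun _ => sphereMeasure d Set.univ *
        ENNReal.ofReal ((r + t) ^ (d - 1))) ρ := by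
    intro ρ hρ
    have hρ' : 0 < ρ := hρ
    have hn : ∀ θ : Sph d, ‖ρ • (θ : Euc d)‖ = ρ := fun θ => by
      rw [norm_smul, Real.norm_of_nonneg hρ'.le]; simp
    by_cases h : |ρ - r| ≤ t
    · have h' := abs_le.1 h
      have hI : ρ ∈ Set.Icc (r - t) (r + t) := ⟨by linarith, by linarith⟩
      rw [Set.indicator_of_mem hI]
      have : ∀ θ : Sph d, ({x : Euc d | |‖x‖ - r| ≤ t}.indicator 1 (ρ • (θ : Euc d)) : ℝ≥0∞) = 1 :=
        fun θ => by rw [Set.indicator_of_mem (by simpa [hn θ] using h)]; rfl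
      simp only [this, lintegral_one]
      rw [mul_comm]
      gcongr
      linarith
    · have : ∀ θ : Sph d, ({x : Euc d | |‖x‖ - r| ≤ t}.indicator 1 (ρ • (θ : Euc d)) : ℝ≥0∞) = 0 :=
        fun θ => by
          rw [Set.indicator_of_notMem]
          simp only [Set.mem_ofPred_eq, hn θ]
          exact h
      simp [this]
  refine (setLIntegral_mono' measurableSet_Ioi hsph).trans ?_
  refine (setLIntegral_le_lintegral _ _).trans ?_
  rw [lintegral_indicator_const measurableSet_Icc, Real.volume_Icc]
  rw [mul_assoc, ← ENNReal.ofReal_mul (by positivity)]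
  refine mul_le_mul_right (ENNReal.ofReal_le_ofReal (le_of_eq ?_)) _
  ring

/-- A geometric series started where `2 ^ m` exceeds `L`. -/
lemma exists_tsum_geometric_le {κ : ℝ} (hκ : 0 < κ) :
    ∃ C : ℝ, 0 < C ∧ ∀ L : ℝ, 0 < L →
      ∑' m : ℕ, (if L ≤ (2 : ℝ) ^ m then ENNReal.ofReal ((2 : ℝ) ^ (-(m * κ))) else 0) ≤
        ENNReal.ofReal (C * L ^ (-κ)) := by
  set q : ℝ := (2 : ℝ) ^ (-κ) with hq
  have hq0 : 0 < q := by positivity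
  have hq1 : q < 1 := Real.rpow_lt_one_of_one_lt_of_neg one_lt_two (by linarith)
  refine ⟨(1 - q)⁻¹, inv_pos.2 (by linarith), fun L hL => ?_⟩
  obtain ⟨m₀, hm₀, hmin⟩ : ∃ m₀ : ℕ, L ≤ (2 : ℝ) ^ m₀ ∧ ∀ m < m₀, ¬ L ≤ (2 : ℝ) ^ m := by
    classical
    have hex : ∃ m : ℕ, L ≤ (2 : ℝ) ^ m := by
      obtain ⟨m, hm⟩ := pow_unbounded_of_one_lt L (one_lt_two : (1 : ℝ) < 2)
      exact ⟨m, hm.le⟩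
    exact ⟨Nat.find hex, Nat.find_spec hex, fun m hm => Nat.find_min hex hm⟩
  have hterm : ∀ m : ℕ, (2 : ℝ) ^ (-(m * κ)) = q ^ m := by
    intro m
    rw [hq, ← Real.rpow_natCast, ← Real.rpow_mul zero_le_two]; congr 1; ring
  rw [← ENNReal.summable.sum_add_tsum_nat_add' (k := m₀), Finset.sum_eq_zero, zero_add]
  · calc ∑' m : ℕ, (if L ≤ (2 : ℝ) ^ (m + m₀) then
          ENNReal.ofReal ((2 : ℝ) ^ (-(((m + m₀ : ℕ) : ℝ) * κ))) else 0)
        ≤ ∑' m : ℕ, ENNReal.ofReal (L ^ (-κ)) * ENNReal.ofReal q ^ m := by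
          refine ENNReal.tsum_le_tsum fun m => ?_
          split_ifs
          · rw [hterm, ← ENNReal.ofReal_pow hq0.le, ← ENNReal.ofReal_mul (by positivity)]
            refine ENNReal.ofReal_le_ofReal ?_
            rw [pow_add, mul_comm]
            gcongr
            rw [← hterm, ← mul_neg, Real.rpow_mul zero_le_two, Real.rpow_natCast]
            exact Real.rpow_le_rpow_of_nonpos hL hm₀ (by linarith)
          · exact zero_le
      _ = ENNReal.ofReal (L ^ (-κ)) * (1 - ENNReal.ofReal q)⁻¹ := by
          rw [ENNReal.tsum_mul_left, ENNReal.tsum_geometric]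
      _ = _ := by
          rw [← ENNReal.ofReal_one, ← ENNReal.ofReal_sub _ hq0.le,
            ← ENNReal.ofReal_inv_of_pos (by linarith), ← ENNReal.ofReal_mul (by positivity),
            mul_comm]
  · intro m hm
    rw [if_neg (hmin m (Finset.mem_range.1 hm))]

/-! ### Superpositions of smoothed spheres and inner products of their slices. -/

lemma integrable_of_bounded_support {X : Type*} [MeasurableSpace X] {μ : Measure X} {f : X → ℂ}
    (hf : AEStronglyMeasurable f μ) {B : ℝ} (hB : ∀ x, ‖f x‖ ≤ B) {s : Set X} (hs : μ s ≠ ⊤)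
    (hfs : ∀ x, f x ≠ 0 → x ∈ s) : Integrable f μ := by
  have : IntegrableOn f s μ :=
    Measure.integrableOn_of_bounded (M := B) hs hf (Filter.Eventually.of_forall hB)
  exact (integrableOn_iff_integrable_of_support_subset fun x hx => hfs x hx).1 this

/-- The inner product of two superpositions is at most the superposition of the moduli of the
inner products. -/
lemma enorm_integral_mul_conj_le {X Y Z : Type*} [MeasurableSpace X] [MeasurableSpace Y]
    [MeasurableSpace Z] {μ : Measure X} {ν : Measure Y} {ρ : Measure Z} [SFinite μ] [SFinite ν]
    [SFinite ρ] {a : Y → X → ℂ} {b : Z → X → ℂ} (ha : Measurable fun q : Y × X => a q.1 q.2)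
    (hb : Measurable fun q : Z × X => b q.1 q.2) {A B : ℝ} (hA : ∀ y x, ‖a y x‖ ≤ A)
    (hB : ∀ z x, ‖b z x‖ ≤ B) {s : Set X} {t : Set Y} {u : Set Z} (hs : μ s ≠ ⊤) (ht : ν t ≠ ⊤)
    (hu : ρ u ≠ ⊤) (has : ∀ y x, a y x ≠ 0 → y ∈ t ∧ x ∈ s) (hbs : ∀ z x, b z x ≠ 0 → z ∈ u) :
    ‖∫ x, (∫ y, a y x ∂ν) * (starRingEnd ℂ) (∫ z, b z x ∂ρ) ∂μ‖ₑ ≤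
      ∫⁻ y, ∫⁻ z, ‖∫ x, a y x * (starRingEnd ℂ) (b z x) ∂μ‖ₑ ∂ρ ∂ν := by
  have hm : Measurable fun q : X × (Y × Z) => a q.2.1 q.1 * (starRingEnd ℂ) (b q.2.2 q.1) := by
    refine Measurable.mul ?_ ?_
    · exact ha.comp (by fun_prop : Measurable fun q : X × (Y × Z) => (q.2.1, q.1))
    · exact Complex.continuous_conj.measurable.comp
        (hb.comp (by fun_prop : Measurable fun q : X × (Y × Z) => (q.2.2, q.1)))
  have hA0 : ∀ y x, 0 ≤ A := fun y x => (norm_nonneg _).trans (hA y x)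
  have hint : Integrable (fun q : X × (Y × Z) => a q.2.1 q.1 * (starRingEnd ℂ) (b q.2.2 q.1))
      (μ.prod (ν.prod ρ)) := by
    refine integrable_of_bounded_support hm.aestronglyMeasurable (B := A * B) (s := s ×ˢ (t ×ˢ u))
      (fun q => ?_) ?_ fun q hq => ?_
    · rw [norm_mul, RCLike.norm_conj]
      exact mul_le_mul (hA _ _) (hB _ _) (norm_nonneg _) (hA0 q.2.1 q.1)
    · rw [Measure.prod_prod, Measure.prod_prod]
      exact ENNReal.mul_ne_top hs (ENNReal.mul_ne_top ht hu)
    · have h1 := has _ _ (left_ne_zero_of_mul hq)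
      have h2 : b q.2.2 q.1 ≠ 0 := fun h => hq (by simp [h])
      exact ⟨h1.2, h1.1, hbs _ _ h2⟩
  have h1 : ∀ x, (∫ y, a y x ∂ν) * (starRingEnd ℂ) (∫ z, b z x ∂ρ) =
      ∫ p : Y × Z, a p.1 x * (starRingEnd ℂ) (b p.2 x) ∂(ν.prod ρ) := by
    intro x
    rw [← integral_conj]
    exact (integral_prod_mul (fun y => a y x) (fun z => (starRingEnd ℂ) (b z x))).symm
  simp only [h1]
  rw [integral_integral_swap hint]
  refine (enorm_integral_le_lintegral_enorm _).trans (le_of_eq ?_)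
  rw [lintegral_prod]
  have hsm := hm.stronglyMeasurable.integral_prod_left' (μ := μ)
  exact hsm.measurable.enorm.aemeasurable

/-- The densities on which the operator `sphOp` acts: bounded measurable functions of the centre `y`
and the radius `r`, with bounded support in `{r ≥ 1}`. -/
structure IsTest {d : ℕ} (h : Euc d → ℝ → ℂ) : Prop where
  meas : Measurable fun q : Euc d × ℝ => h q.1 q.2
  bdd : ∃ B, ∀ y r, ‖h y r‖ ≤ B
  supp : ∃ R, ∀ y r, h y r ≠ 0 → 1 ≤ r ∧ r ≤ R ∧ ‖y‖ ≤ R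

/-- Superposition of the kernels of radius `r`. -/
noncomputable def sphConv {d : ℕ} (F : ℝ → Euc d → ℂ) (h : Euc d → ℝ → ℂ) (r : ℝ) (x : Euc d) : ℂ :=
  ∫ y, h y r * F r (x - y)

/-- Superposition of the kernels `F_r(· - y)` with density `h(y, r) r^{d-1} dy dr`. -/
noncomputable def sphOp {d : ℕ} (F : ℝ → Euc d → ℂ) (h : Euc d → ℝ → ℂ) (x : Euc d) : ℂ :=
  ∫ r, ((r ^ (d - 1) : ℝ) : ℂ) * sphConv F h r x

/-- The integral of `w` with respect to `r^{d-1} dy dr`. -/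
noncomputable def wmass {d : ℕ} (w : Euc d → ℝ → ℝ≥0∞) : ℝ≥0∞ :=
  ∫⁻ r, ENNReal.ofReal (r ^ (d - 1)) * ∫⁻ y, w y r

section

variable {d : ℕ} {F : ℝ → Euc d → ℂ} {C : ℝ} {h : Euc d → ℝ → ℂ}

lemma IsTest.measurable_slice (hh : IsTest h) (r : ℝ) : Measurable fun y => h y r :=
  hh.meas.comp (by fun_prop : Measurable fun y : Euc d => (y, r))

lemma IsSphericalKernel.norm_le (hF : IsSphericalKernel F C) {r : ℝ} (hr : 0 ≤ r) {x : Euc d}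
    (hx : F r x ≠ 0) : ‖x‖ ≤ r + 1 / 5 := by
  have := (abs_le.1 (hF.supp r x hr hx)).2
  linarith

lemma IsSphericalKernel.measurable_integrand (hF : IsSphericalKernel F C) (hh : IsTest h) :
    Measurable fun q : (ℝ × Euc d) × Euc d => h q.2 q.1.1 * F q.1.1 (q.1.2 - q.2) :=
  (hh.meas.comp (by fun_prop : Measurable fun q : (ℝ × Euc d) × Euc d => (q.2, q.1.1))).mul
    (hF.cont.measurable.comp
      (by fun_prop : Measurable fun q : (ℝ × Euc d) × Euc d => (q.1.1, q.1.2 - q.2)))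

lemma IsSphericalKernel.measurable_sphConv (hF : IsSphericalKernel F C) (hh : IsTest h) :
    Measurable fun q : ℝ × Euc d => sphConv F h q.1 q.2 :=
  (hF.measurable_integrand hh).stronglyMeasurable.integral_prod_right'.measurable

lemma IsSphericalKernel.exists_integrand_bound (hF : IsSphericalKernel F C) (hh : IsTest h) :
    ∃ B R : ℝ, 1 ≤ R ∧ (∀ r x y, ‖h y r * F r (x - y)‖ ≤ B) ∧
      (∀ r x y, h y r * F r (x - y) ≠ 0 → 1 ≤ r ∧ r ≤ R ∧ ‖y‖ ≤ R ∧ ‖x‖ ≤ R) := by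
  obtain ⟨B, hB⟩ := hh.bdd
  obtain ⟨R, hR⟩ := hh.supp
  refine ⟨B * C, max 1 (2 * R + 1), le_max_left _ _, fun r x y => ?_, fun r x y hne => ?_⟩
  · rw [norm_mul]
    exact mul_le_mul (hB _ _) (hF.bound _ _) (norm_nonneg _) ((norm_nonneg _).trans (hB y r))
  · obtain ⟨h1, h2, h3⟩ := hR y r (left_ne_zero_of_mul hne)
    have h4 := hF.norm_le (by linarith) (right_ne_zero_of_mul hne)
    have h5 := norm_add_le (x - y) y
    rw [sub_add_cancel] at h5
    have : 2 * R + 1 ≤ max 1 (2 * R + 1) := le_max_right _ _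
    exact ⟨h1, by linarith, by linarith, by linarith⟩

lemma IsSphericalKernel.integrable_integrand (hF : IsSphericalKernel F C) (hh : IsTest h) (r : ℝ)
    (x : Euc d) : Integrable fun y => h y r * F r (x - y) := by
  obtain ⟨B, R, hR1, hB, hR⟩ := hF.exists_integrand_bound hh
  refine integrable_of_bounded_support (B := B) (s := Metric.closedBall 0 R) ?_ (hB r x)
    measure_closedBall_lt_top.ne fun y hy => ?_
  · exact ((hF.measurable_integrand hh).comp
      (by fun_prop : Measurable fun y : Euc d => ((r, x), y))).aestronglyMeasurable
  · exact mem_closedBall_zero_iff.2 (hR r x y hy).2.2.1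

lemma IsSphericalKernel.exists_sphConv_bound (hF : IsSphericalKernel F C) (hh : IsTest h) :
    ∃ B R : ℝ, 1 ≤ R ∧ (∀ r x, ‖sphConv F h r x‖ ≤ B) ∧
      (∀ r x, sphConv F h r x ≠ 0 → 1 ≤ r ∧ r ≤ R ∧ ‖x‖ ≤ R) := by
  obtain ⟨B, R, hR1, hB, hR⟩ := hF.exists_integrand_bound hh
  refine ⟨B * (volume : Measure (Euc d)).real (Metric.closedBall 0 R), R, hR1, fun r x => ?_,
    fun r x hne => ?_⟩
  · have : sphConv F h r x = ∫ y in Metric.closedBall 0 R, h y r * F r (x - y) := by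
      refine (setIntegral_eq_integral_of_forall_compl_eq_zero fun y hy => ?_).symm
      by_contra hne
      exact hy (mem_closedBall_zero_iff.2 (hR r x y hne).2.2.1)
    rw [this]
    exact norm_setIntegral_le_of_norm_le_const measure_closedBall_lt_top fun y _ => hB r x y
  · have : ∃ y, h y r * F r (x - y) ≠ 0 := by
      by_contra! hall
      exact hne (by simp [sphConv, hall])
    obtain ⟨y, hy⟩ := this
    obtain ⟨h1, h2, -, h4⟩ := hR r x y hy
    exact ⟨h1, h2, h4⟩

lemma IsSphericalKernel.exists_weighted_sphConv_bound (hF : IsSphericalKernel F C)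
    (hh : IsTest h) :
    ∃ B R : ℝ, (∀ r x, ‖((r ^ (d - 1) : ℝ) : ℂ) * sphConv F h r x‖ ≤ B) ∧
      (∀ r x, ((r ^ (d - 1) : ℝ) : ℂ) * sphConv F h r x ≠ 0 → 1 ≤ r ∧ r ≤ R ∧ ‖x‖ ≤ R) := by
  obtain ⟨B, R, hR1, hB, hR⟩ := hF.exists_sphConv_bound hh
  refine ⟨R ^ (d - 1) * B, R, fun r x => ?_, fun r x hne => hR r x (right_ne_zero_of_mul hne)⟩
  have hB0 : 0 ≤ B := (norm_nonneg _).trans (hB r x)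
  by_cases h0 : sphConv F h r x = 0
  · rw [h0, mul_zero, norm_zero]; positivity
  · obtain ⟨h1, h2, -⟩ := hR r x h0
    rw [norm_mul, Complex.norm_real, Real.norm_of_nonneg (by positivity)]
    exact mul_le_mul (pow_le_pow_left₀ (by linarith) h2 _) (hB r x) (norm_nonneg _)
      (by positivity)

lemma IsSphericalKernel.measurable_weighted_sphConv (hF : IsSphericalKernel F C) (hh : IsTest h) :
    Measurable fun q : ℝ × Euc d => ((q.1 ^ (d - 1) : ℝ) : ℂ) * sphConv F h q.1 q.2 :=
  (by fun_prop : Measurable fun q : ℝ × Euc d => ((q.1 ^ (d - 1) : ℝ) : ℂ)).mul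
    (hF.measurable_sphConv hh)

lemma IsSphericalKernel.integrable_weighted_sphConv (hF : IsSphericalKernel F C) (hh : IsTest h)
    (x : Euc d) : Integrable fun r : ℝ => ((r ^ (d - 1) : ℝ) : ℂ) * sphConv F h r x := by
  obtain ⟨B, R, hB, hR⟩ := hF.exists_weighted_sphConv_bound hh
  refine integrable_of_bounded_support (B := B) (s := Set.Icc 1 R) ?_ (fun r => hB r x)
    (by simp) fun r hr => ⟨(hR r x hr).1, (hR r x hr).2.1⟩
  exact ((hF.measurable_weighted_sphConv hh).comp
    (by fun_prop : Measurable fun r : ℝ => (r, x))).aestronglyMeasurable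

lemma IsSphericalKernel.measurable_sphOp (hF : IsSphericalKernel F C) (hh : IsTest h) :
    Measurable (sphOp F h) :=
  (hF.measurable_weighted_sphConv hh).stronglyMeasurable.integral_prod_left'.measurable

/-- The `L²` norm of `sphOp F h` is controlled by the inner products of the slices. -/
lemma IsSphericalKernel.lintegral_sphOp_sq_le (hF : IsSphericalKernel F C) (hh : IsTest h) :
    ∫⁻ x, ‖sphOp F h x‖ₑ ^ 2 ≤ ∫⁻ r, ∫⁻ r', ‖∫ x, (((r ^ (d - 1) : ℝ) : ℂ) * sphConv F h r x) *
      (starRingEnd ℂ) (((r' ^ (d - 1) : ℝ) : ℂ) * sphConv F h r' x)‖ₑ := by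
  obtain ⟨B, R, hB, hR⟩ := hF.exists_weighted_sphConv_bound hh
  have hm := hF.measurable_weighted_sphConv hh
  have h1 := enorm_integral_mul_conj_le (μ := volume) (ν := volume) (ρ := volume) hm hm hB hB
    (s := Metric.closedBall 0 R) (t := Set.Icc 1 R) (u := Set.Icc 1 R)
    measure_closedBall_lt_top.ne (by simp) (by simp)
    (fun r x hne => ⟨⟨(hR r x hne).1, (hR r x hne).2.1⟩,
      mem_closedBall_zero_iff.2 (hR r x hne).2.2⟩)
    (fun r x hne => ⟨(hR r x hne).1, (hR r x hne).2.1⟩)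
  refine le_trans (le_of_eq ?_) h1
  have hbd : ∀ x, ‖sphOp F h x‖ ≤ B * (volume : Measure ℝ).real (Set.Icc 1 R) := by
    intro x
    have : sphOp F h x = ∫ r in Set.Icc 1 R, ((r ^ (d - 1) : ℝ) : ℂ) * sphConv F h r x := by
      refine (setIntegral_eq_integral_of_forall_compl_eq_zero fun r hr => ?_).symm
      by_contra hne
      exact hr ⟨(hR r x hne).1, (hR r x hne).2.1⟩
    rw [this]
    exact norm_setIntegral_le_of_norm_le_const (by simp) fun r _ => hB r x
  have hsupp : ∀ x, sphOp F h x ≠ 0 → x ∈ Metric.closedBall (0 : Euc d) R := by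
    intro x hx
    have : ∃ r, ((r ^ (d - 1) : ℝ) : ℂ) * sphConv F h r x ≠ 0 := by
      by_contra! hall
      exact hx (by simp only [sphOp, hall, integral_zero])
    obtain ⟨r, hr⟩ := this
    exact mem_closedBall_zero_iff.2 (hR r x hr).2.2
  have hsq : ∀ x, sphOp F h x * (starRingEnd ℂ) (sphOp F h x) = ((‖sphOp F h x‖ ^ 2 : ℝ) : ℂ) := by
    intro x
    rw [Complex.mul_conj']; push_cast; rfl
  change _ = ‖∫ x, sphOp F h x * (starRingEnd ℂ) (sphOp F h x)‖ₑ
  simp only [hsq]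
  rw [integral_complex_ofReal, ← ofReal_norm, Complex.norm_real,
    Real.norm_of_nonneg (integral_nonneg fun x => by positivity),
    ofReal_integral_eq_lintegral_ofReal]
  · refine lintegral_congr fun x => ?_
    rw [ENNReal.ofReal_pow (norm_nonneg _), ofReal_norm]
  · have hmo := hF.measurable_sphOp hh
    have := integrable_of_bounded_support (μ := volume) (f := fun x =>
      sphOp F h x * (starRingEnd ℂ) (sphOp F h x))
      (B := (B * (volume : Measure ℝ).real (Set.Icc 1 R)) * (B * (volume : Measure ℝ).real (Set.Icc 1 R)))
      (s := Metric.closedBall 0 R)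
      (hmo.mul (Complex.continuous_conj.measurable.comp hmo)).aestronglyMeasurable
      (fun x => by
        rw [norm_mul, RCLike.norm_conj]
        exact mul_le_mul (hbd x) (hbd x) (norm_nonneg _) ((norm_nonneg _).trans (hbd x)))
      measure_closedBall_lt_top.ne (fun x hx => hsupp x (left_ne_zero_of_mul hx))
    have h2 := this.norm
    refine h2.congr (Filter.Eventually.of_forall fun x => ?_)
    simp only [norm_mul, RCLike.norm_conj, sq]
  · exact Filter.Eventually.of_forall fun x => by positivity

/-- `L²` bound for a weighted slice. -/
lemma IsSphericalKernel.lintegral_weighted_sphConv_sq_le (hd : 1 ≤ d) (hF : IsSphericalKernel F C)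
    (hh : IsTest h) (r : ℝ) :
    ∫⁻ x, ‖((r ^ (d - 1) : ℝ) : ℂ) * sphConv F h r x‖ₑ ^ 2 ≤
      ENNReal.ofReal C * (ENNReal.ofReal (r ^ (d - 1)) * ∫⁻ y, ‖h y r‖ₑ ^ 2) := by
  obtain ⟨B, hB⟩ := hh.bdd
  obtain ⟨R, hR⟩ := hh.supp
  by_cases hr : 1 ≤ r
  · have h1 := hF.l2 r (by linarith) (fun y => h y r) (hh.measurable_slice r) ⟨B, fun y => hB y r⟩
      ⟨R, fun y hy => (hR y r hy).2.2⟩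
    simp only [enorm_mul, mul_pow]
    rw [lintegral_const_mul' _ _ (by finiteness)]
    -- The squared weight r^{2(d-1)} against the decay r^{-(d-1)} leaves r^{d-1}, the weight of
    -- `wmass`.
    refine (mul_le_mul_right h1 _).trans (le_of_eq ?_)
    rw [← mul_assoc, ← mul_assoc, ← ofReal_norm, Complex.norm_real,
      Real.norm_of_nonneg (by positivity), ← ENNReal.ofReal_pow (by positivity),
      ← ENNReal.ofReal_mul (by positivity), ← ENNReal.ofReal_mul hF.pos.le]
    congr 2
    rw [Real.rpow_neg (by linarith), show (d : ℝ) - 1 = ((d - 1 : ℕ) : ℝ) by rw [Nat.cast_sub hd]; simp,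
      Real.rpow_natCast]
    have : r ^ (d - 1) ≠ 0 := by positivity
    field_simp
  · have : ∀ x, sphConv F h r x = 0 := by
      intro x
      have h0 : ∀ y, h y r = 0 := fun y => by
        by_contra hne; exact hr (hR y r hne).1
      simp [sphConv, h0]
    simp [this]

/-- The inner product of two slices, by the triangle inequality. -/
lemma IsSphericalKernel.enorm_inner_slices_le_near (hd : 1 ≤ d) (hF : IsSphericalKernel F C)
    (hh : IsTest h) (r r' : ℝ) :
    ‖∫ x, (((r ^ (d - 1) : ℝ) : ℂ) * sphConv F h r x) *
      (starRingEnd ℂ) (((r' ^ (d - 1) : ℝ) : ℂ) * sphConv F h r' x)‖ₑ ≤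
    ENNReal.ofReal C * (ENNReal.ofReal (r ^ (d - 1)) * ∫⁻ y, ‖h y r‖ₑ ^ 2) +
      ENNReal.ofReal C * (ENNReal.ofReal (r' ^ (d - 1)) * ∫⁻ y, ‖h y r'‖ₑ ^ 2) := by
  refine (enorm_integral_le_lintegral_enorm _).trans ?_
  refine le_trans ?_ (add_le_add (hF.lintegral_weighted_sphConv_sq_le hd hh r)
    (hF.lintegral_weighted_sphConv_sq_le hd hh r'))
  have hm : Measurable fun x => ‖((r ^ (d - 1) : ℝ) : ℂ) * sphConv F h r x‖ₑ ^ 2 :=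
    (((hF.measurable_weighted_sphConv hh).comp
      (by fun_prop : Measurable fun x : Euc d => (r, x))).enorm).pow_const 2
  rw [← lintegral_add_left hm]
  refine lintegral_mono fun x => ?_
  rw [enorm_mul]
  have hc : ∀ z : ℂ, ‖(starRingEnd ℂ) z‖ₑ = ‖z‖ₑ := fun z => by
    rw [← ofReal_norm, RCLike.norm_conj, ofReal_norm]
  rw [hc]
  rcases le_total ‖((r ^ (d - 1) : ℝ) : ℂ) * sphConv F h r x‖ₑ
    ‖((r' ^ (d - 1) : ℝ) : ℂ) * sphConv F h r' x‖ₑ with hle | hle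
  · refine le_trans ?_ le_add_self
    rw [sq]; gcongr
  · refine le_trans ?_ le_self_add
    rw [sq]; gcongr

/-- The inner product of two slices, in terms of the inner products of the kernels. -/
lemma IsSphericalKernel.enorm_inner_slices_le_far (hF : IsSphericalKernel F C)
    (hh : IsTest h) (r r' : ℝ) :
    ‖∫ x, (((r ^ (d - 1) : ℝ) : ℂ) * sphConv F h r x) *
      (starRingEnd ℂ) (((r' ^ (d - 1) : ℝ) : ℂ) * sphConv F h r' x)‖ₑ ≤
    ∫⁻ y', ENNReal.ofReal (r' ^ (d - 1)) * ‖h y' r'‖ₑ *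
      (ENNReal.ofReal (r ^ (d - 1)) * ∫⁻ y, ‖h y r‖ₑ *
        ‖∫ x, F r (x - y) * (starRingEnd ℂ) (F r' (x - y'))‖ₑ) := by
  obtain ⟨B, R, hR1, hB, hR⟩ := hF.exists_integrand_bound hh
  have hms : ∀ r, Measurable fun q : Euc d × Euc d => h q.1 r * F r (q.2 - q.1) := fun r =>
    (hF.measurable_integrand hh).comp
      (by fun_prop : Measurable fun q : Euc d × Euc d => ((r, q.2), q.1))
  have hc : ∀ z : ℂ, ‖(starRingEnd ℂ) z‖ₑ = ‖z‖ₑ := fun z => by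
    rw [← ofReal_norm, RCLike.norm_conj, ofReal_norm]
  have h1 := enorm_integral_mul_conj_le (μ := volume) (ν := volume) (ρ := volume) (hms r) (hms r')
    (fun y x => hB r x y) (fun y x => hB r' x y)
    (s := Metric.closedBall 0 R) (t := Metric.closedBall 0 R) (u := Metric.closedBall 0 R)
    measure_closedBall_lt_top.ne measure_closedBall_lt_top.ne measure_closedBall_lt_top.ne
    (fun y x hne => ⟨mem_closedBall_zero_iff.2 (hR r x y hne).2.2.1,
      mem_closedBall_zero_iff.2 (hR r x y hne).2.2.2⟩)
    (fun y x hne => mem_closedBall_zero_iff.2 (hR r' x y hne).2.2.1)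
  have h2 : ∀ x, (((r ^ (d - 1) : ℝ) : ℂ) * sphConv F h r x) *
      (starRingEnd ℂ) (((r' ^ (d - 1) : ℝ) : ℂ) * sphConv F h r' x) =
      (((r ^ (d - 1) : ℝ) : ℂ) * ((r' ^ (d - 1) : ℝ) : ℂ)) *
        (sphConv F h r x * (starRingEnd ℂ) (sphConv F h r' x)) := by
    intro x
    rw [map_mul, Complex.conj_ofReal]; ring
  have h3 : ∀ y z, ∫ x, h y r * F r (x - y) * (starRingEnd ℂ) (h z r' * F r' (x - z)) =
      (h y r * (starRingEnd ℂ) (h z r')) *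
        ∫ x, F r (x - y) * (starRingEnd ℂ) (F r' (x - z)) := by
    intro y z
    rw [← integral_const_mul]
    refine integral_congr_ae (Filter.Eventually.of_forall fun x => ?_)
    simp only [map_mul]; ring
  by_cases hr : 1 ≤ r ∧ 1 ≤ r'
  · obtain ⟨hr, hr'⟩ := hr
    simp only [h2]
    rw [integral_const_mul, enorm_mul]
    have hcoef : ‖((r ^ (d - 1) : ℝ) : ℂ) * ((r' ^ (d - 1) : ℝ) : ℂ)‖ₑ =
        ENNReal.ofReal (r ^ (d - 1)) * ENNReal.ofReal (r' ^ (d - 1)) := by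
      rw [enorm_mul, ← ofReal_norm, ← ofReal_norm, Complex.norm_real, Complex.norm_real,
        Real.norm_of_nonneg (by positivity), Real.norm_of_nonneg (by positivity)]
    rw [hcoef]
    refine (mul_le_mul_right h1 _).trans (le_of_eq ?_)
    simp only [h3, enorm_mul, hc]
    have hmΦ : Measurable fun q : Euc d × Euc d =>
        ‖∫ x, F r (x - q.1) * (starRingEnd ℂ) (F r' (x - q.2))‖ₑ := by
      have hm : Measurable fun q : (Euc d × Euc d) × Euc d =>
          F r (q.2 - q.1.1) * (starRingEnd ℂ) (F r' (q.2 - q.1.2)) := by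
        refine Measurable.mul ?_ (Complex.continuous_conj.measurable.comp ?_)
        · exact hF.cont.measurable.comp
            (by fun_prop : Measurable fun q : (Euc d × Euc d) × Euc d => (r, q.2 - q.1.1))
        · exact hF.cont.measurable.comp
            (by fun_prop : Measurable fun q : (Euc d × Euc d) × Euc d => (r', q.2 - q.1.2))
      exact hm.stronglyMeasurable.integral_prod_right'.measurable.enorm
    rw [lintegral_lintegral_swap]
    · rw [← lintegral_const_mul' _ _ (by finiteness)]
      refine lintegral_congr fun y' => ?_
      have e1 : ∀ y, ‖h y r‖ₑ * ‖h y' r'‖ₑ *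
          ‖∫ x, F r (x - y) * (starRingEnd ℂ) (F r' (x - y'))‖ₑ =
          ‖h y' r'‖ₑ * (‖h y r‖ₑ * ‖∫ x, F r (x - y) * (starRingEnd ℂ) (F r' (x - y'))‖ₑ) :=
        fun y => by ring
      simp only [e1]
      rw [lintegral_const_mul' _ _ (by finiteness)]
      ring
    · refine Measurable.aemeasurable (Measurable.mul (Measurable.mul ?_ ?_) hmΦ)
      · exact ((hh.measurable_slice r).comp measurable_fst).enorm
      · exact ((hh.measurable_slice r').comp measurable_snd).enorm
  · have hz : ∀ x, sphConv F h r x * (starRingEnd ℂ) (sphConv F h r' x) = 0 := by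
      intro x
      by_contra hne
      obtain ⟨B', R', _, _, hR'⟩ := hF.exists_sphConv_bound hh
      refine hr ⟨(hR' r x (left_ne_zero_of_mul hne)).1, (hR' r' x fun h0 => hne (by simp [h0])).1⟩
    simp only [h2, hz, mul_zero, integral_zero, enorm_zero, zero_le]

end

/-! ### The density condition and the interaction with a distant larger sphere. -/

/-- `h` has mass at most `u * 2 ^ (m * (1 + δ))` on each box of side `2 ^ m` at height at
least `2 ^ m`. -/
def HasDensity {d : ℕ} (h : Euc d → ℝ → ℂ) (δ u : ℝ) : Prop :=
  ∀ (m n : ℕ) (z : Fin d → ℤ), 1 ≤ n →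
    ∫⁻ q in dyadicCube (m : ℤ) z ×ˢ Set.Ico (n * (2 : ℝ) ^ m) ((n + 1) * (2 : ℝ) ^ m),
      ‖h q.1 q.2‖ₑ ≤ ENNReal.ofReal (u * (2 : ℝ) ^ (m * (1 + δ)))

section

variable {d : ℕ} {F : ℝ → Euc d → ℂ} {C : ℝ} {h : Euc d → ℝ → ℂ}

lemma IsTest.measurable_enorm (hh : IsTest h) : Measurable fun q : Euc d × ℝ => ‖h q.1 q.2‖ₑ :=
  hh.meas.enorm

lemma setLIntegral_prod_eq {S : Set (Euc d)} {I : Set ℝ}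
    {f : Euc d × ℝ → ℝ≥0∞} (hf : Measurable f) :
    ∫⁻ q in S ×ˢ I, f q = ∫⁻ y in S, ∫⁻ r in I, f (y, r) := by
  rw [Measure.volume_eq_prod, ← Measure.prod_restrict, lintegral_prod _ hf.aemeasurable]

/-- Mass of a density in a slab, by covering with boxes. -/
lemma HasDensity.slab_le (hh : IsTest h) {δ u : ℝ} (hu : HasDensity h δ u) (m n : ℕ) (hn : 1 ≤ n)
    {S T : Set (Euc d)} (hT : ∀ x ∈ S, ∀ y, ‖y - x‖ ≤ d * (2 : ℝ) ^ m → y ∈ T) :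
    ∫⁻ q in S ×ˢ Set.Ico (n * (2 : ℝ) ^ m) ((n + 1) * (2 : ℝ) ^ m), ‖h q.1 q.2‖ₑ ≤
      ENNReal.ofReal (u * (2 : ℝ) ^ (m * (1 + δ))) * (ENNReal.ofReal ((2 : ℝ) ^ m) ^ d)⁻¹ *
        volume T := by
  rw [setLIntegral_prod_eq hh.measurable_enorm]
  have h1 := lintegral_le_of_dyadicCube_bound (m : ℤ)
    (f := fun y => ∫⁻ r in Set.Ico (n * (2 : ℝ) ^ m) ((n + 1) * (2 : ℝ) ^ m), ‖h y r‖ₑ)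
    (A := ENNReal.ofReal (u * (2 : ℝ) ^ (m * (1 + δ)))) (fun z => by
      have := hu m n z hn
      rwa [setLIntegral_prod_eq hh.measurable_enorm] at this)
    (S := S) (T := T) (by simpa using hT)
  simpa using h1

/-- Mass of a density in a box of side comparable to `2 ^ m`. -/
lemma HasDensity.box_le (hh : IsTest h) {δ u : ℝ} (hu : HasDensity h δ u) (m : ℕ)
    (y' : Euc d) (r' : ℝ) :
    ∫⁻ q in Metric.closedBall y' ((2 : ℝ) ^ (m + 1)) ×ˢ
        (Set.Ici ((2 : ℝ) ^ m) ∩ Set.Icc (r' - (2 : ℝ) ^ (m + 2)) r'), ‖h q.1 q.2‖ₑ ≤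
      ENNReal.ofReal (5 * (2 + d) ^ d * (volume : Measure (Euc d)).real (Metric.ball 0 1) *
        (u * (2 : ℝ) ^ (m * (1 + δ)))) := by
  have h2 : (0 : ℝ) < 2 ^ m := by positivity
  set V := (volume : Measure (Euc d)).real (Metric.ball 0 1) with hV
  set N := ⌊r' / (2 : ℝ) ^ m⌋₊ with hN
  set U := ENNReal.ofReal (u * (2 : ℝ) ^ (m * (1 + δ))) with hU
  -- An interval of length 4·2^m below `r'` meets at most five slabs of height 2^m. The subtraction
  -- is truncated, and a slab of index 0 is replaced by the empty set since the density condition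
  -- says nothing about it; heights at least 2^m never need it.
  let J : Fin 5 → Set ℝ := fun i => if 1 ≤ N - i.1 then
    Set.Ico (((N - i.1 : ℕ) : ℝ) * (2 : ℝ) ^ m) ((((N - i.1 : ℕ) : ℝ) + 1) * (2 : ℝ) ^ m) else ∅
  have hcov : Metric.closedBall y' ((2 : ℝ) ^ (m + 1)) ×ˢ
        (Set.Ici ((2 : ℝ) ^ m) ∩ Set.Icc (r' - (2 : ℝ) ^ (m + 2)) r') ⊆
      ⋃ i, Metric.closedBall y' ((2 : ℝ) ^ (m + 1)) ×ˢ J i := by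
    rintro ⟨y, r⟩ ⟨hy, hr1, hr2, hr3⟩
    simp only [Set.mem_Ici] at hr1 hr2 hr3
    set n := ⌊r / (2 : ℝ) ^ m⌋₊ with hn
    have hn1 : 1 ≤ n := Nat.le_floor (by rw [Nat.cast_one, le_div_iff₀ h2]; linarith)
    have hnN : n ≤ N := Nat.floor_mono (div_le_div_of_nonneg_right hr3 h2.le)
    have hn4 : N ≤ n + 4 := by
      have e1 : (N : ℝ) ≤ r' / 2 ^ m := Nat.floor_le (by
        have : 0 < r := h2.trans_le hr1
        have : 0 < r' := this.trans_le hr3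
        positivity)
      have e2 : r / 2 ^ m < n + 1 := Nat.lt_floor_add_one _
      have e3 : r' / 2 ^ m ≤ r / 2 ^ m + 4 := by
        rw [div_add' _ _ _ h2.ne']
        refine div_le_div_of_nonneg_right ?_ h2.le
        rw [pow_add] at hr2
        linarith
      have : (N : ℝ) < (n + 5 : ℕ) := by push_cast; linarith
      have := Nat.cast_lt.1 this
      omega
    refine Set.mem_iUnion.2 ⟨⟨N - n, by omega⟩, hy, ?_⟩
    have hNn : N - (N - n) = n := by omega
    simp only [J, hNn, if_pos hn1]
    refine ⟨?_, ?_⟩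
    · rw [← le_div_iff₀ h2]; exact Nat.floor_le (by
        have : 0 < r := h2.trans_le hr1
        positivity)
    · rw [← div_lt_iff₀ h2]; exact Nat.lt_floor_add_one _
  have hone : ∀ i, ∫⁻ q in Metric.closedBall y' ((2 : ℝ) ^ (m + 1)) ×ˢ J i, ‖h q.1 q.2‖ₑ ≤
      U * ENNReal.ofReal ((2 + d) ^ d * V) := by
    intro i
    by_cases hi : 1 ≤ N - i.1
    · simp only [J, if_pos hi]
      refine (hu.slab_le hh m _ hi (T := Metric.closedBall y' ((2 + d) * 2 ^ m)) ?_).trans ?_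
      · intro x hx y hy
        rw [mem_closedBall_iff_norm] at hx ⊢
        have := norm_add_le (y - x) (x - y')
        rw [sub_add_sub_cancel] at this
        rw [pow_succ] at hx
        nlinarith
      · rw [Measure.addHaar_closedBall _ _ (by positivity), finrank_euclideanSpace_fin, mul_assoc]
        refine mul_le_mul_right (le_of_eq ?_) _
        rw [← ENNReal.ofReal_pow h2.le, ← ENNReal.ofReal_inv_of_pos (by positivity), hV,
          ENNReal.ofReal_mul (by positivity), Measure.real,
          ENNReal.ofReal_toReal measure_ball_lt_top.ne, ← mul_assoc,
          ← ENNReal.ofReal_mul (by positivity)]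
        congr 2
        rw [mul_pow]
        field_simp
    · simp only [J, if_neg hi]
      simp
  calc _ ≤ ∫⁻ q in ⋃ i, Metric.closedBall y' ((2 : ℝ) ^ (m + 1)) ×ˢ J i, ‖h q.1 q.2‖ₑ :=
        lintegral_mono_set hcov
    _ ≤ ∑' i, ∫⁻ q in Metric.closedBall y' ((2 : ℝ) ^ (m + 1)) ×ˢ J i, ‖h q.1 q.2‖ₑ :=
        lintegral_iUnion_le _ _
    _ ≤ ∑' _i : Fin 5, U * ENNReal.ofReal ((2 + d) ^ d * V) := ENNReal.tsum_le_tsum hone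
    _ = _ := by
        rw [tsum_fintype, Finset.sum_const, Finset.card_univ, Fintype.card_fin, nsmul_eq_mul, hU,
          mul_comm (ENNReal.ofReal (u * _)), ← ENNReal.ofReal_mul (by positivity), 
          ← ENNReal.ofReal_natCast, ← ENNReal.ofReal_mul (by positivity)]
        congr 1
        push_cast; ring

/-- Mass of a density near a sphere of radius `r'`, at heights comparable to `2 ^ k`. -/
lemma HasDensity.shell_le (hd : 1 ≤ d) (hh : IsTest h) {δ u : ℝ} (hu0 : 0 ≤ u)
    (hu : HasDensity h δ u) (k : ℕ) (y' : Euc d) {r' : ℝ} (hr' : (2 : ℝ) ^ k ≤ r') :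
    ∫⁻ q in {y : Euc d | |‖y - y'‖ - r'| ≤ (2 : ℝ) ^ (k + 2)} ×ˢ
        Set.Ico ((2 : ℝ) ^ k) ((2 : ℝ) ^ (k + 1)), ‖h q.1 q.2‖ₑ ≤
      ENNReal.ofReal ((sphereMeasure d).real Set.univ * (2 * (4 + d) * (5 + d) ^ (d - 1)) *
        (u * (2 : ℝ) ^ (k * (1 + δ)) * ((2 : ℝ) ^ k) ^ (1 - (d : ℝ)) * r' ^ (d - 1))) := by
  have h2 : (0 : ℝ) < 2 ^ k := by positivity
  have hr0 : 0 < r' := h2.trans_le hr'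
  -- At scale `k` the radii in [2^k, 2^{k+1}) form the slab of index 1.
  have h1 := hu.slab_le hh k 1 le_rfl
    (S := {y : Euc d | |‖y - y'‖ - r'| ≤ (2 : ℝ) ^ (k + 2)})
    (T := {y : Euc d | |‖y - y'‖ - r'| ≤ (4 + d) * (2 : ℝ) ^ k}) (by
      intro x hx y hy
      simp only [Set.mem_ofPred_eq] at hx ⊢
      have e1 := abs_norm_sub_norm_le (y - y') (x - y')
      rw [sub_sub_sub_cancel_right] at e1
      have e2 := abs_sub_le ‖y - y'‖ ‖x - y'‖ r'
      rw [pow_add] at hx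
      linarith)
  have hJ : Set.Ico (((1 : ℕ) : ℝ) * (2 : ℝ) ^ k) ((((1 : ℕ) : ℝ) + 1) * (2 : ℝ) ^ k) =
      Set.Ico ((2 : ℝ) ^ k) ((2 : ℝ) ^ (k + 1)) := by
    rw [pow_succ]; congr 1 <;> push_cast <;> ring
  rw [hJ] at h1
  refine h1.trans ((mul_le_mul_right (volume_shell_le hd y' hr0.le (by positivity)) _).trans ?_)
  rw [← ENNReal.ofReal_pow h2.le, ← ENNReal.ofReal_inv_of_pos (by positivity),
    ← ENNReal.ofReal_toReal (measure_ne_top (sphereMeasure d) Set.univ),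
    ← ENNReal.ofReal_mul (by positivity), ← ENNReal.ofReal_mul (by positivity),
    ← ENNReal.ofReal_mul (by positivity)]
  refine ENNReal.ofReal_le_ofReal ?_
  have e3 : (r' + (4 + d) * (2 : ℝ) ^ k) ^ (d - 1) ≤ ((5 + d) * r') ^ (d - 1) := by
    refine pow_le_pow_left₀ (by positivity) ?_ _
    have : (0 : ℝ) ≤ 4 + d := by positivity
    nlinarith
  have e4 : ((2 : ℝ) ^ k) ^ (1 - (d : ℝ)) = 2 ^ k * ((2 ^ k) ^ d)⁻¹ := by
    rw [Real.rpow_sub h2, Real.rpow_one, Real.rpow_natCast, div_eq_mul_inv]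
  rw [e4]
  change _ * _ * ((sphereMeasure d).real Set.univ * _) ≤ _
  calc u * (2 : ℝ) ^ (k * (1 + δ)) * ((2 ^ k) ^ d)⁻¹ * ((sphereMeasure d).real Set.univ *
        (2 * ((4 + d) * 2 ^ k) * (r' + (4 + d) * 2 ^ k) ^ (d - 1)))
      ≤ u * (2 : ℝ) ^ (k * (1 + δ)) * ((2 ^ k) ^ d)⁻¹ * ((sphereMeasure d).real Set.univ *
        (2 * ((4 + d) * 2 ^ k) * ((5 + d) * r') ^ (d - 1))) := by gcongr
    _ = _ := by rw [mul_pow]; ring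

/-- The supports of two kernels meet only near the sphere of radius `r'`. -/
lemma IsSphericalKernel.inner_ne_zero (hF : IsSphericalKernel F C) {r r' : ℝ} (hr : 0 ≤ r)
    (hr' : 0 ≤ r') {y y' : Euc d}
    (hne : ∫ x, F r (x - y) * (starRingEnd ℂ) (F r' (x - y')) ≠ 0) :
    |‖y - y'‖ - r'| ≤ r + 2 / 5 := by
  have : ∃ x, F r (x - y) * (starRingEnd ℂ) (F r' (x - y')) ≠ 0 := by
    by_contra! hall
    exact hne (by simp [hall])
  obtain ⟨x, hx⟩ := this
  have h1 := hF.supp r _ hr (left_ne_zero_of_mul hx)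
  have h2 := hF.supp r' (x - y') hr' (fun h0 => hx (by simp [h0]))
  have h3 := abs_norm_sub_norm_le (y - y') (x - y')
  rw [sub_sub_sub_cancel_right, norm_sub_rev y x] at h3
  rw [abs_le] at *
  constructor <;> linarith [h1.1, h1.2, h2.1, h2.2, h3.1, h3.2]

/-- The two regimes for the interaction of the radii `r < r'` at distance `v`. -/
lemma interaction_weight_cases {β L r r' v : ℝ} (hβ : 0 ≤ β) (hL : 1 ≤ L) (hr : L ≤ r)
    (hrr : 4 * L < r' - r) (hv : |v - r'| ≤ r + 2 / 5) :
    (∃ m : ℕ, L ≤ (2 : ℝ) ^ m ∧ v ≤ (2 : ℝ) ^ (m + 1) ∧ (2 : ℝ) ^ m ≤ r ∧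
      r' - (2 : ℝ) ^ (m + 2) ≤ r ∧ r ^ (2 * β) * (r * r' * v) ^ (-β) ≤ (2 : ℝ) ^ (-(m * β))) ∨
    (∃ k : ℕ, L / 2 ≤ (2 : ℝ) ^ k ∧ (2 : ℝ) ^ k ≤ r' ∧ (2 : ℝ) ^ k ≤ r ∧ r < (2 : ℝ) ^ (k + 1) ∧
      |v - r'| ≤ (2 : ℝ) ^ (k + 2) ∧
      r ^ (2 * β) * (r * r' * v) ^ (-β) ≤ (6 : ℝ) ^ β * (2 : ℝ) ^ (k * β) * r' ^ (-(2 * β))) := by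
  have hv' := abs_le.1 hv
  have hr0 : 0 < r := by linarith
  have hr0' : 0 < r' := by linarith
  have hv3 : 3 * L ≤ v := by linarith
  have hv0 : 0 < v := by linarith
  obtain ⟨m, hm1, hm2⟩ := exists_nat_pow_near (x := v) (y := (2 : ℝ)) (by linarith) one_lt_two
  -- The exponent 2β = d-1 is that of the polar weight, so this is the weighted size of the inner
  -- product of the kernels.
  have hw : r ^ (2 * β) * (r * r' * v) ^ (-β) = (r / r') ^ β * v ^ (-β) := by
    rw [Real.mul_rpow (by positivity) hv0.le, Real.mul_rpow hr0.le hr0'.le,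
      Real.div_rpow hr0.le hr0'.le, Real.rpow_neg hr0.le, Real.rpow_neg hr0'.le, two_mul,
      Real.rpow_add hr0]
    have : r ^ β ≠ 0 := by positivity
    field_simp
  have hrle : (r / r') ^ β ≤ 1 :=
    Real.rpow_le_one (by positivity) ((div_le_one hr0').2 (by linarith)) hβ
  -- The distance `v` lies in [2^m, 2^{m+1}). If 2^m ≤ r, the pair (y, r) lies in a box of side
  -- about 2^m around (y', r'). Otherwise r < v, and y lies in a shell of thickness about r around
  -- the sphere of radius r' about y'.
  rcases le_or_gt ((2 : ℝ) ^ m) r with hmr | hmr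
  · left
    have h1m : (1 : ℝ) ≤ 2 ^ m := one_le_pow₀ one_le_two
    refine ⟨m, ?_, hm2.le, hmr, ?_, ?_⟩
    · rw [pow_succ] at hm2; linarith
    · rw [pow_succ] at hm2; rw [pow_add]; linarith
    · rw [hw]
      calc (r / r') ^ β * v ^ (-β) ≤ 1 * v ^ (-β) := by gcongr
        _ ≤ 1 * ((2 : ℝ) ^ m) ^ (-β) := by
            gcongr 1 * ?_
            exact Real.rpow_le_rpow_of_nonpos (by positivity) hm1 (by linarith)
        _ = _ := by
            rw [one_mul, ← Real.rpow_natCast, ← Real.rpow_mul zero_le_two, mul_neg]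
  · right
    obtain ⟨k, hk1, hk2⟩ := exists_nat_pow_near (x := r) (y := (2 : ℝ)) (by linarith) one_lt_two
    refine ⟨k, ?_, by linarith, hk1, hk2, ?_, ?_⟩
    · rw [pow_succ] at hk2; linarith
    · have : (1 : ℝ) ≤ 2 ^ k := one_le_pow₀ one_le_two
      rw [pow_succ] at hk2
      rw [pow_add]; linarith
    -- Here v > r and v ≥ r' - r - 2/5, so v is comparable to r'. The constant 6^β is 3^β from this
    -- bound times 2^β from r < 2^{k+1}.
    · have hv6 : r' / 3 ≤ v := by linarith
      rw [hw, Real.div_rpow hr0.le hr0'.le]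
      have e1 : r ^ β ≤ ((2 : ℝ) ^ (k + 1)) ^ β := Real.rpow_le_rpow hr0.le hk2.le hβ
      have e2 : v ^ (-β) ≤ (r' / 3) ^ (-β) :=
        Real.rpow_le_rpow_of_nonpos (by positivity) hv6 (by linarith)
      calc r ^ β / r' ^ β * v ^ (-β) ≤ ((2 : ℝ) ^ (k + 1)) ^ β / r' ^ β * (r' / 3) ^ (-β) := by
            gcongr
        _ = _ := by
            rw [Real.rpow_neg (by positivity), Real.div_rpow hr0'.le (by norm_num), pow_succ,
              Real.mul_rpow (by positivity) (by norm_num), ← Real.rpow_natCast,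
              ← Real.rpow_mul zero_le_two, Real.rpow_neg hr0'.le, two_mul, Real.rpow_add hr0',
              show (6 : ℝ) = 2 * 3 by norm_num, Real.mul_rpow (by norm_num) (by norm_num)]
            have : r' ^ β ≠ 0 := by positivity
            field_simp

end

section

variable {d : ℕ} {F : ℝ → Euc d → ℂ} {C : ℝ} {h : Euc d → ℝ → ℂ}

/-- The two regimes of `interaction_weight_cases`, written as a pointwise majorant: if the inner
product is not zero, (y, r) belongs to at least one of the boxes or shells, with the coefficient
attached to it. Integrated against |h|, each indicator becomes a mass controlled by the density
condition. -/
lemma IsSphericalKernel.weighted_inner_le (hd : 1 ≤ d) (hF : IsSphericalKernel F C) {L r r' : ℝ}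
    (hL : 1 ≤ L) (hr : L ≤ r) (hrr : 4 * L < r' - r) (y y' : Euc d) :
    ENNReal.ofReal (r ^ (d - 1)) * ‖∫ x, F r (x - y) * (starRingEnd ℂ) (F r' (x - y'))‖ₑ ≤
      (∑' m : ℕ, (if L ≤ (2 : ℝ) ^ m then
        ENNReal.ofReal (C * (2 : ℝ) ^ (-(m * (((d : ℝ) - 1) / 2)))) else 0) *
        (Metric.closedBall y' ((2 : ℝ) ^ (m + 1)) ×ˢ
          (Set.Ici ((2 : ℝ) ^ m) ∩ Set.Icc (r' - (2 : ℝ) ^ (m + 2)) r')).indicator 1 (y, r)) +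
      ∑' k : ℕ, (if L / 2 ≤ (2 : ℝ) ^ k ∧ (2 : ℝ) ^ k ≤ r' then
        ENNReal.ofReal (C * ((6 : ℝ) ^ (((d : ℝ) - 1) / 2) * (2 : ℝ) ^ (k * (((d : ℝ) - 1) / 2)) *
          r' ^ (-(2 * (((d : ℝ) - 1) / 2))))) else 0) *
        ({y : Euc d | |‖y - y'‖ - r'| ≤ (2 : ℝ) ^ (k + 2)} ×ˢ
        Set.Ico ((2 : ℝ) ^ k) ((2 : ℝ) ^ (k + 1))).indicator 1 (y, r) := by
  have hr0 : 0 < r := by linarith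
  have hr0' : 0 < r' := by linarith
  have hC := hF.pos
  set β : ℝ := ((d : ℝ) - 1) / 2 with hβ
  have hβ0 : 0 ≤ β := by
    have : (1 : ℝ) ≤ d := by exact_mod_cast hd
    rw [hβ]; linarith
  by_cases hne : ∫ x, F r (x - y) * (starRingEnd ℂ) (F r' (x - y')) = 0
  · simp [hne]
  have hv := hF.inner_ne_zero hr0.le hr0'.le hne
  have hyy : y ≠ y' := by
    rintro rfl
    rw [sub_self, norm_zero, zero_sub, abs_neg, abs_of_pos hr0'] at hv
    linarith
  have hle := hF.inner_le r r' hr0 hr0' y y' hyy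
  have hpow : r ^ (d - 1) = r ^ (2 * β) := by
    rw [← Real.rpow_natCast, Nat.cast_sub hd, hβ]
    congr 1; push_cast; ring
  have hbound : ENNReal.ofReal (r ^ (d - 1)) *
      ‖∫ x, F r (x - y) * (starRingEnd ℂ) (F r' (x - y'))‖ₑ ≤
      ENNReal.ofReal (C * (r ^ (2 * β) * (r * r' * ‖y - y'‖) ^ (-β))) := by
    rw [hpow, ← ofReal_norm, ← ENNReal.ofReal_mul (by positivity)]
    refine ENNReal.ofReal_le_ofReal ?_
    calc _ ≤ r ^ (2 * β) * (C * (r * r' * ‖y - y'‖) ^ (-β)) := by gcongr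
      _ = _ := by ring
  refine hbound.trans ?_
  rcases interaction_weight_cases hβ0 hL hr hrr hv with ⟨m, h1, h2, h3, h4, h5⟩ |
    ⟨k, h1, h2, h3, h4, h5, h6⟩
  · refine le_trans ?_ (le_add_of_nonneg_right (zero_le))
    refine le_trans ?_ (ENNReal.le_tsum m)
    rw [if_pos h1, Set.indicator_of_mem, Pi.one_apply, mul_one]
    · exact ENNReal.ofReal_le_ofReal (by gcongr)
    · refine ⟨?_, h3, h4, by simp only []; linarith⟩
      rw [mem_closedBall_iff_norm]; exact h2
  · refine le_trans ?_ (le_add_of_nonneg_left (zero_le))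
    refine le_trans ?_ (ENNReal.le_tsum k)
    rw [if_pos ⟨h1, h2⟩, Set.indicator_of_mem, Pi.one_apply, mul_one]
    · exact ENNReal.ofReal_le_ofReal (by gcongr)
    · exact ⟨h5, h3, h4⟩

lemma measurableSet_shell (y : Euc d) (r t : ℝ) :
    MeasurableSet {x : Euc d | |‖x - y‖ - r| ≤ t} :=
  measurableSet_le (by fun_prop) measurable_const

/-- Total interaction of a density with one distant larger sphere. -/
lemma IsSphericalKernel.exists_interaction_le (hd : 4 ≤ d) (hF : IsSphericalKernel F C) {δ : ℝ}
    (hδ : 0 < ((d : ℝ) - 1) / 2 - 1 - δ) :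
    ∃ C' : ℝ, 0 < C' ∧ ∀ (h : Euc d → ℝ → ℂ) (u L : ℝ), IsTest h → 0 ≤ u → 1 ≤ L →
      HasDensity h δ u → (∀ y r, h y r ≠ 0 → L ≤ r) → ∀ (y' : Euc d) (r' : ℝ),
      ∫⁻ r in {r | 4 * L < r' - r}, ENNReal.ofReal (r ^ (d - 1)) *
        ∫⁻ y, ‖h y r‖ₑ * ‖∫ x, F r (x - y) * (starRingEnd ℂ) (F r' (x - y'))‖ₑ ≤
      ENNReal.ofReal (C' * (u * L ^ (-(((d : ℝ) - 1) / 2 - 1 - δ)))) := by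
  have hC := hF.pos
  obtain ⟨G, hG, hgeo⟩ := exists_tsum_geometric_le hδ
  set β : ℝ := ((d : ℝ) - 1) / 2 with hβ
  set κ := β - 1 - δ with hκ
  have hβ0 : 0 ≤ β := by
    have : (4 : ℝ) ≤ d := by exact_mod_cast hd
    rw [hβ]; linarith
  set c1 : ℝ := 5 * (2 + d) ^ d * (volume : Measure (Euc d)).real (Metric.ball 0 1) with hc1
  set c2 : ℝ := (sphereMeasure d).real Set.univ * (2 * (4 + d) * (5 + d) ^ (d - 1)) with hc2
  have hc1' : 0 ≤ c1 := by positivity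
  have hc2' : 0 ≤ c2 := by positivity
  refine ⟨C * c1 * G + C * (6 : ℝ) ^ β * c2 * G * (2 : ℝ) ^ κ + 1, by positivity, ?_⟩
  intro h u L hh hu0 hL hu hsupp y' r'
  have hL0 : 0 < L := by linarith
  set a : ℕ → ℝ≥0∞ := fun m => if L ≤ (2 : ℝ) ^ m then
        ENNReal.ofReal (C * (2 : ℝ) ^ (-(m * β))) else 0 with ha
  set b : ℕ → ℝ≥0∞ := fun k => if L / 2 ≤ (2 : ℝ) ^ k ∧ (2 : ℝ) ^ k ≤ r' then
        ENNReal.ofReal (C * ((6 : ℝ) ^ β * (2 : ℝ) ^ (k * β) * r' ^ (-(2 * β)))) else 0 with hb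
  set A : ℕ → Set (Euc d × ℝ) := fun m => Metric.closedBall y' ((2 : ℝ) ^ (m + 1)) ×ˢ
          (Set.Ici ((2 : ℝ) ^ m) ∩ Set.Icc (r' - (2 : ℝ) ^ (m + 2)) r') with hA
  set B : ℕ → Set (Euc d × ℝ) := fun k => {y : Euc d | |‖y - y'‖ - r'| ≤ (2 : ℝ) ^ (k + 2)} ×ˢ
        Set.Ico ((2 : ℝ) ^ k) ((2 : ℝ) ^ (k + 1)) with hB
  have hAm : ∀ m, MeasurableSet (A m) := fun m =>
    measurableSet_closedBall.prod (measurableSet_Ici.inter measurableSet_Icc)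
  have hBm : ∀ m, MeasurableSet (B m) := fun m =>
    (measurableSet_shell _ _ _).prod measurableSet_Ico
  set W : Euc d × ℝ → ℝ≥0∞ := fun q => (∑' m, a m * (A m).indicator 1 q) +
    ∑' k, b k * (B k).indicator 1 q with hW
  have hWa : ∀ m, Measurable fun q => a m * (A m).indicator (1 : Euc d × ℝ → ℝ≥0∞) q := fun m =>
    (measurable_one.indicator (hAm m)).const_mul _
  have hWb : ∀ m, Measurable fun q => b m * (B m).indicator (1 : Euc d × ℝ → ℝ≥0∞) q := fun m =>
    (measurable_one.indicator (hBm m)).const_mul _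
  have hWm : Measurable W := (Measurable.tsum hWa).add (Measurable.tsum hWb)
  have hhm := hh.measurable_enorm
  have hslice : ∫⁻ r in {r | 4 * L < r' - r}, ENNReal.ofReal (r ^ (d - 1)) *
        ∫⁻ y, ‖h y r‖ₑ * ‖∫ x, F r (x - y) * (starRingEnd ℂ) (F r' (x - y'))‖ₑ ≤
      ∫⁻ q : Euc d × ℝ, ‖h q.1 q.2‖ₑ * W q := by
    rw [Measure.volume_eq_prod, lintegral_prod_symm _ (by exact (hhm.mul hWm).aemeasurable)]
    refine le_trans (setLIntegral_mono' (measurableSet_lt (by fun_prop) (by fun_prop)) ?_)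
      (setLIntegral_le_lintegral _ _)
    intro r hr
    simp only [Set.mem_ofPred_eq] at hr
    rw [← lintegral_const_mul' _ _ (by finiteness)]
    refine lintegral_mono fun y => ?_
    by_cases h0 : h y r = 0
    · simp [h0]
    have := hF.weighted_inner_le (by omega) hL (hsupp y r h0) hr y y'
    calc _ = ‖h y r‖ₑ * (ENNReal.ofReal (r ^ (d - 1)) *
          ‖∫ x, F r (x - y) * (starRingEnd ℂ) (F r' (x - y'))‖ₑ) := by ring
      _ ≤ _ := by gcongr
  have hint : ∀ (c : ℝ≥0∞) (S : Set (Euc d × ℝ)), MeasurableSet S →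
      ∫⁻ q : Euc d × ℝ, ‖h q.1 q.2‖ₑ * (c * S.indicator 1 q) =
        c * ∫⁻ q in S, ‖h q.1 q.2‖ₑ := by
    intro c S hS
    rw [← lintegral_indicator hS, ← lintegral_const_mul _ (hhm.indicator hS)]
    refine lintegral_congr fun q => ?_
    by_cases hq : q ∈ S <;> simp [hq, mul_comm]
  have hswap : ∫⁻ q : Euc d × ℝ, ‖h q.1 q.2‖ₑ * W q =
      (∑' m, a m * ∫⁻ q in A m, ‖h q.1 q.2‖ₑ) + ∑' k, b k * ∫⁻ q in B k, ‖h q.1 q.2‖ₑ := by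
    simp only [hW, mul_add, ← ENNReal.tsum_mul_left]
    rw [lintegral_add_left (by exact Measurable.tsum fun m => hhm.mul (hWa m)),
      lintegral_tsum (by exact fun m => (hhm.mul (hWa m)).aemeasurable),
      lintegral_tsum (by exact fun m => (hhm.mul (hWb m)).aemeasurable)]
    congr 1
    · exact tsum_congr fun m => hint _ _ (hAm m)
    · exact tsum_congr fun m => hint _ _ (hBm m)
  -- Kernel decay times box mass: a convergent geometric series because κ = β - 1 - δ is positive.
  have hexp : ∀ m : ℕ, (2 : ℝ) ^ (-(m * β)) * (2 : ℝ) ^ (m * (1 + δ)) = (2 : ℝ) ^ (-(m * κ)) := by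
    intro m
    rw [← Real.rpow_add two_pos]; congr 1; rw [hκ]; ring
  have sA : ∑' m, a m * ∫⁻ q in A m, ‖h q.1 q.2‖ₑ ≤
      ENNReal.ofReal (C * c1 * u) * ENNReal.ofReal (G * L ^ (-κ)) := by
    refine le_trans ?_ (mul_le_mul_right (hgeo L hL0) _)
    rw [← ENNReal.tsum_mul_left]
    refine ENNReal.tsum_le_tsum fun m => ?_
    simp only [ha]
    split_ifs with hm
    · refine (mul_le_mul_right (hu.box_le hh m y' r') _).trans (le_of_eq ?_)
      rw [← ENNReal.ofReal_mul (by positivity), ← ENNReal.ofReal_mul (by positivity), ← hexp]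
      congr 1; rw [hc1]; ring
    · simp
  have sB : ∑' k, b k * ∫⁻ q in B k, ‖h q.1 q.2‖ₑ ≤
      ENNReal.ofReal (C * (6 : ℝ) ^ β * c2 * u) * ENNReal.ofReal (G * (L / 2) ^ (-κ)) := by
    refine le_trans ?_ (mul_le_mul_right (hgeo (L / 2) (by positivity)) _)
    rw [← ENNReal.tsum_mul_left]
    refine ENNReal.tsum_le_tsum fun k => ?_
    simp only [hb]
    by_cases hk : L / 2 ≤ (2 : ℝ) ^ k
    · by_cases hk' : (2 : ℝ) ^ k ≤ r'
      · have hr0' : 0 < r' := lt_of_lt_of_le (by positivity) hk'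
        rw [if_pos ⟨hk, hk'⟩, if_pos hk]
        refine (mul_le_mul_right (hu.shell_le (by omega) hh hu0 k y' hk') _).trans (le_of_eq ?_)
        rw [← ENNReal.ofReal_mul (by positivity), ← ENNReal.ofReal_mul (by positivity), ← hexp]
        congr 1
        -- The shell meets about (r'/2^k)^{d-1} cubes, and the power of r' is cancelled by the
        -- kernel because 2β = d-1. What is left is again 2^{-kκ}.
        have e1 : r' ^ (-(2 * β)) * r' ^ (d - 1) = 1 := by
          rw [← Real.rpow_natCast, ← Real.rpow_add hr0', Nat.cast_sub (by omega : 1 ≤ d), hβ]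
          convert Real.rpow_zero r' using 2
          push_cast; ring
        have e2 : (2 : ℝ) ^ (k * β) * ((2 : ℝ) ^ k) ^ (1 - (d : ℝ)) = (2 : ℝ) ^ (-(k * β)) := by
          rw [← Real.rpow_natCast, ← Real.rpow_mul zero_le_two, ← Real.rpow_add two_pos, hβ]
          congr 1; ring
        rw [← e2]
        calc _ = C * 6 ^ β * c2 * u * ((2 : ℝ) ^ (k * β) * ((2 : ℝ) ^ k) ^ (1 - (d : ℝ)) *
              2 ^ (k * (1 + δ))) * (r' ^ (-(2 * β)) * r' ^ (d - 1)) := by ring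
          _ = _ := by rw [e1, mul_one]
      · rw [if_neg (fun h => hk' h.2), zero_mul]; exact zero_le
    · rw [if_neg (fun h => hk h.1), zero_mul]; exact zero_le
  refine hslice.trans (hswap.le.trans ((add_le_add sA sB).trans ?_))
  rw [← ENNReal.ofReal_mul (by positivity), ← ENNReal.ofReal_mul (by positivity),
    ← ENNReal.ofReal_add (by positivity) (by positivity)]
  refine ENNReal.ofReal_le_ofReal ?_
  have e3 : (L / 2) ^ (-κ) = L ^ (-κ) * 2 ^ κ := by
    rw [Real.div_rpow hL0.le zero_le_two, Real.rpow_neg zero_le_two, div_inv_eq_mul]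
  rw [e3]
  have : 0 ≤ u * L ^ (-κ) := by positivity
  linarith

end

/-! ### The L² estimate under the density condition. -/

section

variable {d : ℕ} {F : ℝ → Euc d → ℂ} {C : ℝ} {h : Euc d → ℝ → ℂ}

lemma IsSphericalKernel.measurable_inner (hF : IsSphericalKernel F C) :
    Measurable fun q : (ℝ × Euc d) × (ℝ × Euc d) =>
      ∫ x, F q.1.1 (x - q.1.2) * (starRingEnd ℂ) (F q.2.1 (x - q.2.2)) := by
  have h1 : Continuous fun q : ((ℝ × Euc d) × (ℝ × Euc d)) × Euc d =>
      F q.1.1.1 (q.2 - q.1.1.2) * (starRingEnd ℂ) (F q.1.2.1 (q.2 - q.1.2.2)) :=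
    (hF.cont.comp (by fun_prop :
      Continuous fun q : ((ℝ × Euc d) × (ℝ × Euc d)) × Euc d => (q.1.1.1, q.2 - q.1.1.2))).mul
    (Complex.continuous_conj.comp (hF.cont.comp (by fun_prop :
      Continuous fun q : ((ℝ × Euc d) × (ℝ × Euc d)) × Euc d => (q.1.2.1, q.2 - q.1.2.2))))
  exact h1.measurable.stronglyMeasurable.integral_prod_right'.measurable

/-- Interaction of the slice of radius `r` with the sphere of centre `y'` and radius `r'`. -/
noncomputable def sliceInteraction (F : ℝ → Euc d → ℂ) (h : Euc d → ℝ → ℂ) (r : ℝ) (y' : Euc d)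
    (r' : ℝ) : ℝ≥0∞ :=
  ENNReal.ofReal (r ^ (d - 1)) * ∫⁻ y, ‖h y r‖ₑ *
        ‖∫ x, F r (x - y) * (starRingEnd ℂ) (F r' (x - y'))‖ₑ

lemma IsSphericalKernel.measurable_sliceInteraction (hF : IsSphericalKernel F C) (hh : IsTest h) :
    Measurable fun q : ℝ × (Euc d × ℝ) => sliceInteraction F h q.1 q.2.1 q.2.2 := by
  refine Measurable.mul (by fun_prop) ?_
  have h1 : Measurable fun q : (ℝ × (Euc d × ℝ)) × Euc d => ‖h q.2 q.1.1‖ₑ *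
      ‖∫ x, F q.1.1 (x - q.2) * (starRingEnd ℂ) (F q.1.2.2 (x - q.1.2.1))‖ₑ :=
    (hh.measurable_enorm.comp (by fun_prop :
      Measurable fun q : (ℝ × (Euc d × ℝ)) × Euc d => (q.2, q.1.1))).mul
    (hF.measurable_inner.comp (by fun_prop :
      Measurable fun q : (ℝ × (Euc d × ℝ)) × Euc d => ((q.1.1, q.2), (q.1.2.2, q.1.2.1)))).enorm
  exact h1.lintegral_prod_right'

lemma IsTest.measurable_sliceMass (hh : IsTest h) :
    Measurable fun r : ℝ => ENNReal.ofReal (r ^ (d - 1)) * ∫⁻ y, ‖h y r‖ₑ :=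
  Measurable.mul (by fun_prop) hh.measurable_enorm.lintegral_prod_left'

lemma lintegral_near_eq {f : ℝ → ℝ≥0∞} {t : ℝ} :
    ∫⁻ r, ∫⁻ r', {q : ℝ × ℝ | |q.1 - q.2| ≤ t}.indicator (fun q => f q.1) (r, r') =
      ENNReal.ofReal (2 * t) * ∫⁻ r, f r := by
  have h1 : ∀ r, ∫⁻ r', {q : ℝ × ℝ | |q.1 - q.2| ≤ t}.indicator (fun q => f q.1) (r, r') =
      ENNReal.ofReal (2 * t) * f r := by
    intro r
    have h2 : ∀ r', {q : ℝ × ℝ | |q.1 - q.2| ≤ t}.indicator (fun q => f q.1) (r, r') =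
        (Metric.closedBall r t).indicator (fun _ => f r) r' := by
      intro r'
      simp only [Set.indicator, Set.mem_ofPred_eq, Metric.mem_closedBall, Real.dist_eq,
        abs_sub_comm r' r]
    simp only [h2]
    rw [lintegral_indicator measurableSet_closedBall, setLIntegral_const, Real.volume_closedBall,
      mul_comm]
  simp only [h1]
  rw [lintegral_const_mul' _ _ ENNReal.ofReal_ne_top]

/-- The square norm in terms of near and far interactions. -/
lemma IsSphericalKernel.lintegral_sphOp_sq_le_of_interaction (hd : 1 ≤ d)
    (hF : IsSphericalKernel F C) (hh : IsTest h) (h1 : ∀ y r, ‖h y r‖ ≤ 1) {L : ℝ} (hL : 0 ≤ L)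
    {A : ℝ≥0∞} (hA : ∀ y' r', h y' r' ≠ 0 →
      ∫⁻ r in {r | 4 * L < r' - r}, sliceInteraction F h r y' r' ≤ A) :
    ∫⁻ x, ‖sphOp F h x‖ₑ ^ 2 ≤
      (ENNReal.ofReal (16 * C * L) + 2 * A) * wmass fun y r => ‖h y r‖ₑ := by
  have hC := hF.pos
  set P : ℝ → ℝ → ℝ≥0∞ := fun r r' => ‖∫ x, (((r ^ (d - 1) : ℝ) : ℂ) * sphConv F h r x) *
      (starRingEnd ℂ) (((r' ^ (d - 1) : ℝ) : ℂ) * sphConv F h r' x)‖ₑ with hP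
  set n : ℝ → ℝ≥0∞ := fun r => ENNReal.ofReal C * (ENNReal.ofReal (r ^ (d - 1)) * ∫⁻ y, ‖h y r‖ₑ)
    with hn
  set I : ℝ × ℝ → ℝ≥0∞ := fun q => ∫⁻ y', ENNReal.ofReal (q.2 ^ (d - 1)) * ‖h y' q.2‖ₑ *
    sliceInteraction F h q.1 y' q.2 with hI
  have hnm : Measurable n := hh.measurable_sliceMass.const_mul _
  have hSI := hF.measurable_sliceInteraction hh
  have hIm : Measurable I := by
    have : Measurable fun q : (ℝ × ℝ) × Euc d => ENNReal.ofReal (q.1.2 ^ (d - 1)) *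
        ‖h q.2 q.1.2‖ₑ * sliceInteraction F h q.1.1 q.2 q.1.2 :=
      (Measurable.mul (by fun_prop) (hh.measurable_enorm.comp
        (by fun_prop : Measurable fun q : (ℝ × ℝ) × Euc d => (q.2, q.1.2)))).mul
      (hSI.comp (by fun_prop : Measurable fun q : (ℝ × ℝ) × Euc d => (q.1.1, (q.2, q.1.2))))
    exact this.lintegral_prod_right'
  set near : Set (ℝ × ℝ) := {q | |q.1 - q.2| ≤ 4 * L} with hnear
  set far : Set (ℝ × ℝ) := {q | 4 * L < q.2 - q.1} with hfar
  have hnearm : MeasurableSet near := measurableSet_le (by fun_prop) (by fun_prop)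
  have hfarm : MeasurableSet far := measurableSet_lt (by fun_prop) (by fun_prop)
  -- `far` contains only pairs whose second radius is the larger one; the other order is recovered
  -- by adding the transpose, at the cost of a factor 2.
  set G : ℝ × ℝ → ℝ≥0∞ := fun q => near.indicator (fun q => n q.1) q + far.indicator I q with hG
  have hnm' : Measurable (near.indicator fun q => n q.1) :=
    (hnm.comp measurable_fst).indicator hnearm
  have hGm : Measurable G := hnm'.add (hIm.indicator hfarm)
  have hPsymm : ∀ r r', P r r' = P r' r := by
    intro r r'
    simp only [hP]
    rw [← ofReal_norm, ← RCLike.norm_conj, ofReal_norm, ← integral_conj]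
    simp [mul_comm]
  -- The bound |h| ≤ 1 puts the near part in terms of the same L¹ mass as the far part.
  have hsq : ∀ r, ∫⁻ y, ‖h y r‖ₑ ^ 2 ≤ ∫⁻ y, ‖h y r‖ₑ := by
    intro r
    refine lintegral_mono fun y => ?_
    rw [sq]
    refine mul_le_of_le_one_left zero_le ?_
    rw [← ofReal_norm]
    exact ENNReal.ofReal_le_one.2 (h1 y r)
  have hPG : ∀ r r', P r r' ≤ G (r, r') + G (r', r) := by
    intro r r'
    rcases le_or_gt |r - r'| (4 * L) with hn1 | hf
    · refine (hF.enorm_inner_slices_le_near hd hh r r').trans ?_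
      refine add_le_add (le_trans ?_ le_self_add) (le_trans ?_ le_self_add)
      · rw [Set.indicator_of_mem (by exact hn1)]
        simp only [hn]; gcongr 1; gcongr 1; exact hsq r
      · rw [Set.indicator_of_mem (by rw [abs_sub_comm] at hn1; exact hn1)]
        simp only [hn]; gcongr 1; gcongr 1; exact hsq r'
    · rcases lt_abs.1 hf with hf | hf
      · refine le_trans ?_ le_add_self
        refine le_trans ?_ le_add_self
        rw [Set.indicator_of_mem (by exact hf), hPsymm]
        exact hF.enorm_inner_slices_le_far hh r' r
      · refine le_trans ?_ le_self_add
        refine le_trans ?_ le_add_self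
        rw [Set.indicator_of_mem (by simp only [hfar, Set.mem_ofPred_eq]; linarith)]
        exact hF.enorm_inner_slices_le_far hh r r'
  have hGint : ∫⁻ r, ∫⁻ r', G (r, r') ≤
      (ENNReal.ofReal (8 * C * L) + A) * wmass fun y r => ‖h y r‖ₑ := by
    have e1 : ∫⁻ r, ∫⁻ r', G (r, r') =
        (∫⁻ r, ∫⁻ r', near.indicator (fun q => n q.1) (r, r')) +
          ∫⁻ r, ∫⁻ r', far.indicator I (r, r') := by
      simp only [hG]
      rw [← lintegral_add_left (by exact hnm'.lintegral_prod_right')]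
      refine lintegral_congr fun r => ?_
      exact lintegral_add_left (hnm'.comp measurable_prodMk_left) _
    rw [e1, add_mul]
    refine add_le_add (le_of_eq ?_) ?_
    · rw [lintegral_near_eq]
      simp only [hn]
      rw [lintegral_const_mul' _ _ ENNReal.ofReal_ne_top, ← mul_assoc,
        ← ENNReal.ofReal_mul (by positivity), wmass]
      congr 2; ring
    · rw [lintegral_lintegral_swap (by exact (hIm.indicator hfarm).aemeasurable), wmass,
        ← lintegral_const_mul _ hh.measurable_sliceMass]
      refine lintegral_mono fun r' => ?_
      have e2 : ∫⁻ r, far.indicator I (r, r') = ∫⁻ r in {r | 4 * L < r' - r}, I (r, r') := by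
        rw [← lintegral_indicator (measurableSet_lt (by fun_prop) (by fun_prop))]
        rfl
      rw [e2, ← lintegral_const_mul' _ _ ENNReal.ofReal_ne_top, ← lintegral_const_mul _
        ((hh.measurable_slice r').enorm.const_mul _)]
      simp only [hI]
      rw [lintegral_lintegral_swap]
      · refine lintegral_mono fun y' => ?_
        rw [lintegral_const_mul' _ _ (by finiteness)]
        by_cases h0 : h y' r' = 0
        · simp [h0]
        · rw [mul_comm A]
          exact mul_le_mul_right (hA y' r' h0) _
      · refine Measurable.aemeasurable ?_
        refine Measurable.mul (Measurable.const_mul ?_ _) ?_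
        · exact (hh.measurable_slice r').enorm.comp measurable_snd
        · exact hSI.comp (by fun_prop : Measurable fun q : ℝ × Euc d => (q.1, (q.2, r')))
  calc ∫⁻ x, ‖sphOp F h x‖ₑ ^ 2 ≤ ∫⁻ r, ∫⁻ r', P r r' := hF.lintegral_sphOp_sq_le hh
    _ ≤ ∫⁻ r, ∫⁻ r', (G (r, r') + G (r', r)) :=
        lintegral_mono fun r => lintegral_mono fun r' => hPG r r'
    _ = (∫⁻ r, ∫⁻ r', G (r, r')) + ∫⁻ r, ∫⁻ r', G (r', r) := by
        rw [← lintegral_add_left (by exact hGm.lintegral_prod_right')]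
        refine lintegral_congr fun r => ?_
        exact lintegral_add_left (hGm.comp measurable_prodMk_left) _
    _ = (∫⁻ r, ∫⁻ r', G (r, r')) + ∫⁻ r, ∫⁻ r', G (r, r') := by
        congr 1
        exact (lintegral_lintegral_swap (f := fun r r' => G (r', r))
          (hGm.comp measurable_swap).aemeasurable)
    _ ≤ _ := by
        rw [← two_mul]
        refine (mul_le_mul_right hGint 2).trans (le_of_eq ?_)
        rw [← mul_assoc, mul_add]
        congr 2
        rw [show (16 * C * L) = 2 * (8 * C * L) by ring, ENNReal.ofReal_mul zero_le_two]
        simp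

lemma IsTest.indicator {S : Set (Euc d × ℝ)} (hh : IsTest h) (hS : MeasurableSet S) :
    IsTest fun y r => S.indicator (fun q => h q.1 q.2) (y, r) where
  meas := hh.meas.indicator hS
  bdd := hh.bdd.imp fun B hB y r => (norm_indicator_le_norm_self _ _).trans (hB y r)
  supp := hh.supp.imp fun R hR y r hne => hR y r fun h0 => hne (by simp [Set.indicator, h0])

lemma HasDensity.mono {h' : Euc d → ℝ → ℂ} {δ u u' : ℝ} (hu : HasDensity h δ u)
    (hle : ∀ y r, ‖h' y r‖ ≤ ‖h y r‖) (huu : u ≤ u') : HasDensity h' δ u' := by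
  intro m n z hn
  refine (lintegral_mono fun q => ?_).trans ((hu m n z hn).trans
    (ENNReal.ofReal_le_ofReal (by gcongr)))
  exact enorm_le_iff_norm_le.2 (hle _ _)

lemma IsSphericalKernel.sphOp_add (hF : IsSphericalKernel F C) {h' : Euc d → ℝ → ℂ}
    (hh : IsTest h) (hh' : IsTest h') (x : Euc d) :
    sphOp F (fun y r => h y r + h' y r) x = sphOp F h x + sphOp F h' x := by
  unfold sphOp
  rw [← integral_add (hF.integrable_weighted_sphConv hh x) (hF.integrable_weighted_sphConv hh' x)]
  congr 1 with r
  unfold sphConv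
  rw [← mul_add, ← integral_add (hF.integrable_integrand hh r x) (hF.integrable_integrand hh' r x)]
  simp [add_mul]

lemma enorm_add_sq_le (a b : ℂ) : ‖a + b‖ₑ ^ 2 ≤ 2 * ‖a‖ₑ ^ 2 + 2 * ‖b‖ₑ ^ 2 := by
  rw [← ofReal_norm, ← ofReal_norm, ← ofReal_norm, ← ENNReal.ofReal_pow (norm_nonneg _),
    ← ENNReal.ofReal_pow (norm_nonneg _), ← ENNReal.ofReal_pow (norm_nonneg _),
    show (2 : ℝ≥0∞) = ENNReal.ofReal 2 by simp, ← ENNReal.ofReal_mul zero_le_two,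
    ← ENNReal.ofReal_mul zero_le_two, ← ENNReal.ofReal_add (by positivity) (by positivity)]
  refine ENNReal.ofReal_le_ofReal ?_
  have := norm_add_le a b
  nlinarith [sq_nonneg (‖a‖ - ‖b‖), norm_nonneg (a + b), norm_nonneg a, norm_nonneg b]

lemma wmass_mono {w w' : Euc d → ℝ → ℝ≥0∞} (hw : ∀ y r, w y r ≤ w' y r) : wmass w ≤ wmass w' :=
  lintegral_mono fun r => mul_le_mul_right (lintegral_mono fun y => hw y r) _

/-- `L²` bound for densities with controlled mass on boxes. -/
lemma IsSphericalKernel.exists_lintegral_sphOp_sq_le (hd : 4 ≤ d) (hF : IsSphericalKernel F C)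
    {δ : ℝ} (hδ : 0 < ((d : ℝ) - 1) / 2 - 1 - δ) :
    ∃ C' : ℝ, 0 < C' ∧ ∀ (h : Euc d → ℝ → ℂ) (u : ℝ), IsTest h → (∀ y r, ‖h y r‖ ≤ 1) → 1 ≤ u →
      HasDensity h δ u → ∫⁻ x, ‖sphOp F h x‖ₑ ^ 2 ≤
        ENNReal.ofReal (C' * u ^ ((((d : ℝ) - 1) / 2 - δ)⁻¹)) * wmass fun y r => ‖h y r‖ₑ := by
  have hC := hF.pos
  obtain ⟨C₁, hC₁, hint⟩ := hF.exists_interaction_le hd hδ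
  set κ : ℝ := ((d : ℝ) - 1) / 2 - 1 - δ with hκ
  have hκ1 : ((d : ℝ) - 1) / 2 - δ = κ + 1 := by rw [hκ]; ring
  rw [hκ1]
  refine ⟨64 * C + 4 * C₁, by positivity, ?_⟩
  intro h u hh h1 hu1 hu
  have hu0 : 0 < u := by linarith
  -- The solution of u L^{-κ} = L, which equates the far interaction with the near loss.
  set L : ℝ := u ^ ((κ + 1)⁻¹) with hL
  have hL1 : 1 ≤ L := Real.one_le_rpow hu1 (by positivity)
  have hLu : u * L ^ (-κ) = L := by
    rw [hL, ← Real.rpow_mul hu0.le]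
    nth_rewrite 1 [← Real.rpow_one u]
    rw [← Real.rpow_add hu0]
    congr 1
    field_simp; ring
  set S : Set (Euc d × ℝ) := {q | q.2 < L} with hS
  have hSm : MeasurableSet S := measurableSet_lt (by fun_prop) (by fun_prop)
  set h₁ : Euc d → ℝ → ℂ := fun y r => S.indicator (fun q => h q.1 q.2) (y, r) with hh₁
  set h₂ : Euc d → ℝ → ℂ := fun y r => Sᶜ.indicator (fun q => h q.1 q.2) (y, r) with hh₂
  have ht₁ : IsTest h₁ := hh.indicator hSm
  have ht₂ : IsTest h₂ := hh.indicator hSm.compl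
  have hle₁ : ∀ y r, ‖h₁ y r‖ ≤ ‖h y r‖ := fun y r => norm_indicator_le_norm_self _ _
  have hle₂ : ∀ y r, ‖h₂ y r‖ ≤ ‖h y r‖ := fun y r => norm_indicator_le_norm_self _ _
  have hsum : h = fun y r => h₁ y r + h₂ y r := by
    funext y r
    exact (congrFun (Set.indicator_self_add_compl S fun q => h q.1 q.2) (y, r)).symm
  -- On this part all radii lie in [1, L), so no pair differs by more than 4L and the far bound is
  -- 0.
  have b₁ := hF.lintegral_sphOp_sq_le_of_interaction (by omega) ht₁
    (fun y r => (hle₁ y r).trans (h1 y r)) (L := L) (by linarith) (A := 0) (by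
      intro y' r' hne
      have hr' : r' < L := by
        have := Set.mem_of_indicator_ne_zero hne
        exact this
      refine le_of_eq ((setLIntegral_congr_fun (measurableSet_lt (by fun_prop) (by fun_prop))
        (g := fun _ => 0) fun r hr => ?_).trans lintegral_zero)
      simp only [Set.mem_ofPred_eq] at hr
      have : ∀ y, h₁ y r = 0 := by
        intro y
        by_contra h0
        have h0' : h y r ≠ 0 := fun h0' => h0 (by simp [hh₁, Set.indicator, h0'])
        obtain ⟨R, hR⟩ := hh.supp
        have := (hR y r h0').1
        linarith
      simp [sliceInteraction, this])
  have b₂ := hF.lintegral_sphOp_sq_le_of_interaction (by omega) ht₂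
    (fun y r => (hle₂ y r).trans (h1 y r)) (L := L) (by linarith)
    (A := ENNReal.ofReal (C₁ * L)) (by
      intro y' r' _
      have := hint h₂ u L ht₂ hu0.le hL1 (hu.mono hle₂ le_rfl) (fun y r hne => by
        have := Set.mem_of_indicator_ne_zero hne
        simpa [hS] using this) y' r'
      rwa [hLu] at this)
  have hm₁ : (wmass fun y r => ‖h₁ y r‖ₑ) ≤ wmass fun y r => ‖h y r‖ₑ :=
    wmass_mono fun y r => enorm_le_iff_norm_le.2 (hle₁ y r)
  have hm₂ : (wmass fun y r => ‖h₂ y r‖ₑ) ≤ wmass fun y r => ‖h y r‖ₑ :=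
    wmass_mono fun y r => enorm_le_iff_norm_le.2 (hle₂ y r)
  set M := wmass fun y r => ‖h y r‖ₑ with hM
  have e0 : ∀ x, ‖sphOp F h x‖ₑ ^ 2 ≤ 2 * ‖sphOp F h₁ x‖ₑ ^ 2 + 2 * ‖sphOp F h₂ x‖ₑ ^ 2 := by
    intro x
    have := hF.sphOp_add ht₁ ht₂ x
    rw [← hsum] at this
    rw [this]
    exact enorm_add_sq_le _ _
  calc ∫⁻ x, ‖sphOp F h x‖ₑ ^ 2
      ≤ ∫⁻ x, (2 * ‖sphOp F h₁ x‖ₑ ^ 2 + 2 * ‖sphOp F h₂ x‖ₑ ^ 2) := lintegral_mono e0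
    _ = 2 * (∫⁻ x, ‖sphOp F h₁ x‖ₑ ^ 2) + 2 * ∫⁻ x, ‖sphOp F h₂ x‖ₑ ^ 2 := by
        rw [lintegral_add_left (((hF.measurable_sphOp ht₁).enorm.pow_const 2).const_mul 2),
          lintegral_const_mul' _ _ (by simp), lintegral_const_mul' _ _ (by simp)]
    _ ≤ 2 * ((ENNReal.ofReal (16 * C * L) + 2 * 0) * M) +
        2 * ((ENNReal.ofReal (16 * C * L) + 2 * ENNReal.ofReal (C₁ * L)) * M) := by
        gcongr
        · exact b₁.trans (by gcongr)
        · exact b₂.trans (by gcongr)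
    _ = (2 * (ENNReal.ofReal (16 * C * L) + 2 * 0) +
        2 * (ENNReal.ofReal (16 * C * L) + 2 * ENNReal.ofReal (C₁ * L))) * M := by ring
    _ = ENNReal.ofReal ((64 * C + 4 * C₁) * L) * M := by
        congr 1
        rw [show (2 : ℝ≥0∞) = ENNReal.ofReal 2 by simp, mul_zero, add_zero,
          ← ENNReal.ofReal_mul zero_le_two, ← ENNReal.ofReal_mul zero_le_two,
          ← ENNReal.ofReal_add (by positivity) (by positivity),
          ← ENNReal.ofReal_mul zero_le_two, ← ENNReal.ofReal_add (by positivity) (by positivity)]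
        congr 1; ring

end

/-! ### L¹ bounds and the exceptional set. -/

section

variable {d : ℕ} {F : ℝ → Euc d → ℂ} {C : ℝ} {h : Euc d → ℝ → ℂ}

lemma wmass_eq {w : Euc d → ℝ → ℝ≥0∞} (hw : Measurable fun q : Euc d × ℝ => w q.1 q.2) :
    wmass w = ∫⁻ q : Euc d × ℝ, ENNReal.ofReal (q.2 ^ (d - 1)) * w q.1 q.2 := by
  rw [Measure.volume_eq_prod, lintegral_prod_symm _ (by fun_prop), wmass]
  refine lintegral_congr fun r => ?_
  exact (lintegral_const_mul' _ _ ENNReal.ofReal_ne_top).symm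

lemma wmass_const_mul {w : Euc d → ℝ → ℝ≥0∞} {c : ℝ≥0∞} (hc : c ≠ ⊤) :
    (wmass fun y r => c * w y r) = c * wmass w := by
  unfold wmass
  rw [← lintegral_const_mul' _ _ hc]
  refine lintegral_congr fun r => ?_
  rw [lintegral_const_mul' _ _ hc]; ring

lemma IsTest.sphConv_eq_zero (hh : IsTest h) {r : ℝ} (hr : r < 1) (x : Euc d) :
    sphConv F h r x = 0 := by
  obtain ⟨R, hR⟩ := hh.supp
  have : ∀ y, h y r = 0 := fun y => by
    by_contra h0
    linarith [(hR y r h0).1]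
  simp [sphConv, this]

lemma IsSphericalKernel.lintegral_sphOp_le_slices (hF : IsSphericalKernel F C) (hh : IsTest h) :
    ∫⁻ x, ‖sphOp F h x‖ₑ ≤ ∫⁻ r, ENNReal.ofReal (r ^ (d - 1)) * ∫⁻ x, ‖sphConv F h r x‖ₑ := by
  have h1 : ∀ (r : ℝ) (x : Euc d), ‖((r ^ (d - 1) : ℝ) : ℂ) * sphConv F h r x‖ₑ =
      ENNReal.ofReal (r ^ (d - 1)) * ‖sphConv F h r x‖ₑ := by
    intro r x
    rcases lt_or_ge r 1 with hr | hr
    · simp [hh.sphConv_eq_zero hr]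
    · rw [enorm_mul, ← ofReal_norm, Complex.norm_real, Real.norm_of_nonneg (by positivity)]
  calc ∫⁻ x, ‖sphOp F h x‖ₑ
      ≤ ∫⁻ x, ∫⁻ r, ENNReal.ofReal (r ^ (d - 1)) * ‖sphConv F h r x‖ₑ := by
        refine lintegral_mono fun x => (enorm_integral_le_lintegral_enorm _).trans (le_of_eq ?_)
        simp only [h1]
    _ = ∫⁻ r, ∫⁻ x, ENNReal.ofReal (r ^ (d - 1)) * ‖sphConv F h r x‖ₑ := by
        refine lintegral_lintegral_swap ?_
        have hm : Measurable fun q : Euc d × ℝ => ENNReal.ofReal (q.2 ^ (d - 1)) *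
            ‖sphConv F h q.2 q.1‖ₑ :=
          Measurable.mul (by fun_prop) ((hF.measurable_sphConv hh).comp measurable_swap).enorm
        exact hm.aemeasurable
    _ = _ := by
        refine lintegral_congr fun r => ?_
        rw [lintegral_const_mul' _ _ ENNReal.ofReal_ne_top]

lemma IsSphericalKernel.lintegral_sphConv_le (hF : IsSphericalKernel F C) (hh : IsTest h) (r : ℝ) :
    ∫⁻ x, ‖sphConv F h r x‖ₑ ≤ ENNReal.ofReal C * ∫⁻ y, ‖h y r‖ₑ := by
  calc ∫⁻ x, ‖sphConv F h r x‖ₑ ≤ ∫⁻ x, ∫⁻ y, ‖h y r‖ₑ * ‖F r (x - y)‖ₑ := by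
        refine lintegral_mono fun x => (enorm_integral_le_lintegral_enorm _).trans (le_of_eq ?_)
        simp only [enorm_mul]
    _ = ∫⁻ y, ∫⁻ x, ‖h y r‖ₑ * ‖F r (x - y)‖ₑ := by
        have hm : Measurable fun q : Euc d × Euc d => ‖h q.2 r‖ₑ * ‖F r (q.1 - q.2)‖ₑ :=
          ((hh.measurable_slice r).enorm.comp measurable_snd).mul (hF.cont.measurable.comp
            (by fun_prop : Measurable fun q : Euc d × Euc d => (r, q.1 - q.2))).enorm
        exact lintegral_lintegral_swap hm.aemeasurable
    _ ≤ ∫⁻ y, ENNReal.ofReal C * ‖h y r‖ₑ := by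
        refine lintegral_mono fun y => ?_
        rw [lintegral_const_mul' _ _ (by finiteness), mul_comm,
          lintegral_sub_right_eq_self (fun x => ‖F r x‖ₑ) y]
        exact mul_le_mul_left (hF.l1 r) _
    _ = _ := lintegral_const_mul' _ _ ENNReal.ofReal_ne_top

lemma IsSphericalKernel.lintegral_sphOp_le (hF : IsSphericalKernel F C) (hh : IsTest h) :
    ∫⁻ x, ‖sphOp F h x‖ₑ ≤ ENNReal.ofReal C * wmass fun y r => ‖h y r‖ₑ := by
  refine (hF.lintegral_sphOp_le_slices hh).trans ?_
  rw [wmass, ← lintegral_const_mul' _ _ ENNReal.ofReal_ne_top]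
  refine lintegral_mono fun r => ?_
  refine (mul_le_mul_right (hF.lintegral_sphConv_le hh r) _).trans (le_of_eq (by ring))

lemma sphOp_const_mul (c : ℂ) (x : Euc d) :
    sphOp F (fun y r => c * h y r) x = c * sphOp F h x := by
  simp only [sphOp, sphConv, mul_assoc, integral_const_mul]
  rw [← integral_const_mul]
  congr 1 with r
  ring

lemma IsTest.const_mul (hh : IsTest h) (c : ℂ) : IsTest fun y r => c * h y r where
  meas := hh.meas.const_mul c
  bdd := by
    obtain ⟨B, hB⟩ := hh.bdd
    exact ⟨‖c‖ * B, fun y r => by rw [norm_mul]; gcongr; exact hB y r⟩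
  supp := hh.supp.imp fun R hR y r hne => hR y r (right_ne_zero_of_mul hne)

/-- The points within `1 / 5` of a sphere whose centre and radius lie in a given box. -/
def boxShell {d : ℕ} (m n : ℕ) (z : Fin d → ℤ) : Set (Euc d) :=
  {x | ∃ q ∈ dyadicCube (m : ℤ) z ×ˢ Set.Ico (n * (2 : ℝ) ^ m) ((n + 1) * (2 : ℝ) ^ m),
    |‖x - q.1‖ - q.2| ≤ 1 / 5}

/-- Within a box the centres and radii vary by O(2^m), and 1/5 ≤ 2^m, so all the thickened spheres
lie in one shell of thickness O(2^m) about a sphere of radius n2^m. As n ≥ 1, the thickness is at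
most comparable to the radius. -/
lemma volume_boxShell_le (hd : 1 ≤ d) (m : ℕ) {n : ℕ} (hn : 1 ≤ n) (z : Fin d → ℤ) :
    volume (boxShell m n z) ≤ ENNReal.ofReal ((sphereMeasure d).real Set.univ *
      (2 * (d + 2) * (d + 3) ^ (d - 1)) * ((2 : ℝ) ^ m * (n * (2 : ℝ) ^ m) ^ (d - 1))) := by
  rcases (boxShell m n z).eq_empty_or_nonempty with he | ⟨x0, q0, hq0, -⟩
  · simp [he]
  have h2 : (1 : ℝ) ≤ 2 ^ m := one_le_pow₀ one_le_two
  have hn' : (1 : ℝ) ≤ n := by exact_mod_cast hn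
  have hsub : boxShell m n z ⊆ {x | |‖x - q0.1‖ - n * 2 ^ m| ≤ (d + 2) * 2 ^ m} := by
    rintro x ⟨q, hq, hx⟩
    have e1 : ‖q.1 - q0.1‖ ≤ d * (2 : ℝ) ^ (m : ℤ) := norm_sub_le_of_mem_dyadicCube hq0.1 hq.1
    rw [zpow_natCast] at e1
    have e2 := abs_norm_sub_norm_le (x - q0.1) (x - q.1)
    rw [sub_sub_sub_cancel_left] at e2
    have e3 := hq.2.1
    have e4 := hq.2.2
    simp only [Set.mem_ofPred_eq]
    rw [abs_le] at *
    constructor <;> nlinarith [e2.1, e2.2, hx.1, hx.2]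
  refine (measure_mono hsub).trans ((volume_shell_le hd q0.1 (by positivity)
    (by positivity)).trans ?_)
  rw [← ENNReal.ofReal_toReal (measure_ne_top (sphereMeasure d) Set.univ),
    ← ENNReal.ofReal_mul (by positivity)]
  refine ENNReal.ofReal_le_ofReal ?_
  change (sphereMeasure d).real Set.univ * _ ≤ _
  have e5 : (n * (2 : ℝ) ^ m + (d + 2) * 2 ^ m) ^ (d - 1) ≤ ((d + 3) * (n * 2 ^ m)) ^ (d - 1) := by
    refine pow_le_pow_left₀ (by positivity) ?_ _
    have : (2 : ℝ) ^ m ≤ n * 2 ^ m := le_mul_of_one_le_left (by positivity) hn'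
    have : (0 : ℝ) ≤ d + 2 := by positivity
    nlinarith
  calc (sphereMeasure d).real Set.univ *
        (2 * ((d + 2) * 2 ^ m) * (n * (2 : ℝ) ^ m + (d + 2) * 2 ^ m) ^ (d - 1))
      ≤ (sphereMeasure d).real Set.univ *
        (2 * ((d + 2) * 2 ^ m) * ((d + 3) * (n * 2 ^ m)) ^ (d - 1)) := by gcongr
    _ = _ := by rw [mul_pow]; ring

lemma measurableSet_box (m n : ℕ) (z : Fin d → ℤ) : MeasurableSet
    (dyadicCube (m : ℤ) z ×ˢ Set.Ico (n * (2 : ℝ) ^ m) ((n + 1) * (2 : ℝ) ^ m)) :=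
  (measurableSet_dyadicCube _ _).prod measurableSet_Ico

lemma pairwise_disjoint_box (m : ℕ) : Pairwise (Function.onFun Disjoint
    fun i : ℕ × (Fin d → ℤ) => dyadicCube (m : ℤ) i.2 ×ˢ
      Set.Ico (i.1 * (2 : ℝ) ^ m) ((i.1 + 1) * (2 : ℝ) ^ m)) := by
  rintro ⟨n, z⟩ ⟨n', z'⟩ hne
  refine Set.disjoint_left.2 ?_
  rintro ⟨y, r⟩ ⟨h1, h2, h3⟩ ⟨h1', h2', h3'⟩
  simp only at h1 h1' h2 h3 h2' h3'
  have hp : (0 : ℝ) < 2 ^ m := by positivity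
  refine hne (Prod.ext ?_ ?_)
  · have e1 : (n : ℝ) < n' + 1 := lt_of_mul_lt_mul_right (h2.trans_lt h3') hp.le
    have e2 : (n' : ℝ) < n + 1 := lt_of_mul_lt_mul_right (h2'.trans_lt h3) hp.le
    have e1' : n < n' + 1 := by exact_mod_cast e1
    have e2' : n' < n + 1 := by exact_mod_cast e2
    simp only; omega
  · rw [mem_dyadicCube_iff] at h1 h1'
    exact h1.symm.trans h1'

/-- The spheres attached to the boxes of too large mass cover a small set. -/
lemma exists_volume_iUnion_boxShell_le (hd : 1 ≤ d) {δ : ℝ} (hδ : 0 < δ) :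
    ∃ C' : ℝ, 0 < C' ∧ ∀ w : Euc d × ℝ → ℝ≥0∞, Measurable w →
      volume (⋃ (i : ℕ × (ℕ × (Fin d → ℤ))) (_ : 1 ≤ i.2.1 ∧
        ENNReal.ofReal ((2 : ℝ) ^ (i.1 * (1 + δ))) < ∫⁻ q in dyadicCube (i.1 : ℤ) i.2.2 ×ˢ
          Set.Ico (i.2.1 * (2 : ℝ) ^ i.1) ((i.2.1 + 1) * (2 : ℝ) ^ i.1), w q),
        boxShell i.1 i.2.1 i.2.2) ≤
      ENNReal.ofReal C' * ∫⁻ q : Euc d × ℝ, ENNReal.ofReal (q.2 ^ (d - 1)) * w q := by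
  obtain ⟨G, hG, hgeo⟩ := exists_tsum_geometric_le hδ
  set c : ℝ := (sphereMeasure d).real Set.univ * (2 * (d + 2) * (d + 3) ^ (d - 1)) with hc
  have hc0 : 0 ≤ c := by positivity
  refine ⟨G * c + 1, by positivity, ?_⟩
  intro w hw
  set B : ℕ → ℕ × (Fin d → ℤ) → Set (Euc d × ℝ) := fun m i => dyadicCube (m : ℤ) i.2 ×ˢ
          Set.Ico (i.1 * (2 : ℝ) ^ m) ((i.1 + 1) * (2 : ℝ) ^ m) with hB
  set w' : Euc d × ℝ → ℝ≥0∞ := fun q => ENNReal.ofReal (q.2 ^ (d - 1)) * w q with hw'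
  -- A bad box has weighted mass at least (n2^m)^{d-1} 2^{m(1+δ)}, while its shell has volume O(2^m
  -- (n2^m)^{d-1}). The quotient 2^{-mδ} is what allows the sum over the scales `m`; at one scale
  -- the boxes are disjoint.
  have hone : ∀ i : ℕ × (ℕ × (Fin d → ℤ)), volume (⋃ (_ : 1 ≤ i.2.1 ∧
        ENNReal.ofReal ((2 : ℝ) ^ (i.1 * (1 + δ))) < ∫⁻ q in B i.1 i.2, w q),
        boxShell i.1 i.2.1 i.2.2) ≤
      ENNReal.ofReal (c * (2 : ℝ) ^ (-(i.1 * δ))) * ∫⁻ q in B i.1 i.2, w' q := by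
    rintro ⟨m, n, z⟩
    by_cases hi : 1 ≤ n ∧ ENNReal.ofReal ((2 : ℝ) ^ (m * (1 + δ))) < ∫⁻ q in B m (n, z), w q
    · simp only [hi, and_self, Set.iUnion_true]
      refine (volume_boxShell_le hd m hi.1 z).trans ?_
      have e1 : c * ((2 : ℝ) ^ m * (n * (2 : ℝ) ^ m) ^ (d - 1)) =
          c * (2 : ℝ) ^ (-(m * δ)) * ((n * (2 : ℝ) ^ m) ^ (d - 1) * (2 : ℝ) ^ (m * (1 + δ))) := by
        have : (2 : ℝ) ^ m = (2 : ℝ) ^ (-(m * δ)) * (2 : ℝ) ^ (m * (1 + δ)) := by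
          rw [← Real.rpow_add two_pos, ← Real.rpow_natCast]; congr 1; ring
        generalize (n * (2 : ℝ) ^ m) ^ (d - 1) = X
        rw [this]; ring
      rw [e1, ENNReal.ofReal_mul (by positivity)]
      gcongr
      rw [ENNReal.ofReal_mul (by positivity)]
      refine (mul_le_mul_right hi.2.le _).trans ?_
      rw [← lintegral_const_mul _ hw]
      refine setLIntegral_mono' (measurableSet_box m n z) fun q hq => ?_
      simp only [hw']
      gcongr
      exact hq.2.1
    · simp only [hi, Set.iUnion_false, measure_empty, zero_le]
  refine (measure_iUnion_le _).trans ((ENNReal.tsum_le_tsum hone).trans ?_)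
  rw [ENNReal.tsum_prod']
  calc _ ≤ ∑' m : ℕ, ENNReal.ofReal (c * (2 : ℝ) ^ (-(m * δ))) * ∫⁻ q, w' q := by
        refine ENNReal.tsum_le_tsum fun m => ?_
        simp only
        rw [ENNReal.tsum_mul_left]
        gcongr
        exact (lintegral_iUnion (s := B m) (fun i => measurableSet_box m i.1 i.2)
          (pairwise_disjoint_box m) w').symm.le.trans (setLIntegral_le_lintegral _ _)
    _ = (ENNReal.ofReal c * ∑' m : ℕ, (if (1 : ℝ) ≤ (2 : ℝ) ^ m then
          ENNReal.ofReal ((2 : ℝ) ^ (-(m * δ))) else 0)) * ∫⁻ q, w' q := by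
        rw [ENNReal.tsum_mul_right, ← ENNReal.tsum_mul_left]
        congr 1
        refine tsum_congr fun m => ?_
        rw [if_pos (one_le_pow₀ one_le_two), ENNReal.ofReal_mul hc0]
    _ ≤ _ := by
        gcongr
        refine (mul_le_mul_right (hgeo 1 one_pos) _).trans ?_
        rw [← ENNReal.ofReal_mul hc0, Real.one_rpow, mul_one]
        exact ENNReal.ofReal_le_ofReal (by linarith)

end

/-! ### Level sets of the density and the weak type bound. -/

lemma measure_lt_enorm_le {X : Type*} [MeasurableSpace X] {μ : Measure X} {f : X → ℂ}
    (hf : Measurable f) {s : ℝ} (hs : 0 < s) (n : ℕ) :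
    μ {x | ENNReal.ofReal s < ‖f x‖ₑ} ≤ ENNReal.ofReal ((s ^ n)⁻¹) * ∫⁻ x, ‖f x‖ₑ ^ n ∂μ := by
  have h1 : {x | ENNReal.ofReal s < ‖f x‖ₑ} ⊆ {x | ENNReal.ofReal (s ^ n) ≤ ‖f x‖ₑ ^ n} := by
    intro x hx
    simp only [Set.mem_ofPred_eq] at hx ⊢
    rw [ENNReal.ofReal_pow hs.le]
    exact pow_le_pow_left₀ zero_le hx.le n
  refine (measure_mono h1).trans ((meas_ge_le_lintegral_div (hf.enorm.pow_const n).aemeasurable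
    (by simpa using pow_pos hs n) ENNReal.ofReal_ne_top).trans (le_of_eq ?_))
  rw [ENNReal.ofReal_inv_of_pos (by positivity), div_eq_mul_inv, mul_comm]

section

variable {d : ℕ} {F : ℝ → Euc d → ℂ} {C : ℝ} {h : Euc d → ℝ → ℂ}

lemma IsTest.sum {H : ℕ → Euc d → ℝ → ℂ} (hH : ∀ j, IsTest (H j)) (J : ℕ) :
    IsTest fun y r => ∑ j ∈ Finset.range J, H j y r where
  meas := by
    refine Finset.measurable_sum _ fun j _ => (hH j).meas
  bdd := by
    choose B hB using fun j => (hH j).bdd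
    exact ⟨∑ j ∈ Finset.range J, B j, fun y r =>
      (norm_sum_le _ _).trans (Finset.sum_le_sum fun j _ => hB j y r)⟩
  supp := by
    choose R hR using fun j => (hH j).supp
    refine ⟨∑ j ∈ Finset.range J, |R j|, fun y r hne => ?_⟩
    obtain ⟨j, hj, hj0⟩ := Finset.exists_ne_zero_of_sum_ne_zero hne
    obtain ⟨h1, h2, h3⟩ := hR j y r hj0
    have : R j ≤ ∑ j ∈ Finset.range J, |R j| := (le_abs_self _).trans
      (Finset.single_le_sum (f := fun j => |R j|) (fun i _ => abs_nonneg _) hj)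
    exact ⟨h1, h2.trans this, h3.trans this⟩

lemma IsSphericalKernel.sphOp_sum (hF : IsSphericalKernel F C) {H : ℕ → Euc d → ℝ → ℂ}
    (hH : ∀ j, IsTest (H j)) (J : ℕ) (x : Euc d) :
    sphOp F (fun y r => ∑ j ∈ Finset.range J, H j y r) x =
      ∑ j ∈ Finset.range J, sphOp F (H j) x := by
  induction J with
  | zero => simp [sphOp, sphConv]
  | succ J ih =>
    simp only [Finset.sum_range_succ]
    rw [hF.sphOp_add (IsTest.sum hH J) (hH J), ih]

/-- The part of a density where its modulus is in `(2^{-(j+1)}, 2^{-j}]`. -/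
noncomputable def levelPart {d : ℕ} (h : Euc d → ℝ → ℂ) (j : ℕ) (y : Euc d) (r : ℝ) : ℂ :=
  {q : Euc d × ℝ | (1 / 2 : ℝ) ^ (j + 1) < ‖h q.1 q.2‖ ∧ ‖h q.1 q.2‖ ≤ (1 / 2 : ℝ) ^ j}.indicator
    (fun q => h q.1 q.2) (y, r)

lemma IsTest.levelPart (hh : IsTest h) (j : ℕ) : IsTest (levelPart h j) :=
  hh.indicator ((measurableSet_lt measurable_const hh.meas.norm).inter
    (measurableSet_le hh.meas.norm measurable_const))

lemma levelPart_apply (h : Euc d → ℝ → ℂ) (j : ℕ) (y : Euc d) (r : ℝ) :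
    levelPart h j y r = if (1 / 2 : ℝ) ^ (j + 1) < ‖h y r‖ ∧ ‖h y r‖ ≤ (1 / 2 : ℝ) ^ j then h y r
      else 0 := by
  simp only [levelPart, Set.indicator, Set.mem_ofPred_eq]

lemma sum_levelPart {J : ℕ} {y : Euc d} {r : ℝ} (h1 : ‖h y r‖ ≤ 1)
    (h0 : h y r ≠ 0 → (1 / 2 : ℝ) ^ J < ‖h y r‖) :
    ∑ j ∈ Finset.range J, levelPart h j y r = h y r := by
  by_cases hz : h y r = 0
  · simp [levelPart_apply, hz]
  have hJ := h0 hz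
  have hpos : 0 < ‖h y r‖ := norm_pos_iff.2 hz
  obtain ⟨n, hn1, hn2⟩ := exists_nat_pow_near_of_lt_one hpos h1 (by norm_num : (0 : ℝ) < 1 / 2)
    (by norm_num)
  have hnJ : n < J := by
    by_contra! hle
    exact absurd (hJ.trans_le hn2) (not_lt.2 (pow_le_pow_of_le_one (by norm_num) (by norm_num) hle))
  rw [Finset.sum_eq_single_of_mem n (Finset.mem_range.2 hnJ)]
  · rw [levelPart_apply, if_pos ⟨hn1, hn2⟩]
  · intro j _ hjn
    rw [levelPart_apply, if_neg]
    rintro ⟨h3, h4⟩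
    rcases lt_or_gt_of_ne hjn with hlt | hlt
    · have := pow_le_pow_of_le_one (by norm_num : (0 : ℝ) ≤ 1 / 2) (by norm_num) (by omega : j + 1 ≤ n)
      linarith
    · have := pow_le_pow_of_le_one (by norm_num : (0 : ℝ) ≤ 1 / 2) (by norm_num) (by omega : n + 1 ≤ j)
      linarith

lemma norm_two_pow_mul_levelPart_le (h : Euc d → ℝ → ℂ) (j : ℕ) (y : Euc d) (r : ℝ) :
    ‖(2 : ℂ) ^ j * levelPart h j y r‖ ≤ 1 := by
  rw [levelPart_apply]
  split_ifs with hj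
  · rw [norm_mul, norm_pow, Complex.norm_ofNat]
    calc (2 : ℝ) ^ j * ‖h y r‖ ≤ 2 ^ j * (1 / 2 : ℝ) ^ j := by gcongr; exact hj.2
      _ = 1 := by rw [← mul_pow]; norm_num
  · simp

/-- On its support the normalized level part has modulus at most 1, while 2^{j+1}|h| exceeds 1. The
masses of |h|^q thus control both the box masses and the total mass of the level part, with the
factor u = 2^{(j+1)q}. -/
lemma enorm_two_pow_mul_levelPart_le (h : Euc d → ℝ → ℂ) (j : ℕ) {q : ℝ} (hq : 0 ≤ q) (y : Euc d)
    (r : ℝ) : ‖(2 : ℂ) ^ j * levelPart h j y r‖ₑ ≤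
      ENNReal.ofReal ((2 : ℝ) ^ ((j + 1) * q)) * ‖h y r‖ₑ ^ q := by
  by_cases hj : (1 / 2 : ℝ) ^ (j + 1) < ‖h y r‖ ∧ ‖h y r‖ ≤ (1 / 2 : ℝ) ^ j
  · rw [← ofReal_norm, ← ofReal_norm, ENNReal.ofReal_rpow_of_nonneg (norm_nonneg _) hq,
      ← ENNReal.ofReal_mul (by positivity)]
    refine ENNReal.ofReal_le_ofReal ((norm_two_pow_mul_levelPart_le h j y r).trans ?_)
    have e1 : ((1 / 2 : ℝ) ^ (j + 1)) ^ q ≤ ‖h y r‖ ^ q :=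
      Real.rpow_le_rpow (by positivity) hj.1.le hq
    calc (1 : ℝ) = (2 : ℝ) ^ ((j + 1) * q) * ((1 / 2 : ℝ) ^ (j + 1)) ^ q := by
          rw [Real.rpow_mul zero_le_two, ← Real.mul_rpow (by positivity) (by positivity)]
          have : (2 : ℝ) ^ ((j : ℝ) + 1) = 2 ^ (j + 1) := by exact_mod_cast Real.rpow_natCast 2 (j + 1)
          rw [this, ← mul_pow]; norm_num
      _ ≤ _ := by gcongr
  · rw [levelPart_apply, if_neg hj]; simp

/-- Weak type bound for densities with controlled mass on boxes. -/
lemma IsSphericalKernel.exists_weak_le_of_density (hd : 4 ≤ d) (hF : IsSphericalKernel F C)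
    {δ q : ℝ} (hδ : 0 < ((d : ℝ) - 1) / 2 - 1 - δ) (hq : 0 ≤ q)
    (hqa : q * (1 + (((d : ℝ) - 1) / 2 - δ)⁻¹) < 2) :
    ∃ C' : ℝ, 0 < C' ∧ ∀ (h : Euc d → ℝ → ℂ) (c₀ : ℝ), IsTest h → (∀ y r, ‖h y r‖ ≤ 1) → 0 < c₀ →
      (∀ y r, h y r ≠ 0 → c₀ ≤ ‖h y r‖) →
      (∀ (m n : ℕ) (z : Fin d → ℤ), 1 ≤ n →
        ∫⁻ p in dyadicCube (m : ℤ) z ×ˢ Set.Ico (n * (2 : ℝ) ^ m) ((n + 1) * (2 : ℝ) ^ m),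
        ‖h p.1 p.2‖ₑ ^ q ≤ ENNReal.ofReal ((2 : ℝ) ^ (m * (1 + δ)))) →
      volume {x | ENNReal.ofReal (1 / 2) < ‖sphOp F h x‖ₑ} ≤
        ENNReal.ofReal C' * wmass fun y r => ‖h y r‖ₑ ^ q := by
  obtain ⟨C₁, hC₁, hL2⟩ := hF.exists_lintegral_sphOp_sq_le hd hδ
  set a : ℝ := (((d : ℝ) - 1) / 2 - δ)⁻¹ with ha
  -- Chebyshev in L² at level `j` has the exponential factor 2^{-j(2 - q(1+a))} = 2^{-3jη}. The
  -- decreasing thresholds 2^{-jη}, once squared, consume two thirds of it; the remaining 2^{-jη} is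
  -- summed.
  set η : ℝ := (2 - q * (1 + a)) / 3 with hη
  have hη0 : 0 < η := by rw [hη]; linarith
  obtain ⟨G, hG, hgeo⟩ := exists_tsum_geometric_le hη0
  have hgeo1 : ∑' m : ℕ, ENNReal.ofReal ((2 : ℝ) ^ (-(m * η))) ≤ ENNReal.ofReal G := by
    have := hgeo 1 one_pos
    rw [Real.one_rpow, mul_one] at this
    refine le_trans (le_of_eq (tsum_congr fun m => ?_)) this
    rw [if_pos (one_le_pow₀ one_le_two)]
  refine ⟨(4 * G ^ 2) * C₁ * (2 : ℝ) ^ (q * (1 + a)) * G, by positivity, ?_⟩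
  intro h c₀ hh h1 hc₀ hlow hdens
  set M := wmass fun y r => ‖h y r‖ₑ ^ q with hM
  -- The lower bound `c₀` only makes the number of levels finite; `J` does not enter the constant.
  obtain ⟨J, hJ⟩ := exists_pow_lt_of_lt_one hc₀ (by norm_num : (1 / 2 : ℝ) < 1)
  have hsum : h = fun y r => ∑ j ∈ Finset.range J, levelPart h j y r := by
    funext y r
    exact (sum_levelPart (h1 y r) fun hne => hJ.trans_le (hlow y r hne)).symm
  -- The thresholds are normalized by 1/(2G) so that their sum over all levels is at most 1/2.
  have hlev : ∀ j : ℕ, volume {x | ENNReal.ofReal (1 / (2 * G) * (2 : ℝ) ^ (-(j * η))) <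
      ‖sphOp F (levelPart h j) x‖ₑ} ≤
      ENNReal.ofReal ((4 * G ^ 2) * C₁ * (2 : ℝ) ^ (q * (1 + a))) *
        ENNReal.ofReal ((2 : ℝ) ^ (-(j * η))) * M := by
    intro j
    have hg := (hh.levelPart j).const_mul ((2 : ℂ) ^ j)
    set u : ℝ := (2 : ℝ) ^ ((j + 1) * q) with hu
    have hu1 : 1 ≤ u := Real.one_le_rpow one_le_two (by positivity)
    have hgd : HasDensity (fun y r => (2 : ℂ) ^ j * levelPart h j y r) δ u := by
      intro m n z hn
      calc _ ≤ ∫⁻ p in dyadicCube (m : ℤ) z ×ˢ Set.Ico (n * (2 : ℝ) ^ m) ((n + 1) * (2 : ℝ) ^ m),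
            ENNReal.ofReal u * ‖h p.1 p.2‖ₑ ^ q :=
            lintegral_mono fun p => enorm_two_pow_mul_levelPart_le h j hq p.1 p.2
        _ ≤ _ := by
            rw [lintegral_const_mul' _ _ ENNReal.ofReal_ne_top, ENNReal.ofReal_mul (by positivity)]
            exact mul_le_mul_right (hdens m n z hn) _
    have hb := hL2 _ u hg (norm_two_pow_mul_levelPart_le h j) hu1 hgd
    have hmass : (wmass fun y r => ‖(2 : ℂ) ^ j * levelPart h j y r‖ₑ) ≤ ENNReal.ofReal u * M := by
      rw [hM, ← wmass_const_mul ENNReal.ofReal_ne_top]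
      exact wmass_mono fun y r => enorm_two_pow_mul_levelPart_le h j hq y r
    have hset : {x | ENNReal.ofReal (1 / (2 * G) * (2 : ℝ) ^ (-(j * η))) <
        ‖sphOp F (levelPart h j) x‖ₑ} ⊆ {x | ENNReal.ofReal (2 ^ j * (1 / (2 * G) *
          (2 : ℝ) ^ (-(j * η)))) < ‖sphOp F (fun y r => (2 : ℂ) ^ j * levelPart h j y r) x‖ₑ} := by
      intro x hx
      simp only [Set.mem_ofPred_eq] at hx ⊢
      have e2 : ‖(2 : ℂ) ^ j‖ₑ = ENNReal.ofReal (2 ^ j) := by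
        rw [← ofReal_norm, norm_pow, Complex.norm_ofNat]
      rw [sphOp_const_mul, enorm_mul, ENNReal.ofReal_mul (by positivity), e2]
      exact ENNReal.mul_lt_mul_right (by simp) ENNReal.ofReal_ne_top hx
    refine (measure_mono hset).trans ((measure_lt_enorm_le (hF.measurable_sphOp hg)
      (by positivity) 2).trans ?_)
    refine (mul_le_mul_right (hb.trans (mul_le_mul_right hmass _)) _).trans (le_of_eq ?_)
    rw [← mul_assoc, ← mul_assoc, ← ENNReal.ofReal_mul (by positivity),
      ← ENNReal.ofReal_mul (by positivity), ← ENNReal.ofReal_mul (by positivity)]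
    congr 2
    have e1 : u ^ a * u = (2 : ℝ) ^ (q * (1 + a)) * (2 : ℝ) ^ (j * (q * (1 + a))) := by
      rw [hu, ← Real.rpow_mul zero_le_two, ← Real.rpow_add two_pos, ← Real.rpow_add two_pos]
      congr 1; ring
    have e2 : ((2 : ℝ) ^ j) ^ 2 * ((2 : ℝ) ^ (-(j * η))) ^ 3 =
        (2 : ℝ) ^ (j * (q * (1 + a))) := by
      rw [← pow_mul, ← Real.rpow_natCast, ← Real.rpow_natCast, ← Real.rpow_mul zero_le_two,
        ← Real.rpow_add two_pos]
      congr 1; push_cast; rw [hη]; ring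
    have e3 : (0 : ℝ) < 2 ^ j := by positivity
    have e4 : (0 : ℝ) < (2 : ℝ) ^ (-(j * η)) := by positivity
    calc ((2 ^ j * (1 / (2 * G) * (2 : ℝ) ^ (-(j * η)))) ^ 2)⁻¹ * (C₁ * u ^ a) * u
        = ((2 ^ j * (1 / (2 * G) * (2 : ℝ) ^ (-(j * η)))) ^ 2)⁻¹ * C₁ * (u ^ a * u) := by ring
      _ = _ := by
          rw [e1, ← e2]
          generalize (2 : ℝ) ^ (-(j * η)) = t at e4 ⊢
          generalize (2 : ℝ) ^ j = s at e3 ⊢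
          field_simp
          norm_num
  have hcov : {x | ENNReal.ofReal (1 / 2) < ‖sphOp F h x‖ₑ} ⊆
      ⋃ j : ℕ, {x | ENNReal.ofReal (1 / (2 * G) * (2 : ℝ) ^ (-(j * η))) <
      ‖sphOp F (levelPart h j) x‖ₑ} := by
    intro x hx
    by_contra hnot
    simp only [Set.mem_iUnion, Set.mem_ofPred_eq, not_exists, not_lt] at hnot hx
    refine absurd hx (not_lt.2 ?_)
    rw [hsum, hF.sphOp_sum fun j => hh.levelPart j]
    refine (enorm_sum_le _ _).trans ((Finset.sum_le_sum fun j _ => hnot j).trans ?_)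
    calc ∑ j ∈ Finset.range J, ENNReal.ofReal (1 / (2 * G) * (2 : ℝ) ^ (-(j * η)))
        ≤ ∑' j : ℕ, ENNReal.ofReal (1 / (2 * G) * (2 : ℝ) ^ (-(j * η))) :=
          ENNReal.sum_le_tsum _
      _ = ENNReal.ofReal (1 / (2 * G)) * ∑' j : ℕ, ENNReal.ofReal ((2 : ℝ) ^ (-(j * η))) := by
          rw [← ENNReal.tsum_mul_left]
          exact tsum_congr fun j => ENNReal.ofReal_mul (by positivity)
      _ ≤ ENNReal.ofReal (1 / (2 * G)) * ENNReal.ofReal G := by gcongr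
      _ = _ := by
          rw [← ENNReal.ofReal_mul (by positivity)]
          congr 1; field_simp
  refine (measure_mono hcov).trans ((measure_iUnion_le _).trans
    ((ENNReal.tsum_le_tsum hlev).trans ?_))
  rw [ENNReal.tsum_mul_right, ENNReal.tsum_mul_left, ENNReal.ofReal_mul (q := G) (by positivity)]
  gcongr

end

section

variable {d : ℕ} {F : ℝ → Euc d → ℂ} {C : ℝ} {h : Euc d → ℝ → ℂ}

/-- A Calderón-Zygmund type splitting at height 1. Where |h| > 1 one has |h| ≤ |h|^q and the L¹
bound suffices. The part of the rest inside bad boxes contributes nothing off the set Ω covered by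
their spheres, and Ω has controlled volume. The last part has modulus at most 1 and satisfies the
box condition, so the level set argument applies. -/
lemma IsSphericalKernel.exists_weak_one_le (hd : 4 ≤ d) (hF : IsSphericalKernel F C)
    {δ q : ℝ} (hδ0 : 0 < δ) (hδ : 0 < ((d : ℝ) - 1) / 2 - 1 - δ) (hq : 1 ≤ q)
    (hqa : q * (1 + (((d : ℝ) - 1) / 2 - δ)⁻¹) < 2) :
    ∃ C' : ℝ, 0 < C' ∧ ∀ (h : Euc d → ℝ → ℂ) (c₀ : ℝ), IsTest h → 0 < c₀ →
      (∀ y r, h y r ≠ 0 → c₀ ≤ ‖h y r‖) →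
      volume {x | 1 < ‖sphOp F h x‖ₑ} ≤ ENNReal.ofReal C' * wmass fun y r => ‖h y r‖ₑ ^ q := by
  have hC := hF.pos
  have hq0 : 0 < q := by linarith
  obtain ⟨C₁, hC₁, hgood⟩ := hF.exists_weak_le_of_density hd hδ hq0.le hqa
  obtain ⟨C₂, hC₂, hbad⟩ := exists_volume_iUnion_boxShell_le (d := d) (by omega) hδ0
  refine ⟨2 * C + C₂ + C₁, by positivity, ?_⟩
  intro h c₀ hh hc₀ hlow
  set w : Euc d × ℝ → ℝ≥0∞ := fun p => ‖h p.1 p.2‖ₑ ^ q with hw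
  have hwm : Measurable w := hh.measurable_enorm.pow_const q
  set M := wmass fun y r => ‖h y r‖ₑ ^ q with hM
  have hMeq : M = ∫⁻ p : Euc d × ℝ, ENNReal.ofReal (p.2 ^ (d - 1)) * w p := wmass_eq hwm
  set bad : ℕ × (ℕ × (Fin d → ℤ)) → Prop := fun i => 1 ≤ i.2.1 ∧
        ENNReal.ofReal ((2 : ℝ) ^ (i.1 * (1 + δ))) < ∫⁻ q in dyadicCube (i.1 : ℤ) i.2.2 ×ˢ
          Set.Ico (i.2.1 * (2 : ℝ) ^ i.1) ((i.2.1 + 1) * (2 : ℝ) ^ i.1), w q with hbaddef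
  set Ω : Set (Euc d) := ⋃ (i : ℕ × (ℕ × (Fin d → ℤ))) (_ : bad i), boxShell i.1 i.2.1 i.2.2
    with hΩ
  set Bad : Set (Euc d × ℝ) := ⋃ (i : ℕ × (ℕ × (Fin d → ℤ))) (_ : bad i),
    dyadicCube (i.1 : ℤ) i.2.2 ×ˢ
          Set.Ico (i.2.1 * (2 : ℝ) ^ i.1) ((i.2.1 + 1) * (2 : ℝ) ^ i.1) with hBad
  have hΩle : volume Ω ≤ ENNReal.ofReal C₂ * M := by rw [hMeq]; exact hbad w hwm
  have hBadm : MeasurableSet Bad :=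
    MeasurableSet.iUnion fun i => MeasurableSet.iUnion fun _ => measurableSet_box _ _ _
  set S : Set (Euc d × ℝ) := {p | 1 < ‖h p.1 p.2‖} with hS
  have hSm : MeasurableSet S := measurableSet_lt measurable_const hh.meas.norm
  set h₁ : Euc d → ℝ → ℂ := fun y r => S.indicator (fun p => h p.1 p.2) (y, r) with hh₁
  set h₂ : Euc d → ℝ → ℂ := fun y r => (Sᶜ ∩ Bad).indicator (fun p => h p.1 p.2) (y, r) with hh₂
  set h₃ : Euc d → ℝ → ℂ := fun y r => (Sᶜ ∩ Badᶜ).indicator (fun p => h p.1 p.2) (y, r) with hh₃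
  have ht₁ : IsTest h₁ := hh.indicator hSm
  have ht₂ : IsTest h₂ := hh.indicator (hSm.compl.inter hBadm)
  have ht₃ : IsTest h₃ := hh.indicator (hSm.compl.inter hBadm.compl)
  have ht₂₃ : IsTest fun y r => h₂ y r + h₃ y r := by
    convert hh.indicator hSm.compl using 3 with y r
    simp only [hh₂, hh₃, Set.indicator, Set.mem_inter_iff, Set.mem_compl_iff]
    by_cases hb : (y, r) ∈ Bad <;> simp [hb]
  have hsum : h = fun y r => h₁ y r + (h₂ y r + h₃ y r) := by
    funext y r
    simp only [hh₁, hh₂, hh₃, Set.indicator, Set.mem_inter_iff, Set.mem_compl_iff]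
    by_cases hb : (y, r) ∈ Bad <;> by_cases hs : (y, r) ∈ S <;> simp [hb, hs]
  have hle₃ : ∀ y r, ‖h₃ y r‖ ≤ ‖h y r‖ := fun y r => norm_indicator_le_norm_self _ _
  have b₁ : volume {x | ENNReal.ofReal (1 / 2) < ‖sphOp F h₁ x‖ₑ} ≤ ENNReal.ofReal (2 * C) * M := by
    have e1 := measure_lt_enorm_le (μ := volume) (hF.measurable_sphOp ht₁)
      (by norm_num : (0 : ℝ) < 1 / 2) 1
    simp only [pow_one] at e1
    refine e1.trans ((mul_le_mul_right (hF.lintegral_sphOp_le ht₁) _).trans ?_)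
    rw [← mul_assoc, ← ENNReal.ofReal_mul (by norm_num)]
    refine mul_le_mul' (le_of_eq (by norm_num)) (wmass_mono fun y r => ?_)
    by_cases hs : (y, r) ∈ S
    · have e2 : (1 : ℝ≥0∞) ≤ ‖h y r‖ₑ := by
        rw [← ofReal_norm, ← ENNReal.ofReal_one]
        exact ENNReal.ofReal_le_ofReal (le_of_lt hs)
      simp only [hh₁, Set.indicator_of_mem hs]
      nth_rewrite 1 [← ENNReal.rpow_one ‖h y r‖ₑ]
      exact ENNReal.rpow_le_rpow_of_exponent_le e2 hq
    · simp [hh₁, Set.indicator_of_notMem hs]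
  have b₂ : ∀ x, x ∉ Ω → sphOp F h₂ x = 0 := by
    intro x hx
    have hz : ∀ r y, h₂ y r * F r (x - y) = 0 := by
      intro r y
      by_contra hne
      have hm : (y, r) ∈ Sᶜ ∩ Bad := Set.mem_of_indicator_ne_zero (left_ne_zero_of_mul hne)
      obtain ⟨R, hR⟩ := ht₂.supp
      have hr := (hR y r (left_ne_zero_of_mul hne)).1
      have hs := hF.supp r (x - y) (by linarith) (right_ne_zero_of_mul hne)
      obtain ⟨i, hi, hbox⟩ := Set.mem_iUnion₂.1 hm.2
      exact hx (Set.mem_iUnion₂.2 ⟨i, hi, (y, r), hbox, hs⟩)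
    simp [sphOp, sphConv, hz]
  have b₃ := hgood h₃ c₀ ht₃ (fun y r => by
      by_cases hs : (y, r) ∈ S
      · simp [hh₃, Set.indicator, hs]
      · exact (hle₃ y r).trans (not_lt.1 hs)) hc₀ (fun y r hne => by
      have hm := Set.mem_of_indicator_ne_zero hne
      have e : h₃ y r = h y r := Set.indicator_of_mem hm _
      rw [e] at hne ⊢
      exact hlow y r hne) (by
      intro m n z hn
      by_cases hb : bad (m, (n, z))
      · refine le_trans (le_of_eq ?_) zero_le
        refine (setLIntegral_congr_fun (measurableSet_box m n z) (g := fun _ => 0)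
          fun p hp => ?_).trans lintegral_zero
        have : p ∈ Bad := Set.mem_iUnion₂.2 ⟨_, hb, hp⟩
        simp [hh₃, Set.indicator, this, hq0]
      · have e1 : ∫⁻ p in dyadicCube (m : ℤ) z ×ˢ
            Set.Ico (n * (2 : ℝ) ^ m) ((n + 1) * (2 : ℝ) ^ m), w p ≤
            ENNReal.ofReal ((2 : ℝ) ^ (m * (1 + δ))) := by
          by_contra! hlt
          exact hb ⟨hn, hlt⟩
        refine (lintegral_mono fun p => ?_).trans e1
        exact ENNReal.rpow_le_rpow (enorm_le_iff_norm_le.2 (hle₃ p.1 p.2)) hq0.le)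
  have hm₃ : (wmass fun y r => ‖h₃ y r‖ₑ ^ q) ≤ M := wmass_mono fun y r =>
    ENNReal.rpow_le_rpow (enorm_le_iff_norm_le.2 (hle₃ y r)) hq0.le
  have hcov : {x | 1 < ‖sphOp F h x‖ₑ} ⊆ ({x | ENNReal.ofReal (1 / 2) < ‖sphOp F h₁ x‖ₑ} ∪ Ω) ∪
      {x | ENNReal.ofReal (1 / 2) < ‖sphOp F h₃ x‖ₑ} := by
    intro x hx
    by_contra hnot
    simp only [Set.mem_union, Set.mem_ofPred_eq, not_or, not_lt] at hnot hx
    refine absurd hx (not_lt.2 ?_)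
    rw [hsum, hF.sphOp_add ht₁ ht₂₃, hF.sphOp_add ht₂ ht₃, b₂ x hnot.1.2, zero_add]
    refine (enorm_add_le _ _).trans ((add_le_add hnot.1.1 hnot.2).trans (le_of_eq ?_))
    rw [← ENNReal.ofReal_add (by norm_num) (by norm_num)]
    norm_num
  calc _ ≤ _ := measure_mono hcov
    _ ≤ volume {x | ENNReal.ofReal (1 / 2) < ‖sphOp F h₁ x‖ₑ} + volume Ω +
        volume {x | ENNReal.ofReal (1 / 2) < ‖sphOp F h₃ x‖ₑ} :=
        (measure_union_le _ _).trans (add_le_add_left (measure_union_le _ _) _)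
    _ ≤ ENNReal.ofReal (2 * C) * M + ENNReal.ofReal C₂ * M + ENNReal.ofReal C₁ * M := by
        gcongr
        exact b₃.trans (mul_le_mul_right hm₃ _)
    _ = _ := by
        rw [← add_mul, ← add_mul, ← ENNReal.ofReal_add (by positivity) (by positivity),
          ← ENNReal.ofReal_add (by positivity) (by positivity)]

/-- Weak type `(q, q)` bound. -/
lemma IsSphericalKernel.exists_weak_le (hd : 4 ≤ d) (hF : IsSphericalKernel F C)
    {δ q : ℝ} (hδ0 : 0 < δ) (hδ : 0 < ((d : ℝ) - 1) / 2 - 1 - δ) (hq : 1 ≤ q)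
    (hqa : q * (1 + (((d : ℝ) - 1) / 2 - δ)⁻¹) < 2) :
    ∃ C' : ℝ, 0 < C' ∧ ∀ (h : Euc d → ℝ → ℂ) (c₀ : ℝ), IsTest h → 0 < c₀ →
      (∀ y r, h y r ≠ 0 → c₀ ≤ ‖h y r‖) → ∀ t : ℝ, 0 < t →
      volume {x | ENNReal.ofReal t < ‖sphOp F h x‖ₑ} ≤
        ENNReal.ofReal (C' * t ^ (-q)) * wmass fun y r => ‖h y r‖ₑ ^ q := by
  obtain ⟨C', hC', hweak⟩ := hF.exists_weak_one_le hd hδ0 hδ hq hqa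
  have hq0 : 0 ≤ q := by linarith
  refine ⟨C', hC', ?_⟩
  intro h c₀ hh hc₀ hlow t ht
  have hc : ‖((t⁻¹ : ℝ) : ℂ)‖ = t⁻¹ := by
    rw [Complex.norm_real, Real.norm_of_nonneg (by positivity)]
  have hce : ‖((t⁻¹ : ℝ) : ℂ)‖ₑ = ENNReal.ofReal t⁻¹ := by rw [← ofReal_norm, hc]
  -- By linearity height `t` becomes height 1 for h/t.
  have h1 := hweak _ (t⁻¹ * c₀) (hh.const_mul ((t⁻¹ : ℝ) : ℂ)) (by positivity) (fun y r hne => by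
    rw [norm_mul, hc]
    gcongr
    exact hlow y r (right_ne_zero_of_mul hne))
  have h2 : {x | ENNReal.ofReal t < ‖sphOp F h x‖ₑ} ⊆
      {x | 1 < ‖sphOp F (fun y r => ((t⁻¹ : ℝ) : ℂ) * h y r) x‖ₑ} := by
    intro x hx
    simp only [Set.mem_ofPred_eq] at hx ⊢
    rw [sphOp_const_mul, enorm_mul, hce]
    have e1 : (1 : ℝ≥0∞) = ENNReal.ofReal t⁻¹ * ENNReal.ofReal t := by
      rw [← ENNReal.ofReal_mul (by positivity), inv_mul_cancel₀ ht.ne', ENNReal.ofReal_one]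
    rw [e1]
    exact ENNReal.mul_lt_mul_right (by simpa using ht) ENNReal.ofReal_ne_top hx
  refine (measure_mono h2).trans (h1.trans (le_of_eq ?_))
  have e2 : (fun (y : Euc d) (r : ℝ) => ‖((t⁻¹ : ℝ) : ℂ) * h y r‖ₑ ^ q) =
      fun y r => ENNReal.ofReal (t ^ (-q)) * ‖h y r‖ₑ ^ q := by
    funext y r
    rw [enorm_mul, hce, ENNReal.mul_rpow_of_nonneg _ _ hq0,
      ENNReal.ofReal_rpow_of_nonneg (by positivity) hq0, Real.inv_rpow ht.le, Real.rpow_neg ht.le]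
  rw [e2, wmass_const_mul ENNReal.ofReal_ne_top, ← mul_assoc, ← ENNReal.ofReal_mul hC'.le]

end

/-! ### The L¹ bound with a gain on large cubes. -/

lemma sq_setLIntegral_le {X : Type*} [MeasurableSpace X] {μ : Measure X} {f : X → ℝ≥0∞}
    (hf : Measurable f) {S : Set X} (hS : ∀ x, f x ≠ 0 → x ∈ S) (hSm : MeasurableSet S) :
    (∫⁻ x, f x ∂μ) ^ 2 ≤ μ S * ∫⁻ x, f x ^ 2 ∂μ := by
  have h1 := ENNReal.lintegral_mul_le_Lp_mul_Lq (p := 2) (q := 2) μ (by constructor <;> norm_num)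
    (measurable_one.indicator hSm).aemeasurable hf.aemeasurable
  have h2 : ∀ x, (S.indicator (1 : X → ℝ≥0∞) * f) x = f x := by
    intro x
    by_cases hx : x ∈ S
    · simp [hx]
    · simp [not_not.1 (mt (hS x) hx)]
  have h3 : ∀ x, S.indicator (1 : X → ℝ≥0∞) x ^ (2 : ℝ) = S.indicator 1 x := by
    intro x
    by_cases hx : x ∈ S <;> simp [hx]
  simp only [h2, h3] at h1
  rw [lintegral_indicator_one hSm, ← ENNReal.mul_rpow_of_nonneg _ _ (by norm_num)] at h1
  have h4 := pow_le_pow_left₀ zero_le h1 2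
  rw [← ENNReal.rpow_natCast (_ ^ (1 / (2 : ℝ))), ← ENNReal.rpow_mul] at h4
  simpa using h4

section

variable {d : ℕ} {F : ℝ → Euc d → ℂ} {C : ℝ} {h : Euc d → ℝ → ℂ}

/-- The convolution lives in a shell of volume O(2^ℓ r^{d-1}), the condition r ≥ 2^ℓ keeping the
thickness below a multiple of the radius, and its squared L² norm is O(r^{-(d-1)} A² 2^{ℓd}). By
Cauchy-Schwarz the squared L¹ norm is O(2^ℓ A² 2^{ℓd}), which is 2^{-ℓ(d-1)} times the square of A
2^{ℓd}; the powers of r cancel. -/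
lemma IsSphericalKernel.exists_lintegral_cube_le (hd : 1 ≤ d) (hF : IsSphericalKernel F C) :
    ∃ C' : ℝ, 0 < C' ∧ ∀ (ℓ : ℕ) (z : Fin d → ℤ) (b : Euc d → ℂ) (A : ℝ≥0∞) (r : ℝ), Measurable b →
      (∃ B, ∀ y, ‖b y‖ ≤ B) → (∀ y, b y ≠ 0 → y ∈ dyadicCube (ℓ : ℤ) z) → (∀ y, ‖b y‖ₑ ≤ A) →
      (2 : ℝ) ^ ℓ ≤ r → ∫⁻ x, ‖∫ y, b y * F r (x - y)‖ₑ ≤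
        ENNReal.ofReal (C' * (2 : ℝ) ^ (-(ℓ * (((d : ℝ) - 1) / 2)))) *
          (A * volume (dyadicCube (d := d) (ℓ : ℤ) z)) := by
  have hC := hF.pos
  set c : ℝ := (sphereMeasure d).real Set.univ * (2 * (d + 1) * (d + 2) ^ (d - 1)) with hc
  have hc0 : 0 ≤ c := by positivity
  refine ⟨√(c * C) + 1, by positivity, ?_⟩
  intro ℓ z b A r hb hbB hbz hbA hr
  have h2 : (1 : ℝ) ≤ 2 ^ ℓ := one_le_pow₀ one_le_two
  have hr0 : 0 < r := by linarith
  by_cases hb0 : ∀ y, b y = 0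
  · simp [hb0]
  push Not at hb0
  obtain ⟨y0, hy0⟩ := hb0
  have hy0z := hbz y0 hy0
  set S : Set (Euc d) := {x | |‖x - y0‖ - r| ≤ (d + 1) * 2 ^ ℓ} with hS
  have hSm : MeasurableSet S := measurableSet_shell _ _ _
  have hm : Measurable fun x : Euc d => ∫ y, b y * F r (x - y) := by
    have : Measurable fun q : Euc d × Euc d => b q.2 * F r (q.1 - q.2) :=
      (hb.comp measurable_snd).mul (hF.cont.measurable.comp
        (by fun_prop : Measurable fun q : Euc d × Euc d => (r, q.1 - q.2)))
    exact this.stronglyMeasurable.integral_prod_right'.measurable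
  have hsupp : ∀ x, ‖∫ y, b y * F r (x - y)‖ₑ ≠ 0 → x ∈ S := by
    intro x hx
    have : ∃ y, b y * F r (x - y) ≠ 0 := by
      by_contra! hall
      exact hx (by simp [hall])
    obtain ⟨y, hy⟩ := this
    have e1 := norm_sub_le_of_mem_dyadicCube hy0z (hbz y (left_ne_zero_of_mul hy))
    rw [zpow_natCast] at e1
    have e2 := hF.supp r (x - y) hr0.le (right_ne_zero_of_mul hy)
    have e3 := abs_norm_sub_norm_le (x - y0) (x - y)
    rw [sub_sub_sub_cancel_left] at e3
    have e4 := abs_sub_le ‖x - y0‖ ‖x - y‖ r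
    simp only [hS, Set.mem_ofPred_eq]
    linarith
  have hvol : volume S ≤ ENNReal.ofReal (c * 2 ^ ℓ * r ^ (d - 1)) := by
    refine (volume_shell_le hd y0 hr0.le (by positivity)).trans ?_
    rw [← ENNReal.ofReal_toReal (measure_ne_top (sphereMeasure d) Set.univ),
      ← ENNReal.ofReal_mul (by positivity)]
    refine ENNReal.ofReal_le_ofReal ?_
    change (sphereMeasure d).real Set.univ * _ ≤ _
    have e5 : (r + (d + 1) * (2 : ℝ) ^ ℓ) ^ (d - 1) ≤ ((d + 2) * r) ^ (d - 1) := by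
      refine pow_le_pow_left₀ (by positivity) ?_ _
      have : (0 : ℝ) ≤ d + 1 := by positivity
      nlinarith
    calc (sphereMeasure d).real Set.univ *
          (2 * ((d + 1) * 2 ^ ℓ) * (r + (d + 1) * (2 : ℝ) ^ ℓ) ^ (d - 1))
        ≤ (sphereMeasure d).real Set.univ *
          (2 * ((d + 1) * 2 ^ ℓ) * ((d + 2) * r) ^ (d - 1)) := by gcongr
      _ = _ := by rw [mul_pow]; ring
  set V := volume (dyadicCube (d := d) (ℓ : ℤ) z) with hV
  have hbsq : ∫⁻ y, ‖b y‖ₑ ^ 2 ≤ A ^ 2 * V := by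
    calc ∫⁻ y, ‖b y‖ₑ ^ 2 ≤ ∫⁻ y, (dyadicCube (ℓ : ℤ) z).indicator (fun _ => A ^ 2) y := by
          refine lintegral_mono fun y => ?_
          by_cases hy : y ∈ dyadicCube (ℓ : ℤ) z
          · rw [Set.indicator_of_mem hy]
            exact pow_le_pow_left₀ zero_le (hbA y) 2
          · simp [not_not.1 (mt (hbz y) hy)]
      _ = _ := by rw [lintegral_indicator (measurableSet_dyadicCube _ _), setLIntegral_const]
  have hl2 := hF.l2 r hr0 b hb hbB ⟨‖y0‖ + d * 2 ^ ℓ, fun y hy => by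
    have e1 := norm_sub_le_of_mem_dyadicCube hy0z (hbz y hy)
    rw [zpow_natCast] at e1
    have := norm_add_le (y - y0) y0
    rw [sub_add_cancel] at this
    linarith⟩
  rw [← ENNReal.pow_le_pow_left_iff two_ne_zero]
  refine (sq_setLIntegral_le hm.enorm hsupp hSm).trans
    ((mul_le_mul' hvol (hl2.trans (mul_le_mul_right hbsq _))).trans ?_)
  have hVe : V = ENNReal.ofReal (((2 : ℝ) ^ ℓ) ^ d) := by
    rw [hV, volume_dyadicCube, zpow_natCast, ← ENNReal.ofReal_pow (by positivity)]
  have e6 : r ^ (d - 1) * r ^ (-((d : ℝ) - 1)) = 1 := by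
    rw [← Real.rpow_natCast, ← Real.rpow_add hr0, Nat.cast_sub hd]
    convert Real.rpow_zero r using 2
    push_cast; ring
  have e7 : c * 2 ^ ℓ * r ^ (d - 1) * (C * r ^ (-((d : ℝ) - 1))) = c * C * 2 ^ ℓ := by
    rw [show c * 2 ^ ℓ * r ^ (d - 1) * (C * r ^ (-((d : ℝ) - 1))) =
      c * C * 2 ^ ℓ * (r ^ (d - 1) * r ^ (-((d : ℝ) - 1))) by ring, e6, mul_one]
  have e9 : ((2 : ℝ) ^ (-(ℓ * (((d : ℝ) - 1) / 2)))) ^ 2 * ((2 : ℝ) ^ ℓ) ^ d = 2 ^ ℓ := by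
    rw [← Real.rpow_natCast (_ ^ (-(ℓ * (((d : ℝ) - 1) / 2)))), ← Real.rpow_mul zero_le_two,
      ← pow_mul, ← Real.rpow_natCast 2, ← Real.rpow_natCast 2, ← Real.rpow_add two_pos]
    congr 1; push_cast; ring
  have e8 : c * C * 2 ^ ℓ = (√(c * C) * (2 : ℝ) ^ (-(ℓ * (((d : ℝ) - 1) / 2)))) ^ 2 *
      ((2 : ℝ) ^ ℓ) ^ d := by
    rw [mul_pow, Real.sq_sqrt (by positivity), mul_assoc (c * C), e9]
  calc ENNReal.ofReal (c * 2 ^ ℓ * r ^ (d - 1)) *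
        (ENNReal.ofReal (C * r ^ (-((d : ℝ) - 1))) * (A ^ 2 * V))
      = ENNReal.ofReal (c * C * 2 ^ ℓ) * A ^ 2 * V := by
        rw [← mul_assoc, ← ENNReal.ofReal_mul (by positivity), e7, ← mul_assoc]
    _ = ENNReal.ofReal ((√(c * C) * (2 : ℝ) ^ (-(ℓ * (((d : ℝ) - 1) / 2)))) ^ 2) * A ^ 2 *
          (V * V) := by
        rw [e8, ENNReal.ofReal_mul (by positivity), ← hVe]; ring
    _ ≤ ENNReal.ofReal (((√(c * C) + 1) * (2 : ℝ) ^ (-(ℓ * (((d : ℝ) - 1) / 2)))) ^ 2) * A ^ 2 *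
          (V * V) := by
        gcongr
        linarith
    _ = _ := by
        rw [ENNReal.ofReal_pow (by positivity)]; ring

/-- `L¹` bound with a gain for densities dominated by a function constant on large cubes. -/
lemma IsSphericalKernel.exists_lintegral_sphOp_le (hd : 1 ≤ d) (hF : IsSphericalKernel F C) :
    ∃ C' : ℝ, 0 < C' ∧ ∀ (ℓ : ℕ) (h : Euc d → ℝ → ℂ) (N : Euc d → ℝ → ℝ≥0∞), IsTest h →
      (∀ y r, ‖h y r‖ₑ ≤ N y r) → (∀ y r, h y r ≠ 0 → (2 : ℝ) ^ ℓ ≤ r) →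
      (∀ z, ∀ y ∈ dyadicCube (ℓ : ℤ) z, ∀ y' ∈ dyadicCube (ℓ : ℤ) z, ∀ r, N y r = N y' r) →
      ∫⁻ x, ‖sphOp F h x‖ₑ ≤
        ENNReal.ofReal (C' * (2 : ℝ) ^ (-(ℓ * (((d : ℝ) - 1) / 2)))) * wmass N := by
  obtain ⟨C', hC', hcube⟩ := hF.exists_lintegral_cube_le hd
  refine ⟨C', hC', ?_⟩
  intro ℓ h N hh hN hsupp hconst
  refine (hF.lintegral_sphOp_le_slices hh).trans ?_
  rw [wmass, ← lintegral_const_mul' _ _ ENNReal.ofReal_ne_top]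
  refine lintegral_mono fun r => ?_
  simp only
  rw [mul_left_comm]
  refine mul_le_mul_right ?_ _
  rcases lt_or_ge r (2 ^ ℓ) with hr | hr
  · have : ∀ y, h y r = 0 := fun y => by
      by_contra h0
      exact absurd (hsupp y r h0) (not_le.2 hr)
    simp [sphConv, this]
  set b : (Fin d → ℤ) → Euc d → ℂ := fun z => (dyadicCube (ℓ : ℤ) z).indicator fun y => h y r
    with hb
  have hbm : ∀ z, Measurable (b z) := fun z =>
    (hh.measurable_slice r).indicator (measurableSet_dyadicCube _ _)
  have hpt : ∀ x, ‖sphConv F h r x‖ₑ ≤ ∑' z, ‖∫ y, b z y * F r (x - y)‖ₑ := by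
    intro x
    have e1 : sphConv F h r x = ∑' z, ∫ y, b z y * F r (x - y) := by
      have e2 := integral_iUnion (μ := volume) (f := fun y => h y r * F r (x - y))
        (fun z => measurableSet_dyadicCube (d := d) (ℓ : ℤ) z)
        (pairwise_disjoint_dyadicCube (ℓ : ℤ)) (hF.integrable_integrand hh r x).integrableOn
      rw [iUnion_dyadicCube, Measure.restrict_univ] at e2
      rw [sphConv, e2]
      refine tsum_congr fun z => ?_
      rw [← integral_indicator (measurableSet_dyadicCube _ _)]
      congr 1 with y
      by_cases hy : y ∈ dyadicCube (ℓ : ℤ) z <;> simp [hb, hy]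
    rw [e1]
    exact enorm_tsum_le_tsum_enorm
  calc ∫⁻ x, ‖sphConv F h r x‖ₑ ≤ ∫⁻ x, ∑' z, ‖∫ y, b z y * F r (x - y)‖ₑ := lintegral_mono hpt
    _ = ∑' z, ∫⁻ x, ‖∫ y, b z y * F r (x - y)‖ₑ := by
        refine lintegral_tsum fun z => Measurable.aemeasurable (Measurable.enorm ?_)
        have : Measurable fun q : Euc d × Euc d => b z q.2 * F r (q.1 - q.2) :=
          ((hbm z).comp measurable_snd).mul (hF.cont.measurable.comp
            (by fun_prop : Measurable fun q : Euc d × Euc d => (r, q.1 - q.2)))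
        exact this.stronglyMeasurable.integral_prod_right'.measurable
    _ ≤ ∑' z, ENNReal.ofReal (C' * (2 : ℝ) ^ (-(ℓ * (((d : ℝ) - 1) / 2)))) *
          ∫⁻ y in dyadicCube (ℓ : ℤ) z, N y r := by
        refine ENNReal.tsum_le_tsum fun z => ?_
        rcases (dyadicCube (d := d) (ℓ : ℤ) z).eq_empty_or_nonempty with he | ⟨y0, hy0⟩
        · simp [hb, he]
        rw [setLIntegral_congr_fun (measurableSet_dyadicCube _ _) (g := fun _ => N y0 r)
          (fun y hy => hconst z y hy y0 hy0 r), setLIntegral_const]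
        refine hcube ℓ z (b z) (N y0 r) r (hbm z) ?_ ?_ ?_ hr
        · obtain ⟨B, hB⟩ := hh.bdd
          exact ⟨B, fun y => (norm_indicator_le_norm_self _ _).trans (hB y r)⟩
        · exact fun y hy => Set.mem_of_indicator_ne_zero hy
        · intro y
          by_cases hy : y ∈ dyadicCube (ℓ : ℤ) z
          · simp only [hb]
            rw [Set.indicator_of_mem hy, hconst z y0 hy0 y hy r]
            exact hN y r
          · simp [hb, hy]
    _ = _ := by rw [ENNReal.tsum_mul_left, ← lintegral_eq_tsum_dyadicCube]

end

/-! ### Interpolation between the L¹ and the weak type bounds. -/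

lemma lintegral_Ioi_indicator_rpow_le {a b : ℝ} (ha : -1 < a) (hb : 0 ≤ b) :
    ∫⁻ t in Set.Ioi (0 : ℝ), {t : ℝ | t < b}.indicator (fun t => ENNReal.ofReal (t ^ a)) t ≤
      ENNReal.ofReal (b ^ (a + 1) / (a + 1)) := by
  rw [setLIntegral_indicator (measurableSet_lt (by fun_prop) (by fun_prop))]
  have h1 : {t : ℝ | t < b} ∩ Set.Ioi 0 ⊆ Set.Ioc 0 b := fun t ht => ⟨ht.2, le_of_lt ht.1⟩
  refine (lintegral_mono_set h1).trans (le_of_eq ?_)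
  have hint := intervalIntegral.intervalIntegrable_rpow' (a := 0) (b := b) ha
  rw [intervalIntegrable_iff_integrableOn_Ioc_of_le hb] at hint
  rw [← ofReal_integral_eq_lintegral_ofReal hint
    ((ae_restrict_iff' measurableSet_Ioc).2 (Filter.Eventually.of_forall fun t ht =>
      Real.rpow_nonneg ht.1.le _)), ← intervalIntegral.integral_of_le hb,
    integral_rpow (Or.inl ha), Real.zero_rpow (by linarith), sub_zero]

lemma lintegral_Ioi_indicator_rpow_le' {a b : ℝ} (ha : a < -1) (hb : 0 < b) :
    ∫⁻ t in Set.Ioi (0 : ℝ), {t : ℝ | b ≤ t}.indicator (fun t => ENNReal.ofReal (t ^ a)) t ≤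
      ENNReal.ofReal (b ^ (a + 1) / (-(a + 1))) := by
  rw [setLIntegral_indicator (measurableSet_le (by fun_prop) (by fun_prop))]
  have h1 : {t : ℝ | b ≤ t} ∩ Set.Ioi 0 ⊆ Set.Ici b := fun t ht => ht.1
  refine (lintegral_mono_set h1).trans (le_of_eq ?_)
  rw [setLIntegral_congr Ioi_ae_eq_Ici.symm, ← ofReal_integral_eq_lintegral_ofReal
    (integrableOn_Ioi_rpow_of_lt ha hb) ((ae_restrict_iff' measurableSet_Ioi).2
      (Filter.Eventually.of_forall fun t ht => Real.rpow_nonneg (hb.le.trans (le_of_lt ht)) _)),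
    integral_Ioi_rpow_of_lt ha hb]
  congr 1
  rw [div_neg, neg_div]

/-- Integration in the level `t` of a cut-off mass. -/
lemma lintegral_lintegral_indicator_le {X : Type*} [MeasurableSpace X] {μ : Measure X} [SFinite μ]
    {m w : X → ℝ≥0∞} (hm : Measurable m) {S : Set (X × ℝ)} (hS : MeasurableSet S) {e : ℝ}
    (hle : ∀ q, m q * ∫⁻ t in Set.Ioi (0 : ℝ),
      {t | (q, t) ∈ S}.indicator (fun t => ENNReal.ofReal (t ^ e)) t ≤ w q) :
    ∫⁻ t in Set.Ioi (0 : ℝ), ENNReal.ofReal (t ^ e) * ∫⁻ q, {q | (q, t) ∈ S}.indicator m q ∂μ ≤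
      ∫⁻ q, w q ∂μ := by
  set f : X × ℝ → ℝ≥0∞ := S.indicator fun p => m p.1 * ENNReal.ofReal (p.2 ^ e) with hf
  have hfm : Measurable f := ((hm.comp measurable_fst).mul (by fun_prop)).indicator hS
  calc _ = ∫⁻ t in Set.Ioi (0 : ℝ), ∫⁻ q, f (q, t) ∂μ := by
        refine lintegral_congr fun t => ?_
        rw [← lintegral_const_mul' _ _ ENNReal.ofReal_ne_top]
        refine lintegral_congr fun q => ?_
        by_cases hq : (q, t) ∈ S <;> simp [hf, hq, mul_comm]
    _ = ∫⁻ q, (∫⁻ t in Set.Ioi (0 : ℝ), f (q, t)) ∂μ :=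
        lintegral_lintegral_swap (f := fun t q => f (q, t)) (hfm.comp measurable_swap).aemeasurable
    _ ≤ _ := by
        refine lintegral_mono fun q => le_trans (le_of_eq ?_) (hle q)
        rw [← lintegral_const_mul]
        · refine lintegral_congr fun t => ?_
          by_cases hq : (q, t) ∈ S <;> simp [hf, hq]
        · exact Measurable.indicator (by fun_prop) (measurable_prodMk_left hS)

lemma measurable_lintegral_indicator {X : Type*} [MeasurableSpace X] {μ : Measure X} [SFinite μ]
    {m : X → ℝ≥0∞} (hm : Measurable m) {S : Set (X × ℝ)} (hS : MeasurableSet S) :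
    Measurable fun t : ℝ => ∫⁻ q, {q | (q, t) ∈ S}.indicator m q ∂μ := by
  have : Measurable fun p : X × ℝ => S.indicator (fun p => m p.1) p :=
    (hm.comp measurable_fst).indicator hS
  exact this.lintegral_prod_left'

section

variable {d : ℕ} {F : ℝ → Euc d → ℂ} {C : ℝ} {h : Euc d → ℝ → ℂ}

/-- Strong type bound obtained by interpolation. -/
lemma IsSphericalKernel.exists_lintegral_sphOp_rpow_le (hd : 4 ≤ d) (hF : IsSphericalKernel F C)
    {δ p q : ℝ} (hδ0 : 0 < δ) (hδ : 0 < ((d : ℝ) - 1) / 2 - 1 - δ) (hp : 1 < p) (hpq : p < q)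
    (hqa : q * (1 + (((d : ℝ) - 1) / 2 - δ)⁻¹) < 2) :
    ∃ C' : ℝ, 0 < C' ∧ ∀ (ℓ : ℕ) (h : Euc d → ℝ → ℂ) (c₀ : ℝ) (m : Euc d → ℝ → ℝ), IsTest h →
      0 < c₀ → (∀ y r, h y r ≠ 0 → c₀ ≤ ‖h y r‖) → (∀ y r, h y r ≠ 0 → (2 : ℝ) ^ ℓ ≤ r) →
      (Measurable fun q : Euc d × ℝ => m q.1 q.2) → (∀ y r, ‖h y r‖ ≤ m y r) →
      (∀ z, ∀ y ∈ dyadicCube (ℓ : ℤ) z, ∀ y' ∈ dyadicCube (ℓ : ℤ) z, ∀ r, m y r = m y' r) →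
      ∫⁻ x, ‖sphOp F h x‖ₑ ^ p ≤
        ENNReal.ofReal (C' * (2 : ℝ) ^ (-(ℓ * (((d : ℝ) - 1) / 2 * ((q - p) / (q - 1)))))) *
          wmass fun y r => ENNReal.ofReal (m y r ^ p) := by
  obtain ⟨C₁, hC₁, hL1⟩ := hF.exists_lintegral_sphOp_le (by omega)
  obtain ⟨C₂, hC₂, hweak⟩ := hF.exists_weak_le hd hδ0 hδ (by linarith : 1 ≤ q) hqa
  have hp0 : 0 < p := by linarith
  have hq0 : 0 < q := by linarith
  have hp1 : 0 < p - 1 := by linarith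
  have hqp : 0 < q - p := by linarith
  have hq1 : 0 < q - 1 := by linarith
  refine ⟨p * (2 * C₁ / (p - 1) + C₂ * 2 ^ q / (q - p)), by positivity, ?_⟩
  intro ℓ h c₀ m hh hc₀ hlow hsupp hm hle hconst
  have hm0 : ∀ y r, 0 ≤ m y r := fun y r => (norm_nonneg _).trans (hle y r)
  set γ : ℝ := (2 : ℝ) ^ (-(ℓ * (((d : ℝ) - 1) / 2))) with hγ
  have hγ0 : 0 < γ := by positivity
  -- With the cut at m = A t the two contributions carry γ A^{1-p} and A^{q-p}; this choice makes
  -- them equal, and their common value is the asserted gain.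
  set A : ℝ := γ ^ (1 / (q - 1)) with hA
  have hA0 : 0 < A := by positivity
  have hAγ : A ^ (q - 1) = γ := by
    rw [hA, ← Real.rpow_mul hγ0.le, one_div, inv_mul_cancel₀ hq1.ne', Real.rpow_one]
  have hAqp : (2 : ℝ) ^ (-(ℓ * (((d : ℝ) - 1) / 2 * ((q - p) / (q - 1))))) = A ^ (q - p) := by
    rw [hA, hγ, ← Real.rpow_mul hγ0.le, ← Real.rpow_mul zero_le_two]
    congr 1; field_simp
  rw [hAqp]
  set W : Euc d × ℝ → ℝ≥0∞ := fun x => ENNReal.ofReal (x.2 ^ (d - 1)) with hW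
  have hWm : Measurable W := by fun_prop
  -- The cut is made on the majorant `m` and not on |h|, so that the majorant of the upper part is
  -- still constant on the cubes and the L¹ gain applies to it.
  set hi : Set ((Euc d × ℝ) × ℝ) := {x | A * x.2 < m x.1.1 x.1.2} with hhi
  have hmm : Measurable fun x : (Euc d × ℝ) × ℝ => m x.1.1 x.1.2 := hm.comp measurable_fst
  have hhim : MeasurableSet hi := measurableSet_lt (by fun_prop) hmm
  set m₁ : Euc d × ℝ → ℝ≥0∞ := fun x => W x * ENNReal.ofReal (m x.1 x.2) with hm₁
  set m₂ : Euc d × ℝ → ℝ≥0∞ := fun x => W x * ENNReal.ofReal (m x.1 x.2 ^ q) with hm₂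
  have hm₁m : Measurable m₁ := hWm.mul hm.ennreal_ofReal
  have hm₂m : Measurable m₂ := hWm.mul (hm.pow_const q).ennreal_ofReal
  set I₁ : ℝ → ℝ≥0∞ := fun t => ∫⁻ x, {x | (x, t) ∈ hi}.indicator m₁ x with hI₁
  set I₂ : ℝ → ℝ≥0∞ := fun t => ∫⁻ x, {x | (x, t) ∈ hiᶜ}.indicator m₂ x with hI₂
  have hI₁m : Measurable I₁ := measurable_lintegral_indicator hm₁m hhim
  have hlevel : ∀ t : ℝ, 0 < t → volume {x | t < ‖sphOp F h x‖} ≤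
      ENNReal.ofReal (2 * C₁ * γ * t⁻¹) * I₁ t + ENNReal.ofReal (C₂ * 2 ^ q * t ^ (-q)) * I₂ t := by
    intro t ht
    set T : Set (Euc d × ℝ) := {x | (x, t) ∈ hi} with hT
    have hTm : MeasurableSet T := measurable_prodMk_right hhim
    set h₁ : Euc d → ℝ → ℂ := fun y r => T.indicator (fun p => h p.1 p.2) (y, r) with hh₁
    set h₂ : Euc d → ℝ → ℂ := fun y r => Tᶜ.indicator (fun p => h p.1 p.2) (y, r) with hh₂
    have ht₁ : IsTest h₁ := hh.indicator hTm
    have ht₂ : IsTest h₂ := hh.indicator hTm.compl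
    have hsum : h = fun y r => h₁ y r + h₂ y r := by
      funext y r
      exact (congrFun (Set.indicator_self_add_compl T fun q => h q.1 q.2) (y, r)).symm
    have hne₁ : ∀ y r, h₁ y r ≠ 0 → h y r ≠ 0 := fun y r hne h0 => hne (by
      simp [hh₁, Set.indicator, h0])
    have b₁ : volume {x | ENNReal.ofReal (t / 2) < ‖sphOp F h₁ x‖ₑ} ≤
        ENNReal.ofReal (2 * C₁ * γ * t⁻¹) * I₁ t := by
      have e1 := measure_lt_enorm_le (μ := volume) (hF.measurable_sphOp ht₁)
        (by positivity : 0 < t / 2) 1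
      simp only [pow_one] at e1
      have e2 := hL1 ℓ h₁ (fun y r => T.indicator (fun x => ENNReal.ofReal (m x.1 x.2)) (y, r)) ht₁
        (fun y r => by
          by_cases hx : (y, r) ∈ T
          · simp only [hh₁, Set.indicator_of_mem hx, ← ofReal_norm]
            exact ENNReal.ofReal_le_ofReal (hle y r)
          · simp [hh₁, hx])
        (fun y r hne => hsupp y r (hne₁ y r hne))
        (fun z y hy y' hy' r => by
          have e3 := hconst z y hy y' hy' r
          simp only [Set.indicator, hT, hhi, Set.mem_ofPred_eq, e3])
      rw [← hγ] at e2
      refine e1.trans ((mul_le_mul_right e2 _).trans (le_of_eq ?_))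
      have e4 : (wmass fun (y : Euc d) (r : ℝ) =>
          T.indicator (fun x => ENNReal.ofReal (m x.1 x.2)) (y, r)) = I₁ t := by
        rw [wmass_eq (hm.ennreal_ofReal.indicator hTm)]
        refine lintegral_congr fun x => ?_
        change _ = T.indicator m₁ x
        by_cases hx : x ∈ T <;> simp [hx, hm₁, hW]
      rw [e4, ← mul_assoc, ← ENNReal.ofReal_mul (by positivity)]
      congr 2
      field_simp
    have b₂ : volume {x | ENNReal.ofReal (t / 2) < ‖sphOp F h₂ x‖ₑ} ≤
        ENNReal.ofReal (C₂ * 2 ^ q * t ^ (-q)) * I₂ t := by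
      refine (hweak h₂ c₀ ht₂ hc₀ (fun y r hne => ?_) (t / 2) (by positivity)).trans ?_
      · have e1 : h₂ y r = h y r := Set.indicator_of_mem (Set.mem_of_indicator_ne_zero hne) _
        rw [e1] at hne ⊢
        exact hlow y r hne
      · refine mul_le_mul' (le_of_eq ?_) ?_
        · rw [Real.div_rpow ht.le zero_le_two, Real.rpow_neg zero_le_two, div_inv_eq_mul]
          congr 1; ring
        · rw [wmass_eq (ht₂.measurable_enorm.pow_const q)]
          refine lintegral_mono fun x => ?_
          by_cases hx : x ∈ T
          · simp [hh₂, hx, hq0]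
          · have hx' : x ∈ {x | (x, t) ∈ hiᶜ} := hx
            rw [Set.indicator_of_mem hx']
            simp only [hh₂, hm₂, hW, Set.indicator_of_mem (Set.mem_compl hx)]
            gcongr
            rw [← ofReal_norm, ENNReal.ofReal_rpow_of_nonneg (norm_nonneg _) hq0.le]
            exact ENNReal.ofReal_le_ofReal (Real.rpow_le_rpow (norm_nonneg _) (hle _ _) hq0.le)
    have hcov : {x | t < ‖sphOp F h x‖} ⊆ {x | ENNReal.ofReal (t / 2) < ‖sphOp F h₁ x‖ₑ} ∪
        {x | ENNReal.ofReal (t / 2) < ‖sphOp F h₂ x‖ₑ} := by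
      intro x hx
      by_contra hnot
      simp only [Set.mem_union, Set.mem_ofPred_eq, not_or, not_lt, ← ofReal_norm] at hnot hx
      rw [ENNReal.ofReal_le_ofReal_iff (by positivity),
        ENNReal.ofReal_le_ofReal_iff (by positivity)] at hnot
      rw [hsum, hF.sphOp_add ht₁ ht₂] at hx
      linarith [norm_add_le (sphOp F h₁ x) (sphOp F h₂ x)]
    exact (measure_mono hcov).trans ((measure_union_le _ _).trans (add_le_add b₁ b₂))
  have hwm : (wmass fun y r => ENNReal.ofReal (m y r ^ p)) =
      ∫⁻ x : Euc d × ℝ, W x * ENNReal.ofReal (m x.1 x.2 ^ p) :=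
    wmass_eq (hm.pow_const p).ennreal_ofReal
  have J₁ : ∫⁻ t in Set.Ioi (0 : ℝ), ENNReal.ofReal (t ^ (p - 2)) * I₁ t ≤
      ENNReal.ofReal (A ^ (1 - p) / (p - 1)) * wmass fun y r => ENNReal.ofReal (m y r ^ p) := by
    rw [hwm, ← lintegral_const_mul' _ _ ENNReal.ofReal_ne_top]
    refine lintegral_lintegral_indicator_le hm₁m hhim fun x => ?_
    have e1 : {t : ℝ | (x, t) ∈ hi} = {t : ℝ | t < m x.1 x.2 / A} := by
      ext t
      simp only [hhi, Set.mem_ofPred_eq, lt_div_iff₀ hA0, mul_comm]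
    rw [e1]
    have hb : 0 ≤ m x.1 x.2 / A := div_nonneg (hm0 _ _) hA0.le
    refine (mul_le_mul_right (lintegral_Ioi_indicator_rpow_le (by linarith) hb) _).trans
      (le_of_eq ?_)
    simp only [hm₁]
    rw [mul_assoc, ← ENNReal.ofReal_mul (hm0 _ _), mul_left_comm,
      ← ENNReal.ofReal_mul (p := A ^ (1 - p) / (p - 1)) (by positivity)]
    congr 2
    rw [show p - 2 + 1 = p - 1 by ring, Real.div_rpow (hm0 _ _) hA0.le,
      show (1 - p) = -(p - 1) by ring, Real.rpow_neg hA0.le]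
    have e2 : m x.1 x.2 ^ p = m x.1 x.2 * m x.1 x.2 ^ (p - 1) := by
      rw [← Real.rpow_one_add' (hm0 _ _) (by linarith)]; congr 1; ring
    rw [e2]; ring
  have J₂ : ∫⁻ t in Set.Ioi (0 : ℝ), ENNReal.ofReal (t ^ (p - 1 - q)) * I₂ t ≤
      ENNReal.ofReal (A ^ (q - p) / (q - p)) * wmass fun y r => ENNReal.ofReal (m y r ^ p) := by
    rw [hwm, ← lintegral_const_mul' _ _ ENNReal.ofReal_ne_top]
    refine lintegral_lintegral_indicator_le hm₂m hhim.compl fun x => ?_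
    have e1 : {t : ℝ | (x, t) ∈ hiᶜ} = {t : ℝ | m x.1 x.2 / A ≤ t} := by
      ext t
      simp only [hhi, Set.mem_compl_iff, Set.mem_ofPred_eq, not_lt, div_le_iff₀ hA0, mul_comm]
    rw [e1]
    rcases (hm0 x.1 x.2).eq_or_lt with h0 | hpos
    · simp [hm₂, ← h0, Real.zero_rpow hq0.ne']
    have hb : 0 < m x.1 x.2 / A := div_pos hpos hA0
    refine (mul_le_mul_right (lintegral_Ioi_indicator_rpow_le' (by linarith) hb) _).trans
      (le_of_eq ?_)
    simp only [hm₂]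
    rw [mul_assoc, ← ENNReal.ofReal_mul (Real.rpow_nonneg (hm0 _ _) _), mul_left_comm,
      ← ENNReal.ofReal_mul (p := A ^ (q - p) / (q - p)) (by positivity)]
    congr 2
    rw [show p - 1 - q + 1 = p - q by ring, Real.div_rpow (hm0 _ _) hA0.le,
      show -(p - q) = q - p by ring, show (q - p) = -(p - q) by ring, Real.rpow_neg hA0.le]
    have e2 : m x.1 x.2 ^ p = m x.1 x.2 ^ q * m x.1 x.2 ^ (p - q) := by
      rw [← Real.rpow_add hpos]; congr 1; ring
    rw [e2]; ring
  have hγA : γ * A ^ (1 - p) = A ^ (q - p) := by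
    rw [← hAγ, ← Real.rpow_add hA0]; congr 1; ring
  set Mp := wmass fun y r => ENNReal.ofReal (m y r ^ p) with hMp
  calc ∫⁻ x, ‖sphOp F h x‖ₑ ^ p = ∫⁻ x, ENNReal.ofReal (‖sphOp F h x‖ ^ p) := by
        refine lintegral_congr fun x => ?_
        rw [← ofReal_norm, ENNReal.ofReal_rpow_of_nonneg (norm_nonneg _) hp0.le]
    _ = ENNReal.ofReal p * ∫⁻ t in Set.Ioi 0, volume {x | t < ‖sphOp F h x‖} *
          ENNReal.ofReal (t ^ (p - 1)) :=
        lintegral_rpow_eq_lintegral_meas_lt_mul volume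
          (Filter.Eventually.of_forall fun x => norm_nonneg _)
          (hF.measurable_sphOp hh).norm.aemeasurable hp0
    _ ≤ ENNReal.ofReal p * ∫⁻ t in Set.Ioi (0 : ℝ), (ENNReal.ofReal (2 * C₁ * γ) *
          (ENNReal.ofReal (t ^ (p - 2)) * I₁ t) + ENNReal.ofReal (C₂ * 2 ^ q) *
          (ENNReal.ofReal (t ^ (p - 1 - q)) * I₂ t)) := by
        refine mul_le_mul_right (setLIntegral_mono' measurableSet_Ioi fun t ht => ?_) _
        have ht' : 0 < t := ht
        refine (mul_le_mul_left (hlevel t ht') _).trans (le_of_eq ?_)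
        have e1 : t ^ (p - 2) = t⁻¹ * t ^ (p - 1) := by
          rw [← Real.rpow_neg_one, ← Real.rpow_add ht']; congr 1; ring
        have e2 : t ^ (p - 1 - q) = t ^ (-q) * t ^ (p - 1) := by
          rw [← Real.rpow_add ht']; congr 1; ring
        rw [e1, e2, add_mul]
        simp only [ENNReal.ofReal_mul (by positivity : 0 ≤ 2 * C₁ * γ),
          ENNReal.ofReal_mul (by positivity : 0 ≤ t⁻¹),
          ENNReal.ofReal_mul (by positivity : 0 ≤ C₂ * 2 ^ q),
          ENNReal.ofReal_mul (by positivity : 0 ≤ t ^ (-q))]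
        ring
    _ = ENNReal.ofReal p * (ENNReal.ofReal (2 * C₁ * γ) *
          (∫⁻ t in Set.Ioi (0 : ℝ), ENNReal.ofReal (t ^ (p - 2)) * I₁ t) +
          ENNReal.ofReal (C₂ * 2 ^ q) *
          ∫⁻ t in Set.Ioi (0 : ℝ), ENNReal.ofReal (t ^ (p - 1 - q)) * I₂ t) := by
        rw [lintegral_add_left (by exact Measurable.const_mul (Measurable.mul (by fun_prop) hI₁m) _),
          lintegral_const_mul' _ _ ENNReal.ofReal_ne_top,
          lintegral_const_mul' _ _ ENNReal.ofReal_ne_top]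
    _ ≤ ENNReal.ofReal p * (ENNReal.ofReal (2 * C₁ * γ) *
          (ENNReal.ofReal (A ^ (1 - p) / (p - 1)) * Mp) +
          ENNReal.ofReal (C₂ * 2 ^ q) * (ENNReal.ofReal (A ^ (q - p) / (q - p)) * Mp)) := by
        gcongr
    _ = _ := by
        rw [← mul_assoc, ← mul_assoc, ← add_mul, ← ENNReal.ofReal_mul (by positivity),
          ← ENNReal.ofReal_mul (by positivity),
          ← ENNReal.ofReal_add (by positivity) (by positivity), ← mul_assoc,
          ← ENNReal.ofReal_mul (by positivity), ← hγA]
        congr 2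
        ring

end

/-! ### Convolution with a radial kernel as a superposition of spheres. -/

section

variable {d : ℕ} {C : ℝ}

lemma conv_eq_integral_left {f g : Euc d → ℂ} (x : Euc d) :
    conv f g x = ∫ y, f (x - y) * g y := by
  rw [conv_apply, ← integral_sub_left_eq_self _ volume x]
  simp only [sub_sub_cancel]

lemma conv_conv_eq {ψ K g : Euc d → ℂ} (hψ : Measurable ψ) (hK : Measurable K)
    (hg : Measurable g) {A R : ℝ} (hψA : ∀ x, ‖ψ x‖ ≤ A) (hKA : ∀ x, ‖K x‖ ≤ A)
    (hgA : ∀ x, ‖g x‖ ≤ A) (hψR : ∀ x, ψ x ≠ 0 → ‖x‖ ≤ R) (hgR : ∀ x, g x ≠ 0 → ‖x‖ ≤ R)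
    (x : Euc d) :
    conv ψ (conv K g) x = ∫ y, g y * ∫ z, K z * ψ (x - y - z) := by
  have hA : 0 ≤ A := (norm_nonneg _).trans (hψA 0)
  have hint : Integrable (Function.uncurry fun t y : Euc d => ψ t * (K (x - t - y) * g y)) := by
    have hm : Measurable (Function.uncurry fun t y : Euc d => ψ t * (K (x - t - y) * g y)) :=
      (hψ.comp measurable_fst).mul ((hK.comp (by fun_prop :
        Measurable fun q : Euc d × Euc d => x - q.1 - q.2)).mul (hg.comp measurable_snd))
    refine integrable_of_bounded_support hm.aestronglyMeasurable (B := A * (A * A))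
      (s := Metric.closedBall 0 R ×ˢ Metric.closedBall 0 R) (fun q => ?_) ?_ fun q hq => ?_
    · simp only [Function.uncurry, norm_mul]
      gcongr
      exacts [hψA _, hKA _, hgA _]
    · rw [Measure.volume_eq_prod, Measure.prod_prod]
      exact ENNReal.mul_ne_top measure_closedBall_lt_top.ne measure_closedBall_lt_top.ne
    · simp only [Function.uncurry] at hq
      exact ⟨mem_closedBall_zero_iff.2 (hψR _ (left_ne_zero_of_mul hq)),
        mem_closedBall_zero_iff.2 (hgR _ (right_ne_zero_of_mul (right_ne_zero_of_mul hq)))⟩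
  calc conv ψ (conv K g) x = ∫ t, ∫ y, ψ t * (K (x - t - y) * g y) := by
        rw [conv_apply]
        simp only [conv_eq_integral_left, integral_const_mul]
    _ = ∫ y, ∫ t, ψ t * (K (x - t - y) * g y) := integral_integral_swap hint
    _ = _ := by
        congr 1 with y
        rw [← integral_const_mul, ← integral_sub_left_eq_self _ volume (x - y)]
        congr 1 with z
        rw [show x - (x - y - z) - y = z by abel]
        ring

/-- A convolution with a radial kernel as a superposition of spherical averages. -/
lemma conv_conv_eq_sphOp (hd : 0 < d) {ψ : Euc d → ℂ} (hψ : Continuous ψ)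
    (hF : IsSphericalKernel (fun r => sphAvg ψ r) C) {κ : ℝ → ℂ} {g : Euc d → ℂ}
    (hκ : Measurable κ) (hg : Measurable g) {A R : ℝ} (hR : 0 ≤ R) (hψA : ∀ x, ‖ψ x‖ ≤ A)
    (hκA : ∀ r, ‖κ r‖ ≤ A) (hgA : ∀ x, ‖g x‖ ≤ A) (hψR : ∀ x, ψ x ≠ 0 → ‖x‖ ≤ R)
    (hκR : ∀ r, κ r ≠ 0 → 1 ≤ r ∧ r ≤ R) (hgR : ∀ x, g x ≠ 0 → ‖x‖ ≤ R) (x : Euc d) :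
    conv ψ (conv (fun z => κ ‖z‖) g) x =
      sphOp (fun r => sphAvg ψ r) (fun y r => g y * κ r) x := by
  have hA : 0 ≤ A := (norm_nonneg _).trans (hψA 0)
  have hC := hF.pos
  have hKm : Measurable fun z : Euc d => κ ‖z‖ := hκ.comp measurable_norm
  rw [conv_conv_eq hψ.measurable hKm hg hψA (fun z => hκA _) hgA hψR hgR]
  have hpol : ∀ w : Euc d, ∫ z, κ ‖z‖ * ψ (w - z) =
      ∫ r, ((r ^ (d - 1) : ℝ) : ℂ) * (κ r * sphAvg ψ r w) := by
    intro w
    have hint : Integrable fun z : Euc d => κ ‖z‖ * ψ (w - z) := by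
      refine integrable_of_bounded_support (hKm.mul (hψ.measurable.comp
        (by fun_prop))).aestronglyMeasurable (B := A * A) (s := Metric.closedBall 0 R)
        (fun q => ?_) measure_closedBall_lt_top.ne fun q hq => ?_
      · rw [norm_mul]
        gcongr
        exacts [hκA _, hψA _]
      · exact mem_closedBall_zero_iff.2 (hκR _ (left_ne_zero_of_mul hq)).2
    have hfull := setIntegral_eq_integral_of_forall_compl_eq_zero (μ := volume)
      (f := fun r => ((r ^ (d - 1) : ℝ) : ℂ) * (κ r * sphAvg ψ r w)) (s := Set.Ioi (0 : ℝ))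
      fun r hr => by
        have : κ r = 0 := by
          by_contra h0
          exact hr (lt_of_lt_of_le one_pos (hκR r h0).1)
        simp [this]
    rw [integral_polar hd hint, ← hfull]
    refine setIntegral_congr_fun measurableSet_Ioi fun r hr => ?_
    have hr' : (0 : ℝ) < r := hr
    simp only [sphAvg, norm_smul, norm_eq_of_mem_sphere, mul_one, Real.norm_of_nonneg hr'.le,
      integral_const_mul]
  simp only [hpol]
  have hint : Integrable (Function.uncurry fun (y : Euc d) (r : ℝ) =>
      g y * (((r ^ (d - 1) : ℝ) : ℂ) * (κ r * sphAvg ψ r (x - y)))) := by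
    have hm : Measurable (Function.uncurry fun (y : Euc d) (r : ℝ) =>
        g y * (((r ^ (d - 1) : ℝ) : ℂ) * (κ r * sphAvg ψ r (x - y)))) :=
      (hg.comp measurable_fst).mul (Measurable.mul (by fun_prop) ((hκ.comp measurable_snd).mul
        (hF.cont.measurable.comp
          (by fun_prop : Measurable fun q : Euc d × ℝ => (q.2, x - q.1)))))
    refine integrable_of_bounded_support hm.aestronglyMeasurable
      (B := A * (R ^ (d - 1) * (A * C))) (s := Metric.closedBall 0 R ×ˢ Set.Icc 1 R)
      (fun q => ?_) ?_ fun q hq => ?_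
    · by_cases h0 : κ q.2 = 0
      · simp [Function.uncurry, h0]; positivity
      · have hr := hκR _ h0
        have hr0 : 0 ≤ q.2 := by linarith
        simp only [Function.uncurry, norm_mul, Complex.norm_real, Real.norm_eq_abs, abs_pow,
          abs_of_nonneg hr0]
        gcongr
        exacts [hgA _, hr.2, hκA _, hF.bound _ _]
    · rw [Measure.volume_eq_prod, Measure.prod_prod]
      exact ENNReal.mul_ne_top measure_closedBall_lt_top.ne (by simp)
    · simp only [Function.uncurry] at hq
      have h1 := right_ne_zero_of_mul (right_ne_zero_of_mul hq)
      exact ⟨mem_closedBall_zero_iff.2 (hgR _ (left_ne_zero_of_mul hq)),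
        hκR _ (left_ne_zero_of_mul h1)⟩
  calc ∫ y, g y * ∫ r, ((r ^ (d - 1) : ℝ) : ℂ) * (κ r * sphAvg ψ r (x - y))
      = ∫ y, ∫ r, g y * (((r ^ (d - 1) : ℝ) : ℂ) * (κ r * sphAvg ψ r (x - y))) := by
        simp only [integral_const_mul]
    _ = ∫ r, ∫ y, g y * (((r ^ (d - 1) : ℝ) : ℂ) * (κ r * sphAvg ψ r (x - y))) :=
        integral_integral_swap hint
    _ = _ := by
        unfold sphOp sphConv
        congr 1 with r
        rw [← integral_const_mul]
        congr 1 with y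
        ring

/-- A radial measurable function has a measurable profile. -/
lemma exists_measurable_profile (hd : 0 < d) {K : Euc d → ℂ} (hK : AEStronglyMeasurable K volume)
    (hrad : IsRadial K) {ρ : ℝ} (hsupp : Function.support K ⊆ {x | ρ < ‖x‖}) :
    ∃ κ : ℝ → ℂ, Measurable κ ∧ (∀ r, κ r ≠ 0 → ρ < r) ∧ K =ᵐ[volume] fun x => κ ‖x‖ := by
  obtain ⟨K', hK'm, hKK'⟩ := hK
  have hK'm := hK'm.measurable
  have hS0 : sphereMeasure d Set.univ ≠ 0 := by
    have : Nonempty (Fin d) := ⟨⟨0, hd⟩⟩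
    rw [Measure.toSphere_apply_univ, finrank_euclideanSpace_fin]
    exact mul_ne_zero (by exact_mod_cast hd.ne') (Metric.measure_ball_pos _ _ one_pos).ne'
  set S := (sphereMeasure d).real Set.univ with hS
  have hS1 : (S : ℂ) ≠ 0 := by
    rw [hS, Measure.real, Complex.ofReal_ne_zero, ENNReal.toReal_ne_zero]
    exact ⟨hS0, measure_ne_top _ _⟩
  have hJ : Measurable fun q : ℝ × Sph d => K' (q.1 • (q.2 : Euc d)) :=
    hK'm.comp (by fun_prop)
  -- The spherical means of a Borel representative of `K`. On almost every sphere that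
  -- representative agrees almost everywhere with `K`, which is constant there, so the mean is the
  -- value of `K`.
  set κ : ℝ → ℂ := (Set.Ioi ρ).indicator fun r =>
    (S : ℂ)⁻¹ * ∫ θ : Sph d, K' (r • (θ : Euc d)) ∂sphereMeasure d with hκ
  have hκm : Measurable κ := by
    refine Measurable.indicator (Measurable.const_mul ?_ _) measurableSet_Ioi
    exact hJ.stronglyMeasurable.integral_prod_right'.measurable
  refine ⟨κ, hκm, fun r hr => Set.mem_of_indicator_ne_zero hr, ?_⟩
  refine hKK'.trans ?_
  obtain ⟨N, hN, hNm, hN0⟩ := exists_measurable_superset_of_null (ae_iff.1 hKK')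
  have hpolar := lintegral_polar hd (f := N.indicator 1) (measurable_one.indicator hNm)
  rw [lintegral_indicator_one hNm, hN0] at hpolar
  have hNJ : Measurable fun q : ℝ × Sph d => N.indicator (1 : Euc d → ℝ≥0∞) (q.1 • (q.2 : Euc d)) :=
    (measurable_one.indicator hNm).comp (by fun_prop)
  have hzero := (lintegral_eq_zero_iff (Measurable.mul (by fun_prop)
    hNJ.lintegral_prod_right')).1 hpolar.symm
  have hslice : ∀ᵐ r ∂(volume.restrict (Set.Ioi (0 : ℝ))),
      ∀ᵐ θ : Sph d ∂(sphereMeasure d), K (r • (θ : Euc d)) = K' (r • (θ : Euc d)) := by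
    filter_upwards [hzero, ae_restrict_mem measurableSet_Ioi] with r hr hr0
    have hr0' : (0 : ℝ) < r := hr0
    have hr1 : ENNReal.ofReal (r ^ (d - 1)) *
        ∫⁻ θ : Sph d, N.indicator (1 : Euc d → ℝ≥0∞) (r • (θ : Euc d)) ∂sphereMeasure d = 0 := hr
    have hr2 := (mul_eq_zero.1 hr1).resolve_left (by simpa using pow_pos hr0' (d - 1))
    have hr3 := (lintegral_eq_zero_iff (by exact hNJ.comp measurable_prodMk_left)).1 hr2
    filter_upwards [hr3] with θ hθ
    by_contra hne
    have : r • (θ : Euc d) ∈ N := hN hne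
    simp [this] at hθ
  have hdiff := lintegral_polar hd (f := fun x => ‖K' x - κ ‖x‖‖ₑ)
    ((hK'm.sub (hκm.comp measurable_norm)).enorm)
  have hdiff0 : ∫⁻ x, ‖K' x - κ ‖x‖‖ₑ = 0 := by
    rw [hdiff]
    rw [lintegral_eq_zero_iff]
    · filter_upwards [hslice, ae_restrict_mem measurableSet_Ioi] with r hr hr0
      have hr0' : (0 : ℝ) < r := hr0
      obtain ⟨θ₀⟩ : Nonempty (Sph d) := by
        by_contra hne
        rw [not_nonempty_iff] at hne
        exact hS0 (by simp [Set.eq_empty_of_isEmpty])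
      have hKc : ∀ θ : Sph d, K (r • (θ : Euc d)) = K (r • (θ₀ : Euc d)) := fun θ =>
        hrad _ _ (by simp [norm_smul])
      have hval : κ r = K (r • (θ₀ : Euc d)) := by
        have e1 : ∫ θ : Sph d, K' (r • (θ : Euc d)) ∂sphereMeasure d =
            S * K (r • (θ₀ : Euc d)) := by
          rw [← integral_congr_ae hr]
          simp only [hKc, integral_const]
          rw [hS, Complex.real_smul]
        by_cases hrρ : ρ < r
        · have e2 : κ r = _ := Set.indicator_of_mem (show r ∈ Set.Ioi ρ from hrρ) _
          rw [e2, e1, inv_mul_cancel_left₀ hS1]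
        · have e2 : κ r = 0 := Set.indicator_of_notMem (show r ∉ Set.Ioi ρ from hrρ) _
          rw [e2]
          by_contra hne
          have := hsupp (fun h0 => hne h0.symm : K (r • (θ₀ : Euc d)) ≠ 0)
          simp only [Set.mem_ofPred_eq, norm_smul, norm_eq_of_mem_sphere, mul_one,
            Real.norm_of_nonneg hr0'.le] at this
          exact hrρ this
      simp only [Pi.zero_apply, mul_eq_zero]
      right
      rw [← lintegral_zero (μ := sphereMeasure d)]
      refine lintegral_congr_ae ?_
      filter_upwards [hr] with θ hθ
      rw [← hθ, hKc, norm_smul, norm_eq_of_mem_sphere, mul_one, Real.norm_of_nonneg hr0'.le, hval]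
      simp
    · have : Measurable fun q : ℝ × Sph d => ‖K' (q.1 • (q.2 : Euc d)) - κ ‖q.1 • (q.2 : Euc d)‖‖ₑ :=
        (hJ.sub (hκm.comp (by fun_prop))).enorm
      exact Measurable.mul (by fun_prop) this.lintegral_prod_right'
  have hdiff1 := (lintegral_eq_zero_iff
    (by exact (hK'm.sub (hκm.comp measurable_norm)).enorm)).1 hdiff0
  filter_upwards [hdiff1] with x hx
  exact sub_eq_zero.1 (by simpa using hx)

end

/-! ### Truncation, absolute convergence and passage to the limit. -/

/-- Truncation in the variable and in the value. -/
noncomputable def trunc {X : Type*} [Norm X] (n : ℕ) (f : X → ℂ) (x : X) : ℂ :=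
  {x | ‖x‖ ≤ n + 1 ∧ 1 / ((n : ℝ) + 1) ≤ ‖f x‖ ∧ ‖f x‖ ≤ n + 1}.indicator f x

section trunc

variable {X : Type*} [NormedAddCommGroup X] {f : X → ℂ}

lemma measurable_trunc [MeasurableSpace X] [BorelSpace X] (hf : Measurable f) (n : ℕ) :
    Measurable (trunc n f) :=
  hf.indicator ((measurableSet_le measurable_norm measurable_const).inter
    ((measurableSet_le measurable_const hf.norm).inter (measurableSet_le hf.norm measurable_const)))

lemma norm_trunc_le (n : ℕ) (x : X) : ‖trunc n f x‖ ≤ ‖f x‖ := norm_indicator_le_norm_self _ _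

lemma trunc_ne_zero {n : ℕ} {x : X} (h : trunc n f x ≠ 0) : trunc n f x = f x ∧ ‖x‖ ≤ n + 1 ∧
    1 / ((n : ℝ) + 1) ≤ ‖f x‖ ∧ ‖f x‖ ≤ n + 1 := by
  have h1 := Set.mem_of_indicator_ne_zero h
  exact ⟨Set.indicator_of_mem h1 _, h1⟩

lemma norm_trunc_le_nat (n : ℕ) (x : X) : ‖trunc n f x‖ ≤ n + 1 := by
  by_cases h : trunc n f x = 0
  · rw [h, norm_zero]; positivity
  · rw [(trunc_ne_zero h).1]; exact (trunc_ne_zero h).2.2.2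

lemma tendsto_trunc (x : X) :
    Filter.Tendsto (fun n => trunc n f x) Filter.atTop (nhds (f x)) := by
  by_cases h0 : f x = 0
  · have : ∀ n, trunc n f x = 0 := fun n => by simp [trunc, Set.indicator, h0]
    simp [this, h0]
  refine tendsto_const_nhds.congr' ?_
  have hpos : 0 < ‖f x‖ := norm_pos_iff.2 h0
  filter_upwards [Filter.eventually_ge_atTop ⌈‖x‖⌉₊, Filter.eventually_ge_atTop ⌈‖f x‖⌉₊,
    Filter.eventually_ge_atTop ⌈1 / ‖f x‖⌉₊] with n h1 h2 h3
  have hmem : x ∈ {x | ‖x‖ ≤ n + 1 ∧ 1 / ((n : ℝ) + 1) ≤ ‖f x‖ ∧ ‖f x‖ ≤ n + 1} := by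
    refine ⟨?_, ?_, ?_⟩
    · linarith [Nat.ceil_le.1 h1]
    · rw [div_le_iff₀ (by positivity)]
      have := Nat.ceil_le.1 h3
      rw [div_le_iff₀ hpos] at this
      linarith
    · linarith [Nat.ceil_le.1 h2]
  exact (Set.indicator_of_mem hmem _).symm

end trunc

section

variable {d : ℕ} {C : ℝ}

/-- The mixed norm of the majorant `G ⊗ κ`. -/
lemma wmass_majorant (hd : 0 < d) {κ : ℝ → ℂ} (hκ : Measurable κ) (hκ0 : ∀ r, κ r ≠ 0 → 0 < r)
    {G : (Fin d → ℤ) → ℝ} (hG : ∀ z, 0 ≤ G z) {p : ℝ} (hp : 0 < p) (ν : ℤ) :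
    sphereMeasure d Set.univ * (wmass fun (y : Euc d) r =>
      ENNReal.ofReal ((G (cubeIndex ν y) * ‖κ r‖) ^ p)) =
    (∑' z, volume (dyadicCube (d := d) ν z) * ENNReal.ofReal (G z) ^ p) *
      ∫⁻ x : Euc d, ‖κ ‖x‖‖ₑ ^ p := by
  have h1 : ∀ r, ∫⁻ y : Euc d, ENNReal.ofReal ((G (cubeIndex ν y) * ‖κ r‖) ^ p) =
      (∑' z, volume (dyadicCube (d := d) ν z) * ENNReal.ofReal (G z) ^ p) * ‖κ r‖ₑ ^ p := by
    intro r
    rw [lintegral_eq_tsum_dyadicCube ν, ← ENNReal.tsum_mul_right]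
    refine tsum_congr fun z => ?_
    rw [setLIntegral_congr_fun (measurableSet_dyadicCube _ _)
      (g := fun _ => ENNReal.ofReal (G z) ^ p * ‖κ r‖ₑ ^ p), setLIntegral_const]
    · ring
    · intro y hy
      simp only
      rw [mem_dyadicCube_iff.1 hy, ← ENNReal.ofReal_rpow_of_nonneg (mul_nonneg (hG _)
        (norm_nonneg _)) hp.le, ENNReal.ofReal_mul (hG _), ofReal_norm,
        ENNReal.mul_rpow_of_nonneg _ _ hp.le]
  have hm : Measurable fun x : Euc d => ‖κ ‖x‖‖ₑ ^ p :=
    (hκ.comp measurable_norm).enorm.pow_const p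
  rw [lintegral_polar hd hm, wmass]
  have h2 : ∀ r ∈ Set.Ioi (0 : ℝ), ENNReal.ofReal (r ^ (d - 1)) *
      ∫⁻ θ : Sph d, ‖κ ‖r • (θ : Euc d)‖‖ₑ ^ p ∂sphereMeasure d =
      sphereMeasure d Set.univ * (ENNReal.ofReal (r ^ (d - 1)) * ‖κ r‖ₑ ^ p) := by
    intro r hr
    have hr' : (0 : ℝ) < r := hr
    simp only [norm_smul, norm_eq_of_mem_sphere, mul_one, Real.norm_of_nonneg hr'.le,
      lintegral_const]
    ring
  have hm2 : Measurable fun r : ℝ => ENNReal.ofReal (r ^ (d - 1)) * ‖κ r‖ₑ ^ p :=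
    Measurable.mul (by fun_prop) (hκ.enorm.pow_const p)
  rw [setLIntegral_congr_fun measurableSet_Ioi h2, lintegral_const_mul _ hm2, mul_left_comm]
  congr 1
  rw [← lintegral_const_mul _ hm2, ← lintegral_indicator measurableSet_Ioi]
  refine lintegral_congr fun r => ?_
  rw [h1]
  by_cases hr : r ∈ Set.Ioi (0 : ℝ)
  · rw [Set.indicator_of_mem hr]; ring
  · rw [Set.indicator_of_notMem hr]
    have : κ r = 0 := by
      by_contra h0
      exact hr (hκ0 r h0)
    simp [this, hp]

/-- Hölder's inequality for the convolution integral. -/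
lemma lintegral_enorm_mul_sub_le {K g : Euc d → ℂ} (hK : Measurable K) (hg : Measurable g)
    {p p' : ℝ} (hpp : p.HolderConjugate p') (x : Euc d) :
    ∫⁻ t, ‖K t‖ₑ * ‖g (x - t)‖ₑ ≤
      (∫⁻ t, ‖K t‖ₑ ^ p) ^ (1 / p) * (∫⁻ t, ‖g t‖ₑ ^ p') ^ (1 / p') := by
  have h1 := ENNReal.lintegral_mul_le_Lp_mul_Lq volume hpp hK.enorm.aemeasurable
    (hg.comp (measurable_const.sub measurable_id : Measurable fun t : Euc d => x - t)).enorm.aemeasurable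
  refine h1.trans (le_of_eq ?_)
  congr 2
  exact lintegral_sub_left_eq_self (fun t => ‖g t‖ₑ ^ p') x

/-- Cubes of side 2^ℓ ≥ 1 have volume at least 1, so the cube norm bounds the suprema and the ℓ^p
sum controls the ℓ^{p'} sum for p' ≥ p. With p' conjugate to p ≤ 2, Hölder's inequality then gives
absolute convergence of K*g at every point. -/
lemma lintegral_rpow_lt_top_of_cube {g : Euc d → ℂ} {G : (Fin d → ℤ) → ℝ} {ℓ : ℕ}
    (hgG : ∀ y, ‖g y‖ ≤ G (cubeIndex (ℓ : ℤ) y)) {p p' : ℝ} (hp : 0 < p) (hpp : p ≤ p')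
    (hN : ∑' z, volume (dyadicCube (d := d) (ℓ : ℤ) z) * ENNReal.ofReal (G z) ^ p < ⊤) :
    ∫⁻ y, ‖g y‖ₑ ^ p' < ⊤ := by
  set N := ∑' z, volume (dyadicCube (d := d) (ℓ : ℤ) z) * ENNReal.ofReal (G z) ^ p with hNdef
  have hp' : 0 < p' := by linarith
  have hV : ∀ z, 1 ≤ volume (dyadicCube (d := d) (ℓ : ℤ) z) := by
    intro z
    rw [volume_dyadicCube, zpow_natCast]
    exact one_le_pow₀ (ENNReal.one_le_ofReal.2 (one_le_pow₀ one_le_two))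
  have hG : ∀ z, ENNReal.ofReal (G z) ^ (p' - p) ≤ (N ^ (1 / p)) ^ (p' - p) := by
    intro z
    refine ENNReal.rpow_le_rpow ?_ (by linarith)
    rw [one_div, ENNReal.le_rpow_inv_iff hp]
    exact (le_mul_of_one_le_left zero_le (hV z)).trans (ENNReal.le_tsum z)
  have hle : ∫⁻ y, ‖g y‖ₑ ^ p' ≤ N * (N ^ (1 / p)) ^ (p' - p) := by
    rw [lintegral_eq_tsum_dyadicCube (ℓ : ℤ), hNdef, ← ENNReal.tsum_mul_right]
    refine ENNReal.tsum_le_tsum fun z => ?_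
    calc ∫⁻ y in dyadicCube (ℓ : ℤ) z, ‖g y‖ₑ ^ p'
        ≤ ∫⁻ _ in dyadicCube (ℓ : ℤ) z, ENNReal.ofReal (G z) ^ p' := by
          refine setLIntegral_mono' (measurableSet_dyadicCube _ _) fun y hy => ?_
          refine ENNReal.rpow_le_rpow ?_ hp'.le
          rw [← ofReal_norm, ← mem_dyadicCube_iff.1 hy]
          exact ENNReal.ofReal_le_ofReal (hgG y)
      _ = volume (dyadicCube (d := d) (ℓ : ℤ) z) * (ENNReal.ofReal (G z) ^ p *
            ENNReal.ofReal (G z) ^ (p' - p)) := by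
          rw [setLIntegral_const, ← ENNReal.rpow_add_of_nonneg _ _ hp.le (by linarith), mul_comm]
          congr 2; ring
      _ ≤ _ := by
          rw [← mul_assoc]
          exact mul_le_mul_right (hG z) _
  refine hle.trans_lt (ENNReal.mul_lt_top hN ?_)
  exact ENNReal.rpow_lt_top_of_nonneg (by linarith)
    (ENNReal.rpow_lt_top_of_nonneg (by positivity) hN.ne).ne

end

section

variable {d : ℕ} {C : ℝ}

lemma measurable_conv {K g : Euc d → ℂ} (hK : Measurable K) (hg : Measurable g) :
    Measurable (conv K g) := by
  have h : Measurable fun q : Euc d × Euc d => K q.2 * g (q.1 - q.2) :=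
    (hK.comp measurable_snd).mul (hg.comp (by fun_prop))
  exact h.stronglyMeasurable.integral_prod_right'.measurable

lemma enorm_conv_le {K g : Euc d → ℂ} (hK : Measurable K) (hg : Measurable g)
    {p p' : ℝ} (hpp : p.HolderConjugate p') (x : Euc d) :
    ‖conv K g x‖ₑ ≤ (∫⁻ t, ‖K t‖ₑ ^ p) ^ (1 / p) * (∫⁻ t, ‖g t‖ₑ ^ p') ^ (1 / p') := by
  refine le_trans ?_ (lintegral_enorm_mul_sub_le hK hg hpp x)
  rw [conv_apply]
  refine (enorm_integral_le_lintegral_enorm _).trans (le_of_eq ?_)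
  simp only [enorm_mul]

lemma convExists_of_holder {K g : Euc d → ℂ} (hK : Measurable K) (hg : Measurable g)
    {p p' : ℝ} (hpp : p.HolderConjugate p') (hKp : ∫⁻ t, ‖K t‖ₑ ^ p < ⊤)
    (hgp : ∫⁻ t, ‖g t‖ₑ ^ p' < ⊤) : ConvExists K g := by
  intro x
  refine ⟨(hK.mul (hg.comp (by fun_prop))).aestronglyMeasurable, ?_⟩
  have h := lintegral_enorm_mul_sub_le hK hg hpp x
  simp only [HasFiniteIntegral, ContinuousLinearMap.mul_apply', enorm_mul]
  refine h.trans_lt (ENNReal.mul_lt_top ?_ ?_)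
  · exact ENNReal.rpow_lt_top_of_nonneg (by have := hpp.pos; positivity) hKp.ne
  · exact ENNReal.rpow_lt_top_of_nonneg (by have := hpp.symm.pos; positivity) hgp.ne

lemma convExists_of_bounded {ψ u : Euc d → ℂ} (hψ : Continuous ψ) (hψc : HasCompactSupport ψ)
    (hu : Measurable u) {D : ℝ} (hD : ∀ x, ‖u x‖ ≤ D) : ConvExists ψ u := by
  intro x
  exact (hψ.integrable_of_hasCompactSupport hψc).mul_bdd
    (hu.comp (by fun_prop)).aestronglyMeasurable (Filter.Eventually.of_forall fun t => hD (x - t))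

/-- Convergence of iterated convolutions under truncation. -/
lemma tendsto_conv_conv {ψ K g : Euc d → ℂ} (hψ : Continuous ψ) (hψc : HasCompactSupport ψ)
    {p p' : ℝ} (hpp : p.HolderConjugate p') (hK : Measurable K) (hg : Measurable g)
    (hKp : ∫⁻ t, ‖K t‖ₑ ^ p < ⊤) (hgp : ∫⁻ t, ‖g t‖ₑ ^ p' < ⊤) {Kn gn : ℕ → Euc d → ℂ}
    (hKn : ∀ n, Measurable (Kn n)) (hgn : ∀ n, Measurable (gn n))
    (hKle : ∀ n x, ‖Kn n x‖ ≤ ‖K x‖) (hgle : ∀ n x, ‖gn n x‖ ≤ ‖g x‖)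
    (hKt : ∀ x, Filter.Tendsto (fun n => Kn n x) Filter.atTop (nhds (K x)))
    (hgt : ∀ x, Filter.Tendsto (fun n => gn n x) Filter.atTop (nhds (g x))) (x : Euc d) :
    Filter.Tendsto (fun n => conv ψ (conv (Kn n) (gn n)) x) Filter.atTop
      (nhds (conv ψ (conv K g) x)) := by
  have hp := hpp.pos
  have hp' := hpp.symm.pos
  have hinner : ∀ w, Filter.Tendsto (fun n => conv (Kn n) (gn n) w) Filter.atTop
      (nhds (conv K g w)) := by
    intro w
    simp only [conv_apply]
    refine tendsto_integral_of_dominated_convergence (fun t => ‖K t * g (w - t)‖) (fun n => ?_)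
      (convExists_of_holder hK hg hpp hKp hgp w).norm (fun n => ?_) ?_
    · exact ((hKn n).mul ((hgn n).comp (by fun_prop))).aestronglyMeasurable
    · refine Filter.Eventually.of_forall fun t => ?_
      rw [norm_mul, norm_mul]
      exact mul_le_mul (hKle _ _) (hgle _ _) (norm_nonneg _) (norm_nonneg _)
    · exact Filter.Eventually.of_forall fun t => (hKt t).mul (hgt _)
  have hbd : ∀ n w, ‖conv (Kn n) (gn n) w‖ ≤
      ((∫⁻ t, ‖K t‖ₑ ^ p) ^ (1 / p) * (∫⁻ t, ‖g t‖ₑ ^ p') ^ (1 / p')).toReal := by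
    intro n w
    rw [← toReal_enorm]
    refine ENNReal.toReal_mono (ENNReal.mul_ne_top ?_ ?_)
      ((enorm_conv_le (hKn n) (hgn n) hpp w).trans (mul_le_mul' ?_ ?_))
    · exact ENNReal.rpow_ne_top_of_nonneg (by positivity) hKp.ne
    · exact ENNReal.rpow_ne_top_of_nonneg (by positivity) hgp.ne
    · refine ENNReal.rpow_le_rpow (lintegral_mono fun t => ?_) (by positivity)
      exact ENNReal.rpow_le_rpow (enorm_le_iff_norm_le.2 (hKle n t)) hp.le
    · refine ENNReal.rpow_le_rpow (lintegral_mono fun t => ?_) (by positivity)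
      exact ENNReal.rpow_le_rpow (enorm_le_iff_norm_le.2 (hgle n t)) hp'.le
  simp only [conv_apply (f := ψ)]
  refine tendsto_integral_of_dominated_convergence (fun t => ‖ψ t‖ *
    ((∫⁻ t, ‖K t‖ₑ ^ p) ^ (1 / p) * (∫⁻ t, ‖g t‖ₑ ^ p') ^ (1 / p')).toReal) (fun n => ?_)
      ((hψ.integrable_of_hasCompactSupport hψc).norm.mul_const _) (fun n => ?_) ?_
  · exact (hψ.measurable.mul ((measurable_conv (hKn n) (hgn n)).comp
      (by fun_prop))).aestronglyMeasurable
  · refine Filter.Eventually.of_forall fun t => ?_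
    rw [norm_mul]
    exact mul_le_mul_of_nonneg_left (hbd n _) (norm_nonneg _)
  · exact Filter.Eventually.of_forall fun t => (hinner _).const_mul _

/-- The estimate at scale one, for everywhere defined data. -/
lemma IsSphericalKernel.exists_lintegral_conv_rpow_le (hd : 4 ≤ d) {ψ : Euc d → ℂ}
    (hψ : Continuous ψ) (hψc : HasCompactSupport ψ)
    (hF : IsSphericalKernel (fun r => sphAvg ψ r) C) {δ p q : ℝ} (hδ : 0 < δ)
    (hδ' : 0 < ((d : ℝ) - 1) / 2 - 1 - δ) (hp : 1 < p) (hp2 : p ≤ 2) (hpq : p < q)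
    (hqa : q * (1 + (((d : ℝ) - 1) / 2 - δ)⁻¹) < 2) :
    ∃ C' > 0, ∀ (ℓ : ℕ) (κ : ℝ → ℂ) (g : Euc d → ℂ) (G : (Fin d → ℤ) → ℝ),
      Measurable κ → (∀ r, κ r ≠ 0 → 2 ^ ℓ < r) → Measurable g →
      (∀ y, ‖g y‖ ≤ G (cubeIndex (ℓ : ℤ) y)) → (∀ z, 0 ≤ G z) →
      ∑' z, volume (dyadicCube (d := d) (ℓ : ℤ) z) * ENNReal.ofReal (G z) ^ p < ⊤ →
      ∫⁻ x : Euc d, ‖κ ‖x‖‖ₑ ^ p < ⊤ →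
      ConvExists (fun z => κ ‖z‖) g ∧ ConvExists ψ (conv (fun z => κ ‖z‖) g) ∧
      sphereMeasure d Set.univ * ∫⁻ x, ‖conv ψ (conv (fun z => κ ‖z‖) g) x‖ₑ ^ p ≤
        ENNReal.ofReal (C' * 2 ^ (-((ℓ : ℝ) * (((d : ℝ) - 1) / 2 * ((q - p) / (q - 1)))))) *
          ((∑' z, volume (dyadicCube (d := d) (ℓ : ℤ) z) * ENNReal.ofReal (G z) ^ p) *
            ∫⁻ x : Euc d, ‖κ ‖x‖‖ₑ ^ p) := by
  obtain ⟨C', hC', hmain⟩ :=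
    hF.exists_lintegral_sphOp_rpow_le hd hδ hδ' hp hpq hqa
  refine ⟨C', hC', fun ℓ κ g G hκ hκ0 hg hgG hG hN hKp => ?_⟩
  have hd0 : 0 < d := by omega
  have h2 : (1 : ℝ) ≤ 2 ^ ℓ := one_le_pow₀ one_le_two
  have hpp : p.HolderConjugate (p / (p - 1)) := Real.HolderConjugate.conjExponent hp
  have hpp' : p ≤ p / (p - 1) := by
    rw [le_div_iff₀ (by linarith)]
    nlinarith
  have hKm : Measurable fun z : Euc d => κ ‖z‖ := hκ.comp measurable_norm
  have hgp := lintegral_rpow_lt_top_of_cube hgG (by linarith) hpp' hN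
  have hE := convExists_of_holder hKm hg hpp hKp hgp
  refine ⟨hE, convExists_of_bounded hψ hψc (measurable_conv hKm hg)
    (D := ((∫⁻ t : Euc d, ‖κ ‖t‖‖ₑ ^ p) ^ (1 / p) *
      (∫⁻ t, ‖g t‖ₑ ^ (p / (p - 1))) ^ (1 / (p / (p - 1)))).toReal) fun x => ?_, ?_⟩
  · have := hpp.symm.pos
    rw [← toReal_enorm]
    refine ENNReal.toReal_mono (ENNReal.mul_ne_top ?_ ?_) (enorm_conv_le hKm hg hpp x)
    · exact ENNReal.rpow_ne_top_of_nonneg (by positivity) hKp.ne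
    · exact ENNReal.rpow_ne_top_of_nonneg (by positivity) hgp.ne
  obtain ⟨A₀, hA₀⟩ := hψ.bounded_above_of_compact_support hψc
  obtain ⟨R₀, hR₀⟩ := hψc.isCompact.isBounded.exists_norm_le
  -- Truncated data give densities that are bounded, of bounded support and bounded below in modulus
  -- where they do not vanish. The estimate is uniform in `n`, and Fatou's lemma transfers it to the
  -- limit.
  set u : ℕ → Euc d → ℂ := fun n => conv ψ (conv (fun z => trunc n κ ‖z‖) (trunc n g)) with hu
  have hum : ∀ n, Measurable (u n) := fun n => measurable_conv hψ.measurable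
    (measurable_conv ((measurable_trunc hκ n).comp measurable_norm) (measurable_trunc hg n))
  have hlim : ∀ x, Filter.Tendsto (fun n => u n x) Filter.atTop
      (nhds (conv ψ (conv (fun z => κ ‖z‖) g) x)) := fun x =>
    tendsto_conv_conv hψ hψc hpp hKm hg hKp hgp
      (fun n => (measurable_trunc hκ n).comp measurable_norm) (fun n => measurable_trunc hg n)
      (fun n x => norm_trunc_le n _) (fun n x => norm_trunc_le n _)
      (fun x => tendsto_trunc _) (fun x => tendsto_trunc _) x
  have hκr : ∀ n r, trunc n κ r ≠ 0 → 2 ^ ℓ < r ∧ r ≤ n + 1 := by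
    intro n r hr
    obtain ⟨h1, h2, -, -⟩ := trunc_ne_zero hr
    exact ⟨hκ0 r (h1 ▸ hr), (le_abs_self r).trans h2⟩
  have hbound : ∀ n, ∫⁻ x, ‖u n x‖ₑ ^ p ≤
      ENNReal.ofReal (C' * 2 ^ (-((ℓ : ℝ) * (((d : ℝ) - 1) / 2 * ((q - p) / (q - 1)))))) *
        wmass fun (y : Euc d) r => ENNReal.ofReal ((G (cubeIndex (ℓ : ℤ) y) * ‖κ r‖) ^ p) := by
    intro n
    have hn : (0 : ℝ) < n + 1 := by positivity
    have hid : ∀ x, u n x =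
        sphOp (fun r => sphAvg ψ r) (fun y r => trunc n g y * trunc n κ r) x := by
      intro x
      refine conv_conv_eq_sphOp hd0 hψ hF (measurable_trunc hκ n) (measurable_trunc hg n)
        (A := max A₀ (n + 1)) (R := max R₀ (n + 1)) (le_max_of_le_right hn.le)
        (fun x => le_max_of_le_left (hA₀ x)) (fun r => le_max_of_le_right (norm_trunc_le_nat n r))
        (fun r => le_max_of_le_right (norm_trunc_le_nat n r))
        (fun x hx => le_max_of_le_left (hR₀ x (subset_tsupport _ hx)))
        (fun r hr => ⟨by linarith [(hκr n r hr).1], le_max_of_le_right (hκr n r hr).2⟩)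
        (fun x hx => le_max_of_le_right (trunc_ne_zero hx).2.1) x
    simp only [hid]
    refine hmain ℓ _ ((1 / ((n : ℝ) + 1)) * (1 / ((n : ℝ) + 1)))
      -- The majorant is formed from the untruncated data, so the bound does not depend on `n`; it
      -- depends on y only through its cube.
      (fun y r => G (cubeIndex (ℓ : ℤ) y) * ‖κ r‖) ⟨?_, ?_, ?_⟩ (by positivity) ?_ ?_ ?_ ?_ ?_
    · exact ((measurable_trunc hg n).comp measurable_fst).mul
        ((measurable_trunc hκ n).comp measurable_snd)
    · refine ⟨(n + 1) * (n + 1), fun y r => ?_⟩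
      rw [norm_mul]
      exact mul_le_mul (norm_trunc_le_nat n y) (norm_trunc_le_nat n r) (norm_nonneg _) hn.le
    · refine ⟨n + 1, fun y r h => ?_⟩
      have h1 := hκr n r (right_ne_zero_of_mul h)
      exact ⟨by linarith, h1.2, (trunc_ne_zero (left_ne_zero_of_mul h)).2.1⟩
    · intro y r h
      have h1 := trunc_ne_zero (left_ne_zero_of_mul h)
      have h2 := trunc_ne_zero (right_ne_zero_of_mul h)
      rw [norm_mul, h1.1, h2.1]
      exact mul_le_mul h1.2.2.1 h2.2.2.1 (by positivity) (norm_nonneg _)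
    · exact fun y r h => (hκr n r (right_ne_zero_of_mul h)).1.le
    · exact ((Measurable.of_discrete (f := G)).comp
        ((measurable_cubeIndex _).comp measurable_fst)).mul (hκ.comp measurable_snd).norm
    · intro y r
      rw [norm_mul]
      exact mul_le_mul ((norm_trunc_le n y).trans (hgG y)) (norm_trunc_le n r) (norm_nonneg _)
        (hG _)
    · intro z y hy y' hy' r
      rw [mem_dyadicCube_iff.1 hy, mem_dyadicCube_iff.1 hy']
  have hfatou : ∫⁻ x, ‖conv ψ (conv (fun z => κ ‖z‖) g) x‖ₑ ^ p ≤
      ENNReal.ofReal (C' * 2 ^ (-((ℓ : ℝ) * (((d : ℝ) - 1) / 2 * ((q - p) / (q - 1)))))) *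
        wmass fun (y : Euc d) r => ENNReal.ofReal ((G (cubeIndex (ℓ : ℤ) y) * ‖κ r‖) ^ p) := by
    calc ∫⁻ x, ‖conv ψ (conv (fun z => κ ‖z‖) g) x‖ₑ ^ p
        = ∫⁻ x, Filter.liminf (fun n => ‖u n x‖ₑ ^ p) Filter.atTop := by
          refine lintegral_congr fun x => ?_
          exact (((ENNReal.continuous_rpow_const).tendsto _).comp (hlim x).enorm).liminf_eq.symm
      _ ≤ Filter.liminf (fun n => ∫⁻ x, ‖u n x‖ₑ ^ p) Filter.atTop :=
          lintegral_liminf_le fun n => (hum n).enorm.pow_const p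
      _ ≤ _ := Filter.liminf_le_of_le (by isBoundedDefault) fun b hb => by
          obtain ⟨n, hn⟩ := hb.exists
          exact hn.trans (hbound n)
  rw [← wmass_majorant hd0 hκ (fun r hr => by linarith [hκ0 r hr]) hG (by linarith) (ℓ : ℤ),
    mul_left_comm]
  exact mul_le_mul_right hfatou _

end

/-! ### Choice of exponents and behaviour under dilation. -/

section

variable {d : ℕ}

lemma four_le_of_one_lt_criticalExponent {p : ℝ} (hp : 1 < p) (hpd : p < criticalExponent d) :
    4 ≤ d := by
  have h : 1 < criticalExponent d := hp.trans hpd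
  rw [criticalExponent, lt_div_iff₀ (by positivity)] at h
  have : (3 : ℝ) < d := by linarith
  exact_mod_cast this

/-- Choice of the interpolation exponent. -/
lemma exists_interpolation_exponents {p ε : ℝ} (hp : 1 < p) (hpd : p < criticalExponent d)
    (hε : ε < ((d : ℝ) - 1) * (1 / p - 1 / criticalExponent d)) :
    ∃ δ q : ℝ, 0 < δ ∧ 0 < ((d : ℝ) - 1) / 2 - 1 - δ ∧ p < q ∧
      q * (1 + (((d : ℝ) - 1) / 2 - δ)⁻¹) < 2 ∧
      ε ≤ (((d : ℝ) - 1) / 2 * ((q - p) / (q - 1))) * (1 / p) := by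
  have hd4 : (4 : ℝ) ≤ d := by exact_mod_cast four_le_of_one_lt_criticalExponent hp hpd
  set P := criticalExponent d with hP
  have hP1 : 1 < P := hp.trans hpd
  have hP2 : P * (d + 1) = 2 * d - 2 := by
    rw [hP, criticalExponent, div_mul_cancel₀ _ (by positivity)]
  have hPle : P ≤ 2 := by nlinarith
  -- The interpolated gain at the endpoint q = P. It dominates the one in the hypothesis because
  -- 2(P-1) ≤ P, that is P ≤ 2; by continuity it persists for q slightly below P.
  have hεP : ε < (((d : ℝ) - 1) / 2 * ((P - p) / (P - 1))) * (1 / p) := by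
    refine hε.trans_le ?_
    have e1 : ((d : ℝ) - 1) * (1 / p - 1 / P) = ((d : ℝ) - 1) * (1 / p) * ((P - p) / P) := by
      field_simp
    have e2 : (((d : ℝ) - 1) / 2 * ((P - p) / (P - 1))) * (1 / p) =
        ((d : ℝ) - 1) * (1 / p) * ((P - p) / (2 * (P - 1))) := by
      have : P - 1 ≠ 0 := by linarith
      field_simp
    rw [e1, e2]
    refine mul_le_mul_of_nonneg_left ?_ (mul_nonneg (by linarith) (by positivity))
    exact div_le_div_of_nonneg_left (by linarith) (by linarith) (by linarith)
  have hc : ContinuousAt (fun q : ℝ => (((d : ℝ) - 1) / 2 * ((q - p) / (q - 1))) * (1 / p)) P := by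
    have : P - 1 ≠ 0 := by linarith
    fun_prop (disch := assumption)
  obtain ⟨q, hq1, hq2, hq3⟩ := (((hc.eventually (lt_mem_nhds hεP)).filter_mono
    nhdsWithin_le_nhds).and (Ioo_mem_nhdsLT hpd)).exists
  -- At δ = 0 the weak type condition is exactly q < P; continuity then gives a small δ > 0.
  have hqP : q * (1 + (((d : ℝ) - 1) / 2 - 0)⁻¹) < 2 := by
    rw [sub_zero, inv_div, ← sub_pos]
    have h1 : (0 : ℝ) < d - 1 := by linarith
    have e : 2 - q * (1 + 2 / ((d : ℝ) - 1)) = (P - q) * (d + 1) / (d - 1) := by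
      field_simp
      linarith
    rw [e]
    exact div_pos (mul_pos (by linarith) (by linarith)) h1
  have hc2 : ContinuousAt (fun δ : ℝ => q * (1 + (((d : ℝ) - 1) / 2 - δ)⁻¹)) 0 := by
    have : ((d : ℝ) - 1) / 2 - 0 ≠ 0 := by linarith
    fun_prop (disch := assumption)
  obtain ⟨δ, hδ1, hδ2, hδ3⟩ := (((hc2.eventually (gt_mem_nhds hqP)).filter_mono
    nhdsWithin_le_nhds).and (Ioo_mem_nhdsGT (show (0 : ℝ) < 1 / 4 by norm_num))).exists
  exact ⟨δ, q, hδ2, by linarith, hq2, hδ1, hq1.le⟩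

lemma conv_congr_ae {f f' g g' : Euc d → ℂ} (hf : f =ᵐ[volume] f') (hg : g =ᵐ[volume] g') :
    conv f g = conv f' g' := by
  ext x
  rw [conv_apply, conv_apply]
  refine integral_congr_ae ?_
  filter_upwards [hf, (quasiMeasurePreserving_sub_left volume x).ae hg] with t h1 h2
  rw [h1, h2]

lemma ConvExists.congr_ae {f f' g g' : Euc d → ℂ} (h : ConvExists f g) (hf : f =ᵐ[volume] f')
    (hg : g =ᵐ[volume] g') : ConvExists f' g' := by
  intro x
  refine (h x).congr ?_
  filter_upwards [hf, (quasiMeasurePreserving_sub_left volume x).ae hg] with t h1 h2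
  rw [h1, h2]

/-- The dilation moves from the kernel to the function and the result; used for both convolutions,
this reduces every `s` to `s = 0`. -/
lemma conv_dilate (s : ℤ) (a g : Euc d → ℂ) :
    conv (dilate s a) g = fun x => conv a (fun y => g ((2 : ℝ) ^ (-s) • y)) ((2 : ℝ) ^ s • x) := by
  ext x
  have h2 : (2 : ℝ) ^ (-s) * (2 : ℝ) ^ s = 1 := by rw [← zpow_add₀ two_ne_zero]; simp
  have h := Measure.integral_comp_smul volume
    (fun u : Euc d => a u * g ((2 : ℝ) ^ (-s) • ((2 : ℝ) ^ s • x - u))) ((2 : ℝ) ^ s)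
  rw [conv_apply, conv_apply]
  simp only [dilate, mul_assoc, integral_const_mul]
  simp only [smul_sub, smul_smul, h2, one_smul, finrank_euclideanSpace_fin] at h ⊢
  rw [h, Complex.real_smul, ← mul_assoc]
  have e : (2 : ℂ) ^ (s * (d : ℤ)) * ((|(((2 : ℝ) ^ s) ^ d)⁻¹| : ℝ) : ℂ) = 1 := by
    rw [abs_of_pos (by positivity), zpow_mul, zpow_natCast]
    push_cast
    exact mul_inv_cancel₀ (pow_ne_zero _ (zpow_ne_zero _ two_ne_zero))
  rw [e, one_mul]

lemma convExists_dilate {s : ℤ} {a g : Euc d → ℂ}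
    (h : ConvExists a fun y => g ((2 : ℝ) ^ (-s) • y)) : ConvExists (dilate s a) g := by
  intro x
  have h2 : (2 : ℝ) ^ (-s) * (2 : ℝ) ^ s = 1 := by rw [← zpow_add₀ two_ne_zero]; simp
  have h1 := ((integrable_comp_smul_iff volume _ (by positivity : (2 : ℝ) ^ s ≠ 0)).2
    (h ((2 : ℝ) ^ s • x))).const_mul ((2 : ℂ) ^ (s * (d : ℤ)))
  refine h1.congr (Filter.Eventually.of_forall fun t => ?_)
  simp only [ContinuousLinearMap.mul_apply', dilate, smul_sub, smul_smul, h2, one_smul, mul_assoc]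

lemma eLpNorm_comp_smul {c : ℝ} (hc : c ≠ 0) (F : Euc d → ℂ) (p : ℝ≥0∞) :
    eLpNorm (fun x => F (c • x)) p volume =
      ENNReal.ofReal |(c ^ d)⁻¹| ^ (1 / p).toReal * eLpNorm F p volume := by
  have hemb : MeasurableEmbedding fun x : Euc d => c • x :=
    (Homeomorph.smulOfNeZero c hc).measurableEmbedding
  have h := hemb.eLpNorm_map_measure (μ := volume) (g := F) (p := p)
  rw [Measure.map_addHaar_smul volume hc, eLpNorm_smul_measure_of_ne_zero (by simp [hc]),
    finrank_euclideanSpace_fin] at h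
  exact h.symm

lemma smul_mem_dyadicCube_iff {ν s : ℤ} {z : Fin d → ℤ} {y : Euc d} :
    (2 : ℝ) ^ (-s) • y ∈ dyadicCube (ν - s) z ↔ y ∈ dyadicCube ν z := by
  have h2 : (0 : ℝ) < (2 : ℝ) ^ (-s) := by positivity
  have e : (2 : ℝ) ^ (ν - s) = 2 ^ (-s) * 2 ^ ν := by
    rw [← zpow_add₀ two_ne_zero]; congr 1; ring
  refine forall_congr' fun i => ?_
  rw [e, PiLp.smul_apply, smul_eq_mul, mul_left_comm, mul_left_comm _ ((2 : ℝ) ^ (-s)),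
    mul_le_mul_iff_right₀ h2, mul_lt_mul_iff_right₀ h2]

/-- Dilation by 2^s matches the cubes of the two generations and preserves essential suprema, so
only the factor 2^{-sd} in the volumes is left. An L^p norm acquires the same factor. -/
lemma cubeNorm_comp_smul {p : ℝ} (hp : 0 < p) (ν s : ℤ) (g : Euc d → ℂ) :
    cubeNorm p (ν - s) g = ENNReal.ofReal |(((2 : ℝ) ^ s) ^ d)⁻¹| ^ (1 / p) *
      cubeNorm p ν fun y => g ((2 : ℝ) ^ (-s) • y) := by
  have h2 : (0 : ℝ) < (2 : ℝ) ^ (-s) := by positivity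
  rw [cubeNorm, cubeNorm, ← ENNReal.mul_rpow_of_nonneg _ _ (by positivity), ← ENNReal.tsum_mul_left]
  congr 1
  refine tsum_congr fun z => ?_
  have e1 : (dyadicCube ν z).indicator (fun y : Euc d => g ((2 : ℝ) ^ (-s) • y)) =
      fun y => (dyadicCube (ν - s) z).indicator g ((2 : ℝ) ^ (-s) • y) := by
    ext y
    by_cases hy : y ∈ dyadicCube ν z
    · rw [Set.indicator_of_mem hy, Set.indicator_of_mem (smul_mem_dyadicCube_iff.2 hy)]
    · rw [Set.indicator_of_notMem hy,
        Set.indicator_of_notMem fun h => hy (smul_mem_dyadicCube_iff.1 h)]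
  rw [e1, eLpNorm_comp_smul h2.ne', volume_dyadicCube, volume_dyadicCube, ← mul_assoc]
  congr 2
  · rw [← ENNReal.ofReal_pow (by positivity), ← ENNReal.ofReal_pow (by positivity),
      ← ENNReal.ofReal_mul (by positivity), abs_of_pos (by positivity), ← inv_pow, ← mul_pow,
      ← zpow_neg, ← zpow_add₀ two_ne_zero]
    congr 3; ring
  · simp

end

/-! ### The estimate at scale one for measurable data. -/

section

variable {d : ℕ} {C : ℝ}

lemma eLpNorm_ofReal_eq {f : Euc d → ℂ} {p : ℝ} (hp : 0 < p) :
    eLpNorm f (ENNReal.ofReal p) volume = (∫⁻ x, ‖f x‖ₑ ^ p) ^ (1 / p) := by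
  rw [eLpNorm_eq_lintegral_rpow_enorm_toReal (by simpa using hp) ENNReal.ofReal_ne_top,
    ENNReal.toReal_ofReal hp.le]

lemma eLpNorm_indicator_dyadicCube_lt_top {p : ℝ} (hp : 0 < p) {ν : ℤ} {g : Euc d → ℂ}
    (h : cubeNorm p ν g < ⊤) (z : Fin d → ℤ) :
    eLpNorm ((dyadicCube ν z).indicator g) ∞ volume < ⊤ := by
  have h1 := (ENNReal.rpow_lt_top_iff_of_pos (by positivity)).1 h
  have h2 := (ENNReal.le_tsum z).trans_lt h1
  by_contra h3
  rw [not_lt, top_le_iff] at h3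
  have hv : volume (dyadicCube (d := d) ν z) ≠ 0 := by
    rw [volume_dyadicCube]
    exact pow_ne_zero _ (by simpa using zpow_pos two_pos ν)
  rw [h3, ENNReal.top_rpow_of_pos hp, ENNReal.mul_top hv] at h2
  exact lt_irrefl _ h2

/-- A representative dominated everywhere by its essential suprema on the dyadic cubes. -/
lemma exists_representative_le {p : ℝ} (hp : 0 < p) {ν : ℤ} {g : Euc d → ℂ}
    (hg : AEStronglyMeasurable g volume) (h : cubeNorm p ν g < ⊤) :
    ∃ g' : Euc d → ℂ, Measurable g' ∧ g =ᵐ[volume] g' ∧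
      ∀ y, ‖g' y‖ ≤ (eLpNorm ((dyadicCube ν (cubeIndex ν y)).indicator g) ∞ volume).toReal := by
  set G : (Fin d → ℤ) → ℝ := fun z => (eLpNorm ((dyadicCube ν z).indicator g) ∞ volume).toReal
    with hG
  obtain ⟨g₀, hg₀, hgg₀⟩ := hg
  have hGm : Measurable fun y : Euc d => G (cubeIndex ν y) :=
    (Measurable.of_discrete (f := G)).comp (measurable_cubeIndex ν)
  refine ⟨{y | ‖g₀ y‖ ≤ G (cubeIndex ν y)}.indicator g₀,
    hg₀.measurable.indicator (measurableSet_le hg₀.measurable.norm hGm), ?_, fun y => ?_⟩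
  · have hall : ∀ᵐ y : Euc d, ∀ z, ‖(dyadicCube ν z).indicator g y‖ₑ ≤
        eLpNorm ((dyadicCube ν z).indicator g) ∞ volume := by
      refine ae_all_iff.2 fun z => ?_
      rw [eLpNorm_exponent_top]
      exact ae_le_eLpNormEssSup
    filter_upwards [hgg₀, hall] with y h1 h2
    have h3 := h2 (cubeIndex ν y)
    rw [Set.indicator_of_mem (mem_dyadicCube_cubeIndex ν y), h1, ← ofReal_norm,
      ENNReal.ofReal_le_iff_le_toReal (eLpNorm_indicator_dyadicCube_lt_top hp h _).ne] at h3
    rw [h1, Set.indicator_of_mem (show y ∈ {y | ‖g₀ y‖ ≤ G (cubeIndex ν y)} from h3)]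
  · by_cases hy : y ∈ {y | ‖g₀ y‖ ≤ G (cubeIndex ν y)}
    · rw [Set.indicator_of_mem hy]; exact hy
    · rw [Set.indicator_of_notMem hy, norm_zero]; exact ENNReal.toReal_nonneg

/-- The estimate at scale one. -/
lemma exists_eLpNorm_conv_conv_le {p ε : ℝ} (hp : 1 < p) (hpd : p < criticalExponent d)
    (hε : ε < ((d : ℝ) - 1) * (1 / p - 1 / criticalExponent d)) {ψ₀ : Euc d → ℂ}
    (hψ₀ : IsAdmissible ψ₀) :
    ∃ B : ℝ≥0, ∀ (ℓ : ℕ) (K : Euc d → ℂ), MemLp K (ENNReal.ofReal p) volume → IsRadial K →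
      Function.support K ⊆ {x | (2 : ℝ) ^ ℓ < ‖x‖} →
      ∀ g : Euc d → ℂ, AEStronglyMeasurable g volume →
        (cubeNorm p (ℓ : ℤ) g < (⊤ : ℝ≥0∞) →
          ConvExists K g ∧ ConvExists (conv ψ₀ ψ₀) (conv K g)) ∧
        eLpNorm (conv (conv ψ₀ ψ₀) (conv K g)) (ENNReal.ofReal p) volume ≤
          (B : ℝ≥0∞) * eLpNorm K (ENNReal.ofReal p) volume *
            ENNReal.ofReal ((2 : ℝ) ^ (-((ℓ : ℝ) * ε))) * cubeNorm p (ℓ : ℤ) g := by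
  have hd := four_le_of_one_lt_criticalExponent hp hpd
  have hp0 : 0 < p := by linarith
  have hp2 : p ≤ 2 := by
    refine hpd.le.trans ?_
    rw [criticalExponent, div_le_iff₀ (by positivity)]
    linarith
  obtain ⟨δ, q, hδ, hδ', hpq, hqa, hexp⟩ := exists_interpolation_exponents hp hpd hε
  obtain ⟨C, hF⟩ := hψ₀.exists_isSphericalKernel (by omega)
  obtain ⟨C', hC', hmain⟩ := hF.exists_lintegral_conv_rpow_le hd
    hψ₀.contDiff_conv_self.continuous hψ₀.hasCompactSupport_conv_self hδ hδ' hp hp2 hpq hqa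
  set S := sphereMeasure d Set.univ with hS
  have hS0 : S ≠ 0 := by
    have : Nonempty (Fin d) := ⟨⟨0, by omega⟩⟩
    rw [hS, Measure.toSphere_apply_univ, finrank_euclideanSpace_fin]
    exact mul_ne_zero (by exact_mod_cast (by omega : d ≠ 0))
      (Metric.measure_ball_pos _ _ one_pos).ne'
  have hStop : S ≠ ⊤ := measure_ne_top _ _
  -- The maximum with 1 keeps `B` nonzero, so that the right side is really infinite when the cube
  -- norm is infinite and `K` is not null. The factor S⁻¹ is due to `wmass`, which omits the total
  -- mass of the sphere.
  set B : ℝ≥0 := max 1 ((S⁻¹ * ENNReal.ofReal C') ^ (1 / p)).toNNReal with hB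
  have hB1 : (S⁻¹ * ENNReal.ofReal C') ^ (1 / p) ≤ (B : ℝ≥0∞) := by
    rw [← ENNReal.coe_toNNReal (ENNReal.rpow_ne_top_of_nonneg (by positivity)
      (ENNReal.mul_ne_top (ENNReal.inv_ne_top.2 hS0) ENNReal.ofReal_ne_top) :
      (S⁻¹ * ENNReal.ofReal C') ^ (1 / p) ≠ ⊤)]
    exact ENNReal.coe_le_coe.2 (le_max_right _ _)
  have hB0 : (B : ℝ≥0∞) ≠ 0 :=
    ENNReal.coe_ne_zero.2 (lt_of_lt_of_le one_pos (le_max_left _ _)).ne'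
  refine ⟨B, fun ℓ K hK hrad hsupp g hg => ?_⟩
  by_cases hN : cubeNorm p (ℓ : ℤ) g < ⊤
  swap
  · refine ⟨fun h => absurd h hN, ?_⟩
    rw [not_lt, top_le_iff] at hN
    -- In extended arithmetic 0 · ∞ = 0, so a null `K` is treated apart: then both convolutions
    -- vanish identically.
    by_cases hK0 : eLpNorm K (ENNReal.ofReal p) volume = 0
    · have hK0' := (eLpNorm_eq_zero_iff hK.1 (by simpa using hp0)).1 hK0
      have : conv K g = 0 := by
        ext x
        rw [conv_congr_ae hK0' Filter.EventuallyEq.rfl, conv_apply]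
        simp
      have h2 : conv (conv ψ₀ ψ₀) (conv K g) = 0 := by
        ext x
        rw [this, conv_apply]
        simp
      rw [h2, eLpNorm_zero]
      exact zero_le
    · rw [hN, ENNReal.mul_top (mul_ne_zero (mul_ne_zero hB0 hK0)
        (by simpa using Real.rpow_pos_of_pos two_pos _))]
      exact le_top
  obtain ⟨κ, hκ, hκ0, hKκ⟩ := exists_measurable_profile (by omega) hK.1 hrad hsupp
  obtain ⟨g', hg', hgg', hg'G⟩ := exists_representative_le hp0 hg hN
  set G : (Fin d → ℤ) → ℝ := fun z =>
    (eLpNorm ((dyadicCube (ℓ : ℤ) z).indicator g) ∞ volume).toReal with hG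
  have hGE : ∀ z, ENNReal.ofReal (G z) = eLpNorm ((dyadicCube (ℓ : ℤ) z).indicator g) ∞ volume :=
    fun z => ENNReal.ofReal_toReal (eLpNorm_indicator_dyadicCube_lt_top hp0 hN z).ne
  set N := ∑' z, volume (dyadicCube (d := d) (ℓ : ℤ) z) * ENNReal.ofReal (G z) ^ p with hNdef
  have hNeq : cubeNorm p (ℓ : ℤ) g = N ^ (1 / p) := by
    simp only [hNdef, hGE]
    rfl
  have hN' : N < ⊤ := by
    rw [hNeq] at hN
    exact (ENNReal.rpow_lt_top_iff_of_pos (by positivity)).1 hN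
  have hKeq : eLpNorm K (ENNReal.ofReal p) volume = (∫⁻ x : Euc d, ‖κ ‖x‖‖ₑ ^ p) ^ (1 / p) := by
    rw [eLpNorm_congr_ae hKκ, eLpNorm_ofReal_eq hp0]
  have hKp : ∫⁻ x : Euc d, ‖κ ‖x‖‖ₑ ^ p < ⊤ := by
    have := hK.2
    rw [hKeq] at this
    exact (ENNReal.rpow_lt_top_iff_of_pos (by positivity)).1 this
  obtain ⟨h1, h2, h3⟩ := hmain ℓ κ g' G hκ hκ0 hg' hg'G (fun z => ENNReal.toReal_nonneg) hN' hKp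
  have hconv := conv_congr_ae hKκ hgg'
  refine ⟨fun _ => ⟨h1.congr_ae hKκ.symm hgg'.symm, hconv ▸ h2⟩, ?_⟩
  rw [hconv, eLpNorm_ofReal_eq hp0, hKeq, hNeq]
  set E := (2 : ℝ) ^ (-((ℓ : ℝ) * (((d : ℝ) - 1) / 2 * ((q - p) / (q - 1))))) with hE
  have hEε : ENNReal.ofReal E ^ (1 / p) ≤ ENNReal.ofReal ((2 : ℝ) ^ (-((ℓ : ℝ) * ε))) := by
    rw [ENNReal.ofReal_rpow_of_nonneg (by positivity) (by positivity), hE,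
      ← Real.rpow_mul two_pos.le]
    refine ENNReal.ofReal_le_ofReal (Real.rpow_le_rpow_of_exponent_le one_le_two ?_)
    rw [neg_mul, mul_assoc]
    exact neg_le_neg (mul_le_mul_of_nonneg_left hexp (Nat.cast_nonneg ℓ))
  have h4 : ∫⁻ x, ‖conv (conv ψ₀ ψ₀) (conv (fun z => κ ‖z‖) g') x‖ₑ ^ p ≤
      (S⁻¹ * ENNReal.ofReal C') * (∫⁻ x : Euc d, ‖κ ‖x‖‖ₑ ^ p) * ENNReal.ofReal E * N := by
    rw [mul_comm S, ← ENNReal.le_div_iff_mul_le (Or.inl hS0) (Or.inl hStop), div_eq_mul_inv,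
      ENNReal.ofReal_mul hC'.le] at h3
    refine h3.trans (le_of_eq ?_)
    ring
  calc _ ≤ ((S⁻¹ * ENNReal.ofReal C') * (∫⁻ x : Euc d, ‖κ ‖x‖‖ₑ ^ p) * ENNReal.ofReal E * N) ^
        (1 / p) := ENNReal.rpow_le_rpow h4 (by positivity)
    _ = (S⁻¹ * ENNReal.ofReal C') ^ (1 / p) * (∫⁻ x : Euc d, ‖κ ‖x‖‖ₑ ^ p) ^ (1 / p) *
        ENNReal.ofReal E ^ (1 / p) * N ^ (1 / p) := by
      have hp1 : 0 ≤ 1 / p := by positivity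
      rw [ENNReal.mul_rpow_of_nonneg _ _ hp1, ENNReal.mul_rpow_of_nonneg _ _ hp1,
        ENNReal.mul_rpow_of_nonneg _ _ hp1]
    _ ≤ _ := by gcongr

end

end RadialMultiplier

theorem proposition6p1 (d : ℕ) (p ε : ℝ)
    (hp : 1 < p) (hpd : p < RadialMultiplier.criticalExponent d)
    (hε : ε < ((d : ℝ) - 1) * (1 / p - 1 / RadialMultiplier.criticalExponent d))
    (ψ₀ : EuclideanSpace ℝ (Fin d) → ℂ) (hψ₀ : RadialMultiplier.IsAdmissible ψ₀) :
    ∃ C : ℝ≥0, ∀ (ℓ : ℕ) (K : EuclideanSpace ℝ (Fin d) → ℂ),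
      MemLp K (ENNReal.ofReal p) volume →
      RadialMultiplier.IsRadial K →
      Function.support K ⊆ {x | (2 : ℝ) ^ ℓ < ‖x‖} →
      ∀ (s : ℤ) (g : EuclideanSpace ℝ (Fin d) → ℂ),
        AEStronglyMeasurable g volume →
        (RadialMultiplier.cubeNorm p ((ℓ : ℤ) - s) g < (⊤ : ℝ≥0∞) →
          RadialMultiplier.ConvExists (RadialMultiplier.dilate s K) g ∧
          RadialMultiplier.ConvExists
            (RadialMultiplier.dilate s (RadialMultiplier.conv ψ₀ ψ₀))
            (RadialMultiplier.conv (RadialMultiplier.dilate s K) g)) ∧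
        eLpNorm
            (RadialMultiplier.conv
              (RadialMultiplier.dilate s (RadialMultiplier.conv ψ₀ ψ₀))
              (RadialMultiplier.conv (RadialMultiplier.dilate s K) g))
            (ENNReal.ofReal p) volume
          ≤ (C : ℝ≥0∞) * eLpNorm K (ENNReal.ofReal p) volume
              * ENNReal.ofReal ((2 : ℝ) ^ (-((ℓ : ℝ) * ε)))
              * RadialMultiplier.cubeNorm p ((ℓ : ℤ) - s) g := by
  obtain ⟨B, hB⟩ := RadialMultiplier.exists_eLpNorm_conv_conv_le hp hpd hε hψ₀
  refine ⟨B, fun ℓ K hK hrad hsupp s g hg => ?_⟩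
  have hp0 : 0 < p := by linarith
  have h2 : (2 : ℝ) ^ (-s) ≠ 0 := by positivity
  have h2' : (2 : ℝ) ^ s ≠ 0 := by positivity
  have hg' : AEStronglyMeasurable (fun y => g ((2 : ℝ) ^ (-s) • y)) volume :=
    hg.comp_quasiMeasurePreserving ⟨measurable_const_smul _, by
      rw [Measure.map_addHaar_smul volume h2]
      exact Measure.smul_absolutelyContinuous⟩
  obtain ⟨hex, hle⟩ := hB ℓ K hK hrad hsupp _ hg'
  -- The factor 2^{-sd/p} by which the left side and the cube norm both scale.
  set c := ENNReal.ofReal |(((2 : ℝ) ^ s) ^ d)⁻¹| ^ (1 / p) with hc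
  have hc0 : c ≠ 0 := by
    rw [hc]
    have h3 : ENNReal.ofReal |(((2 : ℝ) ^ s) ^ d)⁻¹| ≠ 0 := by
      simpa using pow_pos (zpow_pos (two_pos (α := ℝ)) s) d
    exact (ENNReal.rpow_pos (pos_iff_ne_zero.2 h3) ENNReal.ofReal_ne_top).ne'
  have hcn := RadialMultiplier.cubeNorm_comp_smul hp0 (ℓ : ℤ) s g
  rw [← hc] at hcn
  have hinner : (fun y => RadialMultiplier.conv (RadialMultiplier.dilate s K) g
      ((2 : ℝ) ^ (-s) • y)) =
      RadialMultiplier.conv K (fun y => g ((2 : ℝ) ^ (-s) • y)) := by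
    ext y
    rw [RadialMultiplier.conv_dilate]
    simp only [smul_smul]
    rw [← zpow_add₀ two_ne_zero, add_neg_cancel, zpow_zero, one_smul]
  refine ⟨fun h => ?_, ?_⟩
  · have h3 : RadialMultiplier.cubeNorm p (ℓ : ℤ) (fun y => g ((2 : ℝ) ^ (-s) • y)) < ⊤ := by
      rw [hcn] at h
      exact lt_top_iff_ne_top.2 fun h4 => h.ne (by rw [h4, ENNReal.mul_top hc0])
    obtain ⟨h4, h5⟩ := hex h3
    refine ⟨RadialMultiplier.convExists_dilate h4, RadialMultiplier.convExists_dilate ?_⟩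
    rw [hinner]
    exact h5
  · rw [RadialMultiplier.conv_dilate, hinner, RadialMultiplier.eLpNorm_comp_smul h2', hcn]
    have e : (1 / ENNReal.ofReal p).toReal = 1 / p := by
      rw [one_div, ENNReal.toReal_inv, ENNReal.toReal_ofReal hp0.le, one_div]
    rw [e, ← hc]
    refine (mul_le_mul_right hle c).trans (le_of_eq ?_)
    ring
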